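/- For $q\in(1,2]$ and $(d_i)\in\{0,1\}^{\mathbb N}$ write $(d_1d_2\ldots)_q:=\sum_{i\ge1}d_iq^{-i}$. For $x>0$ let $\mathscr U(x)$ be the set of $q\in(1,2]$ for which there is exactly one $(d_i)\in\{0,1\}^{\mathbb N}$ with $(d_1d_2\ldots)_q=x$, and let $q_s(x):=\inf\mathscr U(x)$. Let $(\tau_i)_{i\ge0}$ be the Thue–Morse sequence ($\tau_i\in\{0,1\}$ is the parity of the number of $1$'s in the binary expansion of $i$). Let $\overline{w}$ be the digitwise reflection $0\leftrightarrow1$ of a word $w$, and let $w^+$ (resp. $w^-$) be $w$ with its last digit changed from $0$ to $1$ (resp. from $1$ to $0$). Let $q_{KL}$ be the unique $q\in(1,2)$ with $(\tau_1\tau_2\ldots)_q=1$. For $m\ge1$ let $\hat q_m$ be the unique base $q\in(1,2]$ in which the quasi-greedy expansion of $1$ (the lexicographically largest expansion not ending in $0^\infty$) is $(\tau_1\ldots\tau_{2^m}^-)^\infty$. (Part of the claim is that these bases exist and are unique.) Put $q_G:=(1+\sqrt5)/2$. Let $S\subset\mathbb N$ be defined recursively by: $1\notin S$; $2,3,4\in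 S$; and for $k\ge2$ and $2^k<n\le2^{k+1}$, $n\in S$ if and only if $n>3\cdot2^{k-1}$ and $n-3\cdot2^{k-1}\in S$. Fix $n\in S\cup\{1\}$ and let $k$ be the integer with $2^{k-1}<n\le2^k$. For $m>k$ and $j\ge1$ put $$\mathbf c_j^{(m)}:=\tau_n\ldots\tau_{2^{m-1}}\big(\overline{\tau_1\ldots\tau_{2^{m-1}}}^{\,+}\big)^j\big(\overline{\tau_1\ldots\tau_{2^m}}^{\,+}\big)^\infty,\qquad \mathbf c_\infty^{(m)}:=\tau_n\ldots\tau_{2^{m-1}}\big(\overline{\tau_1\ldots\tau_{2^{m-1}}}^{\,+}\big)^\infty,$$ $$x_n:=(\tau_n\tau_{n+1}\ldots)_{q_{KL}},\qquad \xi_m:=\big(\mathbf c_\infty^{(m)}\big)_{\hat q_m},\qquad \xi_{m,j}:=\big(\mathbf c_j^{(m)}\big)_{\hat q_m}.$$ Then $(\xi_m)_{m>k}$ strictly decreases to $x_n$; and for each $m>k$, $\xi_{m+1}<\xi_{m,1}$ and $(\xi_{m,j})_{j\ge1}$ strictly increases to $\xi_m$. Moreover: (i) For each $x\in(x_n,\xi_{k+1})$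 we have $q_s(x)=\min\mathscr U(x)$. For every $m>k$: - if $x\in[\xi_{m+1},\xi_{m,1})$, then $q_s(x)$ is the unique $q\in(\hat q_m,\hat q_{m+1}]$ with $\big(\tau_n\ldots\tau_{2^m}(\overline{\tau_1\ldots\tau_{2^m}}^{\,+})^\infty\big)_q=x$; in particular $q_s(\xi_{m+1})=\hat q_{m+1}$; - if $x\in[\xi_{m,j-1},\xi_{m,j})$ for some $j\ge2$, then $q_s(x)$ is the unique $q\in(\hat q_m,\hat q_{m+1})$ with $\big(\mathbf c_j^{(m)}\big)_q=x$. (ii) For every $m>k$: - $q_s$ is strictly decreasing and convex on $[\xi_{m+1},\xi_{m,1})$ and on each $[\xi_{m,j-1},\xi_{m,j})$, $j\ge2$; - the sequence $(q_s(\xi_{m,j}))_{j\ge1}$ is strictly decreasing and converges to $\hat q_m$; - $\lim_{x\nearrow\xi_{m,j}}q_s(x)=\hat q_m<q_s(\xi_{m,j})$ for all $j\ge1$, and $\lim_{x\nearrow\xi_m}q_s(x)=\hat q_m=q_s(\xi_m)$. In particular one gets a full description of $q_s$ on $[1,\infty)$: for $n=1$ one has $k=0$, $x_1=1$ and $\xi_1=q_G$,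 so that the above describes $q_s$ on $(1,q_G]$; furthermore $q_s(1)=\min\mathscr U(1)=q_{KL}$, and $q_s(x)=\min\mathscr U(x)=1+1/x$ for all $x\ge q_G$. -/

import Mathlib

namespace UnivoqueBase

open Set Filter Topology

/-- The value `(d₁d₂…)_q = ∑_{i ≥ 1} d_i / q ^ i` of a sequence of binary digits in base `q`;
the digit `d_{i+1}` is `d i`, with `true` for `1` and `false` for `0`. -/
noncomputable def val (q : ℝ) (d : ℕ → Bool) : ℝ :=
  ∑' i : ℕ, (if d i then (1 : ℝ) else 0) / q ^ (i + 1)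

/-- The set of all bases `q ∈ (1,2]` in which `x` has a unique expansion. -/
def univoqueBases (x : ℝ) : Set ℝ :=
  {q | q ∈ Ioc (1 : ℝ) 2 ∧ ∃! d : ℕ → Bool, val q d = x}

/-- The smallest univoque base `q_s(x)`, an infimum. -/
noncomputable def qs (x : ℝ) : ℝ := sInf (univoqueBases x)

/-- `d` is the quasi-greedy expansion of `x > 0` in base `q`: the lexicographically largest
among the expansions of `x` that do not end with `0^∞`. -/
def IsQuasiGreedy (q x : ℝ) (d : ℕ → Bool) : Prop :=
  IsGreatest {s : Lex (ℕ → Bool) |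
    val q (ofLex s) = x ∧ ∀ N : ℕ, ∃ i, N ≤ i ∧ ofLex s i = true} (toLex d)

/-! ### Words -/

/-- The sequence that consists of the word `w` followed by the sequence `s`. -/
def wordThen (w : List Bool) (s : ℕ → Bool) : ℕ → Bool :=
  fun i => if i < w.length then w.getD i false else s (i - w.length)

/-- The periodic sequence `w^∞` (for a nonempty word `w`). -/
def periodic (w : List Bool) : ℕ → Bool :=
  fun i => w.getD (i % w.length) false

/-- The word `w^j`. -/
def wordPow (w : List Bool) (j : ℕ) : List Bool := (List.replicate j w).flatten

/-- The reflection of a word. -/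
def refl (w : List Bool) : List Bool := w.map (fun b => !b)

/-- The word `w⁺` (for a word `w` that ends in `0`): the last digit is replaced by `1`. -/
def plus (w : List Bool) : List Bool := w.dropLast ++ [true]

/-- The word `w⁻` (for a word `w` that ends in `1`): the last digit is replaced by `0`. -/
def minus (w : List Bool) : List Bool := w.dropLast ++ [false]

/-! ### The Thue-Morse sequence and the bases attached to it -/

/-- The Thue-Morse sequence: the parity of the number of `1`'s in the binary expansion of `i`. -/
def tau (i : ℕ) : Bool := decide ((Nat.digits 2 i).count 1 % 2 = 1)

/-- The word `τ_a τ_{a+1} … τ_b` (for `a ≤ b`). -/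
def tauWord (a b : ℕ) : List Bool := (List.range' a (b + 1 - a)).map tau

/-- The tail `τ_n τ_{n+1} …`. -/
def tauTail (n : ℕ) : ℕ → Bool := fun i => tau (n + i)

/-- The bases in `(1,2)` in which `τ₁τ₂…` has the value `1`. -/
def klBases : Set ℝ := {q | q ∈ Ioo (1 : ℝ) 2 ∧ val q (tauTail 1) = 1}

/-- The Komornik-Loreti constant, the only element of `klBases`. -/
noncomputable def qKL : ℝ := sInf klBases

/-- The bases in `(1,2]` in which the quasi-greedy expansion of `1` is
`(τ₁ … τ_{2^m}⁻)^∞`. -/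
def hatBases (m : ℕ) : Set ℝ :=
  {q | q ∈ Ioc (1 : ℝ) 2 ∧ IsQuasiGreedy q 1 (periodic (minus (tauWord 1 (2 ^ m))))}

/-- The base `q̂_m` (`m ≥ 1`), the only element of `hatBases m`. -/
noncomputable def qhat (m : ℕ) : ℝ := sInf (hatBases m)

/-! ### The cascades -/

/-- The set `S` of positive integers: `2, 3, 4 ∈ S`, and for `k ≥ 2` and `2^k < n ≤ 2^{k+1}`
one has `n ∈ S` if and only if `n > 3·2^{k-1}` and `n - 3·2^{k-1} ∈ S`. -/
inductive S : ℕ → Prop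
  | two : S 2
  | three : S 3
  | four : S 4
  | step (k n : ℕ) (hk : 2 ≤ k) (h₁ : 2 ^ k < n) (h₂ : n ≤ 2 ^ (k + 1))
      (h₃ : 3 * 2 ^ (k - 1) < n) (h₄ : S (n - 3 * 2 ^ (k - 1))) : S n

/-- The word `τ̄₁ … τ̄_{2^m}` with its last digit raised to `1`. -/
def block (m : ℕ) : List Bool := plus (refl (tauWord 1 (2 ^ m)))

/-- `c_{n,j}^{(m)}`, that is, the word `τ_n … τ_{2^{m-1}}`, then `j` times the word
`block (m-1)`, then `block m` repeated forever. -/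
def cSeq (n m j : ℕ) : ℕ → Bool :=
  wordThen (tauWord n (2 ^ (m - 1)) ++ wordPow (block (m - 1)) j) (periodic (block m))

/-- `c_{n,∞}^{(m)}`, that is, the word `τ_n … τ_{2^{m-1}}`, then `block (m-1)` repeated
forever. -/
def cSeqInf (n m : ℕ) : ℕ → Bool :=
  wordThen (tauWord n (2 ^ (m - 1))) (periodic (block (m - 1)))

/-- `x_n = (τ_n τ_{n+1} …)_{q_KL}`. -/
noncomputable def xPt (n : ℕ) : ℝ := val qKL (tauTail n)

/-- `ξ_m`, for given `n`. -/
noncomputable def xi (n m : ℕ) : ℝ := val (qhat m) (cSeqInf n m)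

/-- `ξ_{m,j}`, for given `n`. -/
noncomputable def xiJ (n m j : ℕ) : ℝ := val (qhat m) (cSeq n m j)

end UnivoqueBase

namespace UnivoqueBase

open Set Filter Topology

/-! ### Values of digit sequences -/

/-! An expansion is unique exactly when the tail after every digit 0, and the reflected tail after
every digit 1, has value less than 1 (`Uni`). Lexicographic comparison then controls values: if `p <
q`, `c` is univoque in base `q`, and `d` represents in base `p` the positive number that `c`
represents in base `q`, then `d` is lexicographically smaller than `c` (`lexLt_of_lt_base`). Hence a
solution `q` of `val q c = x` is the least univoque base of `x` as soon as no sequence below `c` is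
a univoque expansion of `x` in a smaller base.

Such sequences are excluded by a rigidity of Thue–Morse type. The base q̂_m is the one in which
τ₁…τ_{2^m} has value 1 (`base m`), and these bases increase to q_KL. In bases up to q̂_{m+1} no
reflected tail of a univoque sequence exceeds (τ₁…τ_{2^m}⁻)^∞ (`Uni.not_pm_lexLt`). Consequently
nothing univoque lies strictly between c_j^{(m)} and c_{j+1}^{(m)} in bases up to q̂_{m+1}
(`Uni.not_between`), and in bases up to q̂_m everything univoque below c_∞^{(m)} already drops
inside τ_n…τ_{2^{m-1}} (`Uni.below_of_lexLt`).

Sequences of the last kind have value less than x_n when n ∈ S ∪ {1} (`Uni.val_lt_xPt`). The level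
of the drop is lowered until its base lies below `q`; the value is then less than a point of the
orbit of 1. For n ∈ S that point is compared with `bound`, the value in base q_KL of τ_n…τ_{2^M}
followed by the reflected Thue–Morse sequence, which is less than x_n. The recursion for S
reproduces the same words, so only n = 2, 3, 4 need numerical checks.

It remains to solve `val q c = x` on each interval. By continuity only the endpoint inequality
(c_{j+1}^{(m)})_{q̂_{m+1}} < (c_j^{(m)})_{q̂_m} is substantial (`val_cFin_succ_lt`). Comparison of
increments reduces it to j = 1, and monotonicity along the orbit of 1 to a single estimate for each
m (`base_gap`), which follows from a doubling formula for the orbit and numerical bounds. On each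
interval `qs` inverts the decreasing convex function `q ↦ val q c`, which gives its shape.

In the code m = M + 1, and the sequences c are tails of `twist v M` with v = 01^∞ (`cInf`) or v =
01^{j+1}(01)^∞ (`cFin`). -/

/-- A binary digit as a real number. -/
noncomputable def bit (b : Bool) : ℝ := if b then 1 else 0

@[simp] lemma bit_true : bit true = 1 := by simp [bit]

@[simp] lemma bit_false : bit false = 0 := by simp [bit]

lemma bit_nonneg (b : Bool) : 0 ≤ bit b := by cases b <;> simp

lemma bit_le_one (b : Bool) : bit b ≤ 1 := by cases b <;> simp

lemma bit_not (b : Bool) : bit (!b) = 1 - bit b := by cases b <;> simp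

/-- The value of the first `N` digits of `d` in base `q`. -/
noncomputable def psum (q : ℝ) (d : ℕ → Bool) (N : ℕ) : ℝ :=
  ∑ i ∈ Finset.range N, bit (d i) / q ^ (i + 1)

lemma val_eq_tsum (q : ℝ) (d : ℕ → Bool) : val q d = ∑' i, bit (d i) / q ^ (i + 1) := rfl

lemma summable_geom {q : ℝ} (hq : 1 < q) : Summable fun i : ℕ => 1 / q ^ (i + 1) := by
  have h := (summable_geometric_of_lt_one (by positivity) (inv_lt_one_of_one_lt₀ hq)).mul_left q⁻¹
  refine h.congr fun i => ?_
  rw [pow_succ, one_div, mul_inv, inv_pow, mul_comm]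

lemma tsum_geom {q : ℝ} (hq : 1 < q) : ∑' i : ℕ, 1 / q ^ (i + 1) = 1 / (q - 1) := by
  have h : ∀ i : ℕ, 1 / q ^ (i + 1) = q⁻¹ * q⁻¹ ^ i := fun i => by
    rw [pow_succ, one_div, mul_inv, inv_pow, mul_comm]
  simp_rw [h]
  rw [tsum_mul_left, tsum_geometric_of_lt_one (by positivity) (inv_lt_one_of_one_lt₀ hq)]
  have : q - 1 ≠ 0 := by linarith
  have : q ≠ 0 := by linarith
  field_simp

lemma term_nonneg {q : ℝ} (hq : 0 < q) (d : ℕ → Bool) (i : ℕ) : 0 ≤ bit (d i) / q ^ (i + 1) :=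
  div_nonneg (bit_nonneg _) (by positivity)

lemma term_le {q : ℝ} (hq : 0 < q) (d : ℕ → Bool) (i : ℕ) :
    bit (d i) / q ^ (i + 1) ≤ 1 / q ^ (i + 1) := by
  have := bit_le_one (d i)
  gcongr

lemma summable_val {q : ℝ} (hq : 1 < q) (d : ℕ → Bool) :
    Summable fun i => bit (d i) / q ^ (i + 1) :=
  Summable.of_nonneg_of_le (term_nonneg (by linarith) d) (term_le (by linarith) d)
    (summable_geom hq)

lemma val_nonneg {q : ℝ} (hq : 1 < q) (d : ℕ → Bool) : 0 ≤ val q d :=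
  tsum_nonneg (term_nonneg (by linarith) d)

lemma val_le {q : ℝ} (hq : 1 < q) (d : ℕ → Bool) : val q d ≤ 1 / (q - 1) := by
  rw [← tsum_geom hq]
  exact (summable_val hq d).tsum_le_tsum (term_le (by linarith) d) (summable_geom hq)

lemma val_not {q : ℝ} (hq : 1 < q) (d : ℕ → Bool) :
    val q (fun i => !d i) = 1 / (q - 1) - val q d := by
  rw [val_eq_tsum, val_eq_tsum, ← tsum_geom hq, ← (summable_geom hq).tsum_sub (summable_val hq d)]
  congr 1; ext i
  rw [bit_not, sub_div]

lemma val_split {q : ℝ} (hq : 1 < q) (d : ℕ → Bool) (N : ℕ) :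
    val q d = psum q d N + val q (fun i => d (N + i)) / q ^ N := by
  rw [val_eq_tsum, ← (summable_val hq d).sum_add_tsum_nat_add N, psum, val_eq_tsum, ← tsum_div_const]
  congr 2; ext i
  rw [div_div, ← pow_add, add_comm N i]
  congr 2; ring

lemma psum_succ (q : ℝ) (d : ℕ → Bool) (N : ℕ) :
    psum q d (N + 1) = psum q d N + bit (d N) / q ^ (N + 1) := by
  simp [psum, Finset.sum_range_succ]

@[simp] lemma psum_zero (q : ℝ) (d : ℕ → Bool) : psum q d 0 = 0 := by simp [psum]

lemma psum_congr {q : ℝ} {d e : ℕ → Bool} {N : ℕ} (h : ∀ i < N, d i = e i) :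
    psum q d N = psum q e N :=
  Finset.sum_congr rfl fun i hi => by rw [h i (Finset.mem_range.1 hi)]

lemma psum_nonneg {q : ℝ} (hq : 0 < q) (d : ℕ → Bool) (N : ℕ) : 0 ≤ psum q d N :=
  Finset.sum_nonneg fun i _ => term_nonneg hq d i

lemma psum_mono {q : ℝ} (hq : 0 < q) (d : ℕ → Bool) : Monotone (psum q d) :=
  monotone_nat_of_le_succ fun N => by rw [psum_succ]; linarith [term_nonneg hq d N]

lemma psum_le_val {q : ℝ} (hq : 1 < q) (d : ℕ → Bool) (N : ℕ) : psum q d N ≤ val q d := by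
  rw [val_split hq d N]
  have := val_nonneg hq (fun i => d (N + i))
  have : 0 ≤ val q (fun i => d (N + i)) / q ^ N := div_nonneg this (by positivity)
  linarith

lemma term_anti {q q' : ℝ} (hq : 0 < q) (h : q ≤ q') (b : Bool) (i : ℕ) :
    bit b / q' ^ (i + 1) ≤ bit b / q ^ (i + 1) :=
  div_le_div_of_nonneg_left (bit_nonneg b) (by positivity) (by gcongr)

lemma psum_anti {q q' : ℝ} (hq : 0 < q) (h : q ≤ q') (d : ℕ → Bool) (N : ℕ) :
    psum q' d N ≤ psum q d N :=
  Finset.sum_le_sum fun i _ => term_anti hq h (d i) i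

lemma psum_strictAnti {q q' : ℝ} (hq : 0 < q) (h : q < q') {d : ℕ → Bool} {N i : ℕ} (hi : i < N)
    (hd : d i = true) : psum q' d N < psum q d N := by
  refine Finset.sum_lt_sum (fun i _ => term_anti hq h.le (d i) i) ⟨i, Finset.mem_range.2 hi, ?_⟩
  rw [hd, bit_true]
  exact div_lt_div_of_pos_left one_pos (by positivity) (pow_lt_pow_left₀ h hq.le (by omega))

lemma val_anti {q q' : ℝ} (hq : 1 < q) (h : q ≤ q') (d : ℕ → Bool) : val q' d ≤ val q d :=
  (summable_val (by linarith) d).tsum_le_tsum (fun i => term_anti (by linarith) h (d i) i)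
    (summable_val hq d)

lemma val_strictAnti {q q' : ℝ} (hq : 1 < q) (h : q < q') {d : ℕ → Bool} {i : ℕ}
    (hd : d i = true) : val q' d < val q d := by
  refine Summable.tsum_lt_tsum (i := i) (fun i => term_anti (by linarith) h.le (d i) i) ?_
    (summable_val (by linarith) d) (summable_val hq d)
  change bit (d i) / _ < bit (d i) / _
  rw [hd, bit_true]
  exact div_lt_div_of_pos_left one_pos (by positivity)
    (pow_lt_pow_left₀ h (by linarith) (by omega))

lemma val_pos {q : ℝ} (hq : 1 < q) {d : ℕ → Bool} {i : ℕ} (hd : d i = true) : 0 < val q d := by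
  have h1 := psum_le_val hq d (i + 1)
  have h2 := psum_nonneg (by linarith : 0 < q) d i
  rw [psum_succ, hd, bit_true] at h1
  have : 0 < 1 / q ^ (i + 1) := by positivity
  linarith

lemma abs_val_sub_le {q : ℝ} (hq : 1 < q) {d e : ℕ → Bool} {N : ℕ} (h : ∀ i < N, d i = e i) :
    |val q d - val q e| ≤ 1 / (q - 1) / q ^ N := by
  rw [val_split hq d N, val_split hq e N, psum_congr h, add_sub_add_left_eq_sub, ← sub_div, abs_div,
    abs_of_pos (by positivity : 0 < q ^ N)]
  gcongr
  rw [abs_le]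
  constructor <;> linarith [val_nonneg hq (fun i => d (N + i)), val_nonneg hq (fun i => e (N + i)),
    val_le hq (fun i => d (N + i)), val_le hq (fun i => e (N + i))]

lemma continuousOn_val (d : ℕ → Bool) : ContinuousOn (fun q => val q d) (Ioi 1) := by
  intro a ha
  have ha1 : (1 : ℝ) < a := ha
  obtain ⟨b, hb1, hba⟩ := exists_between ha1
  have : ContinuousOn (fun q => val q d) (Ici b) := by
    refine continuousOn_tsum (u := fun i => 1 / b ^ (i + 1)) (fun i => ?_) (summable_geom hb1) ?_
    · refine ContinuousOn.div continuousOn_const (by fun_prop) fun q hq => ?_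
      have : b ≤ q := hq
      have : 0 < q := by linarith
      positivity
    · intro i q hq
      have hq' : b ≤ q := hq
      have hq0 : 0 < q := by linarith
      change ‖bit (d i) / q ^ (i + 1)‖ ≤ _
      rw [Real.norm_of_nonneg (term_nonneg hq0 d i)]
      refine (term_le hq0 d i).trans ?_
      gcongr
  exact (this.continuousAt (Ici_mem_nhds hba)).continuousWithinAt

lemma convexOn_term (i : ℕ) : ConvexOn ℝ (Ioi (0 : ℝ)) fun q => 1 / q ^ (i + 1) := by
  have := convexOn_zpow (𝕜 := ℝ) (-((i : ℤ) + 1))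
  refine this.congr fun q hq => ?_
  change q ^ (-((i : ℤ) + 1)) = _
  rw [zpow_neg, one_div]; norm_cast

lemma convexOn_val (d : ℕ → Bool) : ConvexOn ℝ (Ioi (1 : ℝ)) fun q => val q d := by
  refine ⟨convex_Ioi 1, fun x hx y hy a b ha hb hab => ?_⟩
  have hx1 : (1 : ℝ) < x := hx
  have hy1 : (1 : ℝ) < y := hy
  have hz : (1 : ℝ) < a • x + b • y := convex_Ioi (𝕜 := ℝ) 1 hx hy ha hb hab
  change val _ d ≤ a * val x d + b * val y d
  rw [val_eq_tsum, val_eq_tsum, val_eq_tsum, ← tsum_mul_left, ← tsum_mul_left,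
    ← ((summable_val hx1 d).mul_left a).tsum_add ((summable_val hy1 d).mul_left b)]
  refine (summable_val hz d).tsum_le_tsum (fun i => ?_)
    (((summable_val hx1 d).mul_left a).add ((summable_val hy1 d).mul_left b))
  have := (convexOn_term i).2 (mem_Ioi.2 (by linarith : 0 < x)) (mem_Ioi.2 (by linarith : 0 < y))
    ha hb hab
  simp only [smul_eq_mul] at this ⊢
  cases d i
  · simp
  · simpa using this

/-- One step of the greedy algorithm: the remainder that is left after the first digit. -/
noncomputable def greedyStep (q y : ℝ) : ℝ := if 1 ≤ q * y then q * y - 1 else q * y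

/-- The greedy remainders stay in [0, 1/(q-1)]. The condition q ≤ 2 enters through 1 ≤ 1/(q-1): a
remainder less than 1 after a digit 0 is still admissible. -/
lemma exists_expansion {q : ℝ} (hq : 1 < q) (hq2 : q ≤ 2) {y : ℝ} (h0 : 0 ≤ y)
    (h1 : y ≤ 1 / (q - 1)) : ∃ d, val q d = y := by
  set c := 1 / (q - 1) with hc
  have hcq : c * (q - 1) = 1 := by rw [hc]; field_simp [(by linarith : q - 1 ≠ 0)]
  have hc1 : 1 ≤ c := by rw [hc, le_div_iff₀ (by linarith)]; linarith
  let Y : ℕ → ℝ := fun i => (greedyStep q)^[i] y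
  have hY : ∀ i, 0 ≤ Y i ∧ Y i ≤ c := by
    intro i
    induction i with
    | zero => exact ⟨h0, h1⟩
    | succ i ih =>
      have : Y (i + 1) = greedyStep q (Y i) := Function.iterate_succ_apply' _ _ _
      rw [this, greedyStep]
      split_ifs with h
      · constructor
        · linarith
        · nlinarith [ih.1, ih.2]
      · constructor
        · exact mul_nonneg (by linarith) ih.1
        · linarith [not_le.1 h]
  let d : ℕ → Bool := fun i => decide (1 ≤ q * Y i)
  have hsum : ∀ N, y = psum q d N + Y N / q ^ N := by
    intro N
    induction N with
    | zero => simp [Y]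
    | succ N ih =>
      have hs : Y (N + 1) = q * Y N - bit (d N) := by
        have : Y (N + 1) = greedyStep q (Y N) := Function.iterate_succ_apply' _ _ _
        rw [this, greedyStep]
        by_cases h : 1 ≤ q * Y N <;> simp [d, h]
      rw [ih, psum_succ, hs]
      have : q ≠ 0 := by linarith
      field_simp
      ring
  refine ⟨d, ?_⟩
  have hb : ∀ N, |val q d - y| ≤ c / q ^ N := by
    intro N
    rw [val_split hq d N, hsum N, add_sub_add_left_eq_sub, ← sub_div, abs_div,
      abs_of_pos (by positivity : 0 < q ^ N)]
    gcongr
    rw [abs_le]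
    constructor <;> linarith [val_nonneg hq (fun i => d (N + i)), val_le hq (fun i => d (N + i)),
      (hY N).1, (hY N).2]
  have hlim : Tendsto (fun N : ℕ => c / q ^ N) atTop (𝓝 0) :=
    tendsto_const_nhds.div_atTop (tendsto_pow_atTop_atTop_of_one_lt hq)
  have := ge_of_tendsto' hlim hb
  exact sub_eq_zero.1 (abs_nonpos_iff.1 this)

/-! ### Lexicographic order and unique expansions -/

/-- Strict lexicographic order. -/
def LexLt (s t : ℕ → Bool) : Prop := ∃ j, (∀ i < j, s i = t i) ∧ s j = false ∧ t j = true

lemma lexLt_or {s t : ℕ → Bool} (h : s ≠ t) : LexLt s t ∨ LexLt t s := by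
  classical
  have hex : ∃ i, s i ≠ t i := Function.ne_iff.1 h
  have hm : ∀ i < Nat.find hex, s i = t i := fun i hi => not_not.1 (Nat.find_min hex hi)
  have hs := Nat.find_spec hex
  rcases h1 : s (Nat.find hex) with _ | _
  · left
    exact ⟨_, hm, h1, by rw [h1] at hs; simpa using hs.symm⟩
  · right
    exact ⟨_, fun i hi => (hm i hi).symm, by rw [h1] at hs; simpa using hs.symm, h1⟩

/-- The sequence that follows the digit `d i`, reflected if `d i = 1`. -/
def dd (d : ℕ → Bool) (i : ℕ) : ℕ → Bool := fun j => xor (d i) (d (i + 1 + j))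

/-- The condition that characterises the unique expansions in base `q`. -/
def Uni (q : ℝ) (d : ℕ → Bool) : Prop := ∀ i, val q (dd d i) < 1

lemma dd_of_false {d : ℕ → Bool} {i : ℕ} (h : d i = false) : dd d i = fun j => d (i + 1 + j) := by
  ext j; simp [dd, h]

lemma dd_of_true {d : ℕ → Bool} {i : ℕ} (h : d i = true) : dd d i = fun j => !d (i + 1 + j) := by
  ext j; simp [dd, h]

lemma val_split_at {q : ℝ} (hq : 1 < q) (d : ℕ → Bool) (j : ℕ) :
    val q d = psum q d j + (bit (d j) + val q (fun i => d (j + 1 + i))) / q ^ (j + 1) := by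
  rw [val_split hq d (j + 1), psum_succ, add_div, add_assoc]

lemma LexLt.val_lt_psum {q : ℝ} (hq : 1 < q) {s t : ℕ → Bool} {j : ℕ} (h : ∀ i < j, s i = t i)
    (hs : s j = false) (ht : t j = true) (htail : val q (dd s j) < 1) :
    val q s < psum q t (j + 1) := by
  rw [val_split_at hq s j, psum_succ, hs, ht, psum_congr h, bit_true, bit_false, zero_add]
  rw [dd_of_false hs] at htail
  have : val q (fun i => s (j + 1 + i)) / q ^ (j + 1) < 1 / q ^ (j + 1) := by gcongr
  linarith

lemma LexLt.val_le_psum {q : ℝ} (hq : 1 < q) {s t : ℕ → Bool} {j : ℕ} (h : ∀ i < j, s i = t i)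
    (hs : s j = false) (ht : t j = true) (htail : val q (dd s j) ≤ 1) :
    val q s ≤ psum q t (j + 1) := by
  rw [val_split_at hq s j, psum_succ, hs, ht, psum_congr h, bit_true, bit_false, zero_add]
  rw [dd_of_false hs] at htail
  have : val q (fun i => s (j + 1 + i)) / q ^ (j + 1) ≤ 1 / q ^ (j + 1) := by gcongr
  linarith

lemma LexLt.val_lt {q : ℝ} (hq : 1 < q) {s t : ℕ → Bool} (h : LexLt s t) (hs : Uni q s) :
    val q s < val q t := by
  obtain ⟨j, h1, h2, h3⟩ := h
  exact (LexLt.val_lt_psum hq h1 h2 h3 (hs j)).trans_le (psum_le_val hq t _)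

lemma val_dd_lt_of_true {q : ℝ} (hq : 1 < q) {d : ℕ → Bool} {j : ℕ} (hd : d j = true)
    (h : val q (dd d j) < 1) : 1 / (q - 1) - 1 < val q (fun i => d (j + 1 + i)) := by
  rw [dd_of_true hd, val_not hq] at h
  linarith

lemma Uni.unique {q : ℝ} (hq : 1 < q) {d e : ℕ → Bool} (hd : Uni q d) (h : val q e = val q d) :
    e = d := by
  by_contra hne
  rcases lexLt_or hne with ⟨j, h1, h2, h3⟩ | hlt
  · have h4 := val_dd_lt_of_true hq h3 (hd j)
    have h5 := val_le hq (fun i => e (j + 1 + i))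
    rw [val_split_at hq e j, val_split_at hq d j, h2, h3, psum_congr h1, bit_true, bit_false] at h
    have h6 := add_left_cancel h
    rw [div_left_inj' (by positivity)] at h6
    linarith
  · exact absurd h (hlt.val_lt hq hd).ne'

/-- The sequence `d` with the digit at `j` replaced by `b` and the following digits by `e`. -/
def graft (d : ℕ → Bool) (j : ℕ) (b : Bool) (e : ℕ → Bool) : ℕ → Bool :=
  fun i => if i < j then d i else if i = j then b else e (i - (j + 1))

lemma val_graft {q : ℝ} (hq : 1 < q) (d : ℕ → Bool) (j : ℕ) (b : Bool) (e : ℕ → Bool) :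
    val q (graft d j b e) = psum q d j + (bit b + val q e) / q ^ (j + 1) := by
  rw [val_split_at hq _ j]
  have h1 : psum q (graft d j b e) j = psum q d j := psum_congr fun i hi => by simp [graft, hi]
  have h2 : graft d j b e j = b := by simp [graft]
  have h3 : (fun i => graft d j b e (j + 1 + i)) = e := by
    ext i
    have e1 : ¬ (j + 1 + i < j) := by omega
    have e2 : ¬ (j + 1 + i = j) := by omega
    simp [graft, e1, e2]
  rw [h1, h2, h3]

/-- If the condition fails at a digit, that digit can be flipped: the tail then has to change its
value by one, and the new value still lies in [0, 1/(q-1)], so it has an expansion. -/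
lemma uni_of_unique {q : ℝ} (hq : 1 < q) (hq2 : q ≤ 2) {d : ℕ → Bool}
    (h : ∀ e, val q e = val q d → e = d) : Uni q d := by
  have hq1 : 1 ≤ 1 / (q - 1) := by rw [le_div_iff₀ (by linarith)]; linarith
  intro j
  by_contra hge
  rw [not_lt] at hge
  set t := val q (fun i => d (j + 1 + i)) with ht
  have ht0 : 0 ≤ t := val_nonneg hq _
  have ht1 : t ≤ 1 / (q - 1) := val_le hq _
  rcases hb : d j with _ | _
  · rw [dd_of_false hb] at hge
    obtain ⟨e, he⟩ := exists_expansion hq hq2 (y := t - 1) (by linarith) (by linarith)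
    have := h (graft d j true e) (by
      rw [val_graft hq, val_split_at hq d j, hb, he, ← ht]; simp)
    have h2 := congrFun this j
    simp [graft, hb] at h2
  · rw [dd_of_true hb, val_not hq] at hge
    obtain ⟨e, he⟩ := exists_expansion hq hq2 (y := t + 1) (by linarith) (by linarith)
    have := h (graft d j false e) (by
      rw [val_graft hq, val_split_at hq d j, hb, he, ← ht]; simp [add_comm])
    have h2 := congrFun this j
    simp [graft, hb] at h2

lemma mem_univoqueBases {q x : ℝ} :
    q ∈ univoqueBases x ↔ 1 < q ∧ q ≤ 2 ∧ ∃ d, Uni q d ∧ val q d = x := by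
  constructor
  · rintro ⟨⟨h1, h2⟩, d, hd, hu⟩
    exact ⟨h1, h2, d, uni_of_unique h1 h2 fun e he => hu e (he.trans hd), hd⟩
  · rintro ⟨h1, h2, d, hd, hx⟩
    exact ⟨⟨h1, h2⟩, d, hx, fun e he => hd.unique h1 (he.trans hx.symm)⟩

/-- If `d` were above `e`, a finite prefix of `d` would already exceed the value of `e` in base
`q'`, and it is worth at least as much in the smaller base. This turns minimality of a base into a
question about lexicographically smaller sequences. -/
lemma lexLt_of_lt_base {q q' : ℝ} (hq : 1 < q) (hqq : q < q') {d e : ℕ → Bool} (he : Uni q' e)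
    (h : val q d = val q' e) (hpos : 0 < val q d) : LexLt d e := by
  by_cases hne : d = e
  · subst hne
    by_cases hd : ∃ i, d i = true
    · obtain ⟨i, hi⟩ := hd
      exact absurd h (val_strictAnti hq hqq hi).ne'
    · push Not at hd
      have : val q d = 0 := by rw [val_eq_tsum]; simp [hd]
      linarith
  rcases lexLt_or hne with hlt | ⟨j, h1, h2, h3⟩
  · exact hlt
  · have h4 := LexLt.val_lt_psum (by linarith) h1 h2 h3 (he j)
    have h5 := psum_anti (by linarith : 0 < q) hqq.le d (j + 1)
    have h6 := psum_le_val hq d (j + 1)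
    linarith

lemma qs_eq_of_isLeast {x q : ℝ} (h : IsLeast (univoqueBases x) q) : qs x = q := h.csInf_eq

/-! ### The Thue-Morse sequence -/

@[simp] lemma tau_zero : tau 0 = false := by simp [tau]

lemma tau_two_mul (n : ℕ) : tau (2 * n) = tau n := by
  rcases Nat.eq_zero_or_pos n with rfl | hn
  · rfl
  · have : Nat.digits 2 (2 * n) = 0 :: Nat.digits 2 n := by
      rw [Nat.digits_def' (by norm_num) (by omega)]
      simp
    simp [tau, this]

lemma tau_two_mul_add_one (n : ℕ) : tau (2 * n + 1) = !tau n := by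
  have : Nat.digits 2 (2 * n + 1) = 1 :: Nat.digits 2 n := by
    rw [Nat.digits_def' (by norm_num) (by omega)]
    have : (2 * n + 1) / 2 = n := by omega
    simp [this]
  simp only [tau, this, List.count_cons_self]
  rcases Nat.mod_two_eq_zero_or_one ((Nat.digits 2 n).count 1) with h | h
  · have : (List.count 1 (Nat.digits 2 n) + 1) % 2 = 1 := by omega
    simp [h, this]
  · have : (List.count 1 (Nat.digits 2 n) + 1) % 2 = 0 := by omega
    simp [h, this]

@[simp] lemma tau_one : tau 1 = true := by simpa using tau_two_mul_add_one 0

lemma tau_add (a b : ℕ) : ∀ t < 2 ^ a, tau (2 ^ a * b + t) = xor (tau b) (tau t) := by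
  induction a with
  | zero => intro t ht; obtain rfl : t = 0 := by simpa using ht
            simp
  | succ a ih =>
    intro t ht
    rw [pow_succ] at ht
    rcases Nat.even_or_odd' t with ⟨s, rfl | rfl⟩
    · have : 2 ^ (a + 1) * b + 2 * s = 2 * (2 ^ a * b + s) := by ring
      rw [this, tau_two_mul, tau_two_mul, ih s (by omega)]
    · have : 2 ^ (a + 1) * b + (2 * s + 1) = 2 * (2 ^ a * b + s) + 1 := by ring
      rw [this, tau_two_mul_add_one, tau_two_mul_add_one, ih s (by omega)]
      simp

lemma tau_two_pow_mul (a b : ℕ) : tau (2 ^ a * b) = tau b := by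
  simpa using tau_add a b 0 (by positivity)

@[simp] lemma tau_two_pow (a : ℕ) : tau (2 ^ a) = true := by
  simpa using tau_two_pow_mul a 1

lemma tau_two_pow_add {a t : ℕ} (ht : t < 2 ^ a) : tau (2 ^ a + t) = !tau t := by
  simpa using tau_add a 1 t ht

/-- Write i = 2^a(2b+1). Relative to τ_i, the digits after i follow τ₁τ₂… until the next block of
length 2^a, which begins with τ_{b+1}. If τ_{b+1} ≠ τ_b the drop occurs there; otherwise the next
block also agrees and the drop occurs at τ_{2^{a+1}}. -/
lemma exists_drop_tau {M i : ℕ} (hi : ¬ 2 ^ M ∣ i) :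
    ∃ j, j + 1 ≤ 2 ^ M ∧ (∀ l < j, dd tau i l = tauTail 1 l) ∧ dd tau i j = false ∧
      tauTail 1 j = true := by
  have hi0 : i ≠ 0 := by rintro rfl; exact hi (dvd_zero _)
  obtain ⟨a, c, hc, rfl⟩ := Nat.exists_eq_two_pow_mul_odd hi0
  obtain ⟨b, rfl⟩ := hc
  have haM : a < M := by
    by_contra h
    exact hi ((pow_dvd_pow 2 (not_lt.1 h)).mul_right _)
  have hpow : 2 ^ (a + 1) ≤ 2 ^ M := Nat.pow_le_pow_right (by norm_num) haM
  have hp : 2 ^ (a + 1) = 2 * 2 ^ a := by ring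
  have hpos : 0 < 2 ^ a := by positivity
  have h0 : tau (2 ^ a * (2 * b + 1)) = !tau b := by rw [tau_two_pow_mul, tau_two_mul_add_one]
  have h1 : ∀ t < 2 ^ a, tau (2 ^ a * (2 * b + 1) + t) = xor (!tau b) (tau t) := fun t ht => by
    rw [tau_add a _ t ht, tau_two_mul_add_one]
  have h2 : ∀ t < 2 ^ a, tau (2 ^ a * (2 * b + 1) + (2 ^ a + t)) = xor (tau (b + 1)) (tau t) :=
    fun t ht => by
      have : 2 ^ a * (2 * b + 1) + (2 ^ a + t) = 2 ^ a * (2 * (b + 1)) + t := by ring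
      rw [this, tau_add a _ t ht, tau_two_mul]
  have h3 : tau (2 ^ a * (2 * b + 1) + 2 * 2 ^ a) = !tau (b + 1) := by
    have : 2 ^ a * (2 * b + 1) + 2 * 2 ^ a = 2 ^ a * (2 * (b + 1) + 1) := by ring
    rw [this, tau_two_pow_mul, tau_two_mul_add_one]
  by_cases hb : tau b = tau (b + 1)
  · refine ⟨2 * 2 ^ a - 1, by omega, fun l hl => ?_, ?_, ?_⟩
    · simp only [dd, tauTail, h0, add_assoc]
      rcases lt_or_ge (1 + l) (2 ^ a) with hlt | hge
      · rw [h1 _ hlt]; cases tau b <;> simp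
      · obtain ⟨t, ht⟩ := Nat.exists_eq_add_of_le hge
        rw [ht, h2 t (by omega), tau_two_pow_add (by omega), hb]
        cases tau (b + 1) <;> simp
    · have : 2 ^ a * (2 * b + 1) + 1 + (2 * 2 ^ a - 1) = 2 ^ a * (2 * b + 1) + 2 * 2 ^ a := by omega
      simp only [dd, this, h0, h3, hb]; simp
    · have : 1 + (2 * 2 ^ a - 1) = 2 ^ (a + 1) := by omega
      simp only [tauTail, this, tau_two_pow]
  · refine ⟨2 ^ a - 1, by omega, fun l hl => ?_, ?_, ?_⟩
    · simp only [dd, tauTail, h0, add_assoc]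
      rw [h1 _ (by omega)]; cases tau b <;> simp
    · have : 2 ^ a * (2 * b + 1) + 1 + (2 ^ a - 1) = 2 ^ a * (2 * b + 1) + (2 ^ a + 0) := by omega
      simp only [dd, this, h0, h2 0 hpos, tau_zero]
      revert hb; cases tau b <;> cases tau (b + 1) <;> simp
    · have : 1 + (2 ^ a - 1) = 2 ^ a := by omega
      simp only [tauTail, this, tau_two_pow]

/-- The sequence of the blocks `v b ⊕ τ₀ … τ_{2^M-1}`. -/
def twist (v : ℕ → Bool) (M : ℕ) : ℕ → Bool :=
  fun i => xor (v (i / 2 ^ M)) (tau (i % 2 ^ M))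

lemma twist_add (v : ℕ → Bool) {M b t : ℕ} (ht : t < 2 ^ M) :
    twist v M (2 ^ M * b + t) = xor (v b) (tau t) := by
  have hp : 0 < 2 ^ M := by positivity
  rw [twist, Nat.mul_add_div hp, Nat.div_eq_of_lt ht, Nat.mul_add_mod, Nat.mod_eq_of_lt ht,
    add_zero]

lemma twist_mul (v : ℕ → Bool) (M b : ℕ) : twist v M (2 ^ M * b) = v b := by
  simpa using twist_add v (M := M) (b := b) (t := 0) (by positivity)

/-- Since every two-letter word occurs in τ, any two adjacent blocks of a twist occur in τ at
aligned positions. Drops at positions not divisible by 2^M can therefore be read off from τ. -/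
lemma exists_tau_pair (x y : Bool) : ∃ b, tau b = x ∧ tau (b + 1) = y := by
  have h2 : tau 2 = true := tau_two_mul 1
  have h3 : tau 3 = false := tau_two_mul_add_one 1
  have h5 : tau 5 = false := by simpa [h2] using tau_two_mul_add_one 2
  have h6 : tau 6 = false := (tau_two_mul 3).trans h3
  cases x <;> cases y
  · exact ⟨5, h5, h6⟩
  · exact ⟨0, tau_zero, tau_one⟩
  · exact ⟨2, h2, h3⟩
  · exact ⟨1, tau_one, h2⟩

lemma exists_drop_twist_of_not_dvd (v : ℕ → Bool) {M i : ℕ} (hi : ¬ 2 ^ M ∣ i) :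
    ∃ j, j + 1 ≤ 2 ^ M ∧ (∀ l < j, dd (twist v M) i l = tauTail 1 l) ∧
      dd (twist v M) i j = false ∧ tauTail 1 j = true := by
  have hp : 0 < 2 ^ M := by positivity
  set b := i / 2 ^ M
  set t := i % 2 ^ M
  have hit : i = 2 ^ M * b + t := (Nat.div_add_mod i (2 ^ M)).symm
  have ht : t < 2 ^ M := Nat.mod_lt _ hp
  obtain ⟨c, hc0, hc1⟩ := exists_tau_pair (v b) (v (b + 1))
  have key : ∀ s < 2 * 2 ^ M, twist v M (2 ^ M * b + s) = tau (2 ^ M * c + s) := by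
    intro s hs
    rcases lt_or_ge s (2 ^ M) with hlt | hge
    · rw [twist_add v hlt, tau_add M c s hlt, hc0]
    · obtain ⟨s', rfl⟩ := Nat.exists_eq_add_of_le hge
      have e1 : 2 ^ M * b + (2 ^ M + s') = 2 ^ M * (b + 1) + s' := by ring
      have e2 : 2 ^ M * c + (2 ^ M + s') = 2 ^ M * (c + 1) + s' := by ring
      rw [e1, e2, twist_add v (by omega), tau_add M _ s' (by omega), hc1]
  have hnd : ¬ 2 ^ M ∣ 2 ^ M * c + t := by
    rw [Nat.dvd_add_right (dvd_mul_right _ _)]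
    intro h
    exact hi (Nat.dvd_of_mod_eq_zero (Nat.eq_zero_of_dvd_of_lt h ht))
  obtain ⟨j, hj, h1, h2, h3⟩ := exists_drop_tau hnd
  have hdd : ∀ l ≤ j, dd (twist v M) i l = dd tau (2 ^ M * c + t) l := by
    intro l hl
    simp only [dd, hit, add_assoc]
    rw [key t (by omega), key _ (by omega)]
  exact ⟨j, hj, fun l hl => (hdd l hl.le).trans (h1 l hl), (hdd j le_rfl).trans h2, h3⟩

/-- The patterns `011` and `100` do not occur in `v` after position `b`. -/
def NoTurn (v : ℕ → Bool) (b : ℕ) : Prop := v b = v (b + 1) ∨ v b = v (b + 2)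

lemma exists_drop_twist_of_eq {v : ℕ → Bool} {M b : ℕ} (h : v b = v (b + 1)) :
    ∃ j, j + 1 ≤ 2 ^ M ∧ (∀ l < j, dd (twist v M) (2 ^ M * b) l = tauTail 1 l) ∧
      dd (twist v M) (2 ^ M * b) j = false ∧ tauTail 1 j = true := by
  have hpos : 0 < 2 ^ M := by positivity
  refine ⟨2 ^ M - 1, by omega, fun l hl => ?_, ?_, ?_⟩
  · simp only [dd, tauTail, add_assoc, twist_mul]
    rw [twist_add v (by omega)]; cases v b <;> simp
  · have : 2 ^ M * b + 1 + (2 ^ M - 1) = 2 ^ M * (b + 1) := by rw [mul_add]; omega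
    simp only [dd, this, twist_mul, h]; simp
  · have : 1 + (2 ^ M - 1) = 2 ^ M := by omega
    simp only [tauTail, this, tau_two_pow]

lemma exists_drop_twist {v : ℕ → Bool} {M b : ℕ} (hb : NoTurn v b) :
    ∃ j, j + 1 ≤ 2 ^ (M + 1) ∧ (∀ l < j, dd (twist v M) (2 ^ M * b) l = tauTail 1 l) ∧
      dd (twist v M) (2 ^ M * b) j = false ∧ tauTail 1 j = true := by
  have hpos : 0 < 2 ^ M := by positivity
  have hp : 2 ^ (M + 1) = 2 * 2 ^ M := by ring
  have e0 : ∀ t < 2 ^ M, twist v M (2 ^ M * b + t) = xor (v b) (tau t) := fun t ht =>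
    twist_add v ht
  have e1 : ∀ t < 2 ^ M, twist v M (2 ^ M * b + (2 ^ M + t)) = xor (v (b + 1)) (tau t) :=
    fun t ht => by rw [← twist_add v ht]; congr 1; ring
  have e2 : twist v M (2 ^ M * b + 2 * 2 ^ M) = v (b + 2) := by
    rw [← twist_mul v M]; congr 1; ring
  by_cases h : v b = v (b + 1)
  · obtain ⟨j, hj, h1⟩ := exists_drop_twist_of_eq (M := M) h
    exact ⟨j, by omega, h1⟩
  · have h2 : v b = v (b + 2) := hb.resolve_left h
    refine ⟨2 * 2 ^ M - 1, by omega, fun l hl => ?_, ?_, ?_⟩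
    · simp only [dd, tauTail, add_assoc, twist_mul]
      rcases lt_or_ge (1 + l) (2 ^ M) with hlt | hge
      · rw [e0 _ hlt]; cases v b <;> simp
      · obtain ⟨t, ht⟩ := Nat.exists_eq_add_of_le hge
        rw [ht, e1 t (by omega), tau_two_pow_add (by omega)]
        revert h; cases v b <;> cases v (b + 1) <;> simp
    · have : 2 ^ M * b + 1 + (2 * 2 ^ M - 1) = 2 ^ M * b + 2 * 2 ^ M := by omega
      simp only [dd, this, e2, twist_mul, h2]; simp
    · have : 1 + (2 * 2 ^ M - 1) = 2 ^ (M + 1) := by omega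
      simp only [tauTail, this, tau_two_pow]

/-- If all the (reflected) tails of `u` drop below `t` before position `N`, and the first `N` digits
of `t` have a value at most one, then the tails have a value at most one. -/
lemma val_dd_le_one {q : ℝ} (hq : 1 < q) {u t : ℕ → Bool} {i₀ : ℕ}
    (h : ∀ i, i₀ ≤ i → ∃ j, (∀ l < j, dd u i l = t l) ∧ dd u i j = false ∧ t j = true ∧
      psum q t (j + 1) ≤ 1) {i : ℕ} (hi : i₀ ≤ i) : val q (dd u i) ≤ 1 := by
  have hstep : ∀ i, i₀ ≤ i → ∃ j, val q (dd u i) ≤ 1 + (val q (dd u (i + 1 + j)) - 1) / q ^ (j + 1) := by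
    intro i hi
    obtain ⟨j, h1, h2, h3, h4⟩ := h i hi
    refine ⟨j, ?_⟩
    rw [val_split_at hq _ j, h2, psum_congr h1, bit_false, zero_add]
    rw [psum_succ, h3, bit_true] at h4
    -- At a drop the digit equals the reference digit `u i`, so what follows is again a reflected
    -- tail of `u` with the same orientation, and the argument can be repeated.
    have : (fun l => dd u i (j + 1 + l)) = dd u (i + 1 + j) := by
      ext l
      have h5 : u (i + 1 + j) = u i := by
        revert h2; simp only [dd]; cases u i <;> cases u (i + 1 + j) <;> simp
      simp only [dd, h5]
      congr 2; ring
    rw [this, sub_div]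
    linarith
  -- Every drop passes the excess over 1 on to a later tail and divides it by at least `q`; after
  -- `k` drops only the trivial bound divided by `q ^ k` is left.
  have hk : ∀ k : ℕ, ∀ i, i₀ ≤ i → val q (dd u i) ≤ 1 + (1 / (q - 1)) / q ^ k := by
    intro k
    induction k with
    | zero =>
      intro i _
      have := val_le hq (dd u i)
      simp only [pow_zero, div_one]; linarith
    | succ k ih =>
      intro i hi
      obtain ⟨j, hj⟩ := hstep i hi
      refine hj.trans ?_
      have h1 := ih (i + 1 + j) (by omega)
      have hc : 0 ≤ 1 / (q - 1) / q ^ k := by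
        have : 0 < q - 1 := by linarith
        positivity
      have h2 : (val q (dd u (i + 1 + j)) - 1) / q ^ (j + 1) ≤ (1 / (q - 1) / q ^ k) / q ^ (j + 1) := by
        gcongr; linarith
      have h3 : (1 / (q - 1) / q ^ k) / q ^ (j + 1) ≤ (1 / (q - 1) / q ^ k) / q := by
        apply div_le_div_of_nonneg_left hc (by linarith)
        exact le_self_pow₀ hq.le (by omega)
      rw [pow_succ q k, ← div_div]
      linarith
  have hlim : Tendsto (fun k : ℕ => 1 + (1 / (q - 1)) / q ^ k) atTop (𝓝 (1 + 0)) :=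
    tendsto_const_nhds.add
      (tendsto_const_nhds.div_atTop (tendsto_pow_atTop_atTop_of_one_lt hq))
  rw [add_zero] at hlim
  exact ge_of_tendsto' hlim fun k => hk k i hi

/-- Strictness is needed only at the first drop; the tail after it is covered by the weak
inequality. -/
lemma val_dd_lt_one {q : ℝ} (hq : 1 < q) {u t : ℕ → Bool} {i₀ : ℕ}
    (h : ∀ i, i₀ ≤ i → ∃ j, (∀ l < j, dd u i l = t l) ∧ dd u i j = false ∧ t j = true ∧
      psum q t (j + 1) < 1) {i : ℕ} (hi : i₀ ≤ i) : val q (dd u i) < 1 := by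
  have hle : ∀ i, i₀ ≤ i → val q (dd u i) ≤ 1 := fun i hi =>
    val_dd_le_one hq (fun i hi => by
      obtain ⟨j, h1, h2, h3, h4⟩ := h i hi
      exact ⟨j, h1, h2, h3, h4.le⟩) hi
  obtain ⟨j, h1, h2, h3, h4⟩ := h i hi
  refine (LexLt.val_le_psum hq h1 h2 h3 ?_).trans_lt h4
  have h5 : u (i + 1 + j) = u i := by
    revert h2; simp only [dd]; cases u i <;> cases u (i + 1 + j) <;> simp
  have : dd (dd u i) j = dd u (i + 1 + j) := by
    ext l
    simp only [dd, h5]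
    have : i + 1 + (j + 1 + l) = i + 1 + j + 1 + l := by ring
    rw [this]
    cases u i <;> simp
  rw [this]
  exact hle _ (by omega)

lemma dd_tail (u : ℕ → Bool) (n i : ℕ) : dd (fun l => u (n + l)) i = dd u (n + i) := by
  ext j; simp only [dd]; congr 2; ring

/-! ### The bases -/

lemma tauTail_one_zero : tauTail 1 0 = true := tau_one

lemma tauTail_two_pow (m : ℕ) : tauTail 1 (2 ^ m - 1) = true := by
  have : 1 + (2 ^ m - 1) = 2 ^ m := by have : 0 < 2 ^ m := by positivity
                                       omega
  simp [tauTail, this]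

lemma psum_lt_psum_two_pow {q : ℝ} (hq : 0 < q) {m N : ℕ} (h : N < 2 ^ m) :
    psum q (tauTail 1) N < psum q (tauTail 1) (2 ^ m) := by
  have h1 : 2 ^ m = (2 ^ m - 1) + 1 := by omega
  have h2 : psum q (tauTail 1) N ≤ psum q (tauTail 1) (2 ^ m - 1) := psum_mono hq _ (by omega)
  rw [h1, psum_succ, tauTail_two_pow, bit_true]
  have : 0 < 1 / q ^ (2 ^ m - 1 + 1) := by positivity
  linarith

lemma psum_lt_val_tauTail {q : ℝ} (hq : 1 < q) (N : ℕ) :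
    psum q (tauTail 1) N < val q (tauTail 1) :=
  (psum_lt_psum_two_pow (by linarith) (Nat.lt_two_pow_self)).trans_le (psum_le_val hq _ (2 ^ N))

lemma exists_base (m : ℕ) : ∃ q : ℝ, 1 ≤ q ∧ q < 2 ∧ psum q (tauTail 1) (2 ^ m) = 1 := by
  have hcont : ContinuousOn (fun q : ℝ => psum q (tauTail 1) (2 ^ m)) (Icc 1 2) := by
    unfold psum
    refine continuousOn_finsetSum _ fun i _ => ContinuousOn.div continuousOn_const (by fun_prop) ?_
    intro q hq
    have : (0 : ℝ) < q := by linarith [hq.1]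
    positivity
  have h2 : psum 2 (tauTail 1) (2 ^ m) < 1 := by
    have h1 := psum_lt_val_tauTail one_lt_two (2 ^ m)
    have h3 := val_le one_lt_two (tauTail 1)
    norm_num at h3
    linarith
  have h1 : 1 ≤ psum 1 (tauTail 1) (2 ^ m) := by
    have := psum_mono one_pos (tauTail 1) (Nat.one_le_two_pow (n := m))
    simpa [psum_succ, tauTail_one_zero] using this
  obtain ⟨q, hq, hq1⟩ := intermediate_value_Icc' (by norm_num : (1 : ℝ) ≤ 2) hcont ⟨h2.le, h1⟩
  refine ⟨q, hq.1, lt_of_le_of_ne hq.2 ?_, hq1⟩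
  rintro rfl
  exact h2.ne hq1

/-- The base in which `τ₁ … τ_{2^m}` has the value `1`. -/
noncomputable def base (m : ℕ) : ℝ := (exists_base m).choose

lemma one_le_base (m : ℕ) : 1 ≤ base m := (exists_base m).choose_spec.1

lemma base_lt_two (m : ℕ) : base m < 2 := (exists_base m).choose_spec.2.1

lemma psum_base (m : ℕ) : psum (base m) (tauTail 1) (2 ^ m) = 1 := (exists_base m).choose_spec.2.2

lemma base_pos (m : ℕ) : 0 < base m := by linarith [one_le_base m]

lemma one_lt_psum_of_lt_base {q : ℝ} (hq : 0 < q) {m : ℕ} (h : q < base m) :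
    1 < psum q (tauTail 1) (2 ^ m) := by
  rw [← psum_base m]
  exact psum_strictAnti hq h (i := 0) (by positivity) tauTail_one_zero

lemma psum_le_one_of_base_le {q : ℝ} {m : ℕ} (h : base m ≤ q) :
    psum q (tauTail 1) (2 ^ m) ≤ 1 := by
  rw [← psum_base m]
  exact psum_anti (base_pos m) h _ _

lemma psum_lt_one_of_base_lt {q : ℝ} {m : ℕ} (h : base m < q) :
    psum q (tauTail 1) (2 ^ m) < 1 := by
  rw [← psum_base m]
  exact psum_strictAnti (base_pos m) h (i := 0) (by positivity) tauTail_one_zero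

lemma base_strictMono : StrictMono base := by
  refine strictMono_nat_of_lt_succ fun m => ?_
  by_contra h
  have h1 := psum_le_one_of_base_le (not_lt.1 h)
  have h2 := psum_lt_psum_two_pow (base_pos m) (m := m + 1) (N := 2 ^ m)
    (Nat.pow_lt_pow_right (by norm_num) (by omega))
  rw [psum_base m] at h2
  linarith

lemma one_lt_base {m : ℕ} (hm : 1 ≤ m) : 1 < base m :=
  (one_le_base 0).trans_lt (base_strictMono hm)

lemma base_zero : base 0 = 1 := by
  have h := psum_base 0
  have h1 : (2 : ℕ) ^ 0 = 0 + 1 := rfl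
  rw [h1, psum_succ, psum_zero, tauTail_one_zero, bit_true, zero_add, zero_add, pow_one] at h
  have := base_pos 0
  field_simp at h
  linarith

lemma val_tauTail_strictAnti {q q' : ℝ} (hq : 1 < q) (h : q < q') :
    val q' (tauTail 1) < val q (tauTail 1) := val_strictAnti hq h tauTail_one_zero

lemma exists_kl : ∃ q : ℝ, 1 < q ∧ q < 2 ∧ val q (tauTail 1) = 1 := by
  have hb := one_lt_base le_rfl
  have h1 : 1 ≤ val (base 1) (tauTail 1) := by
    rw [← psum_base 1]; exact psum_le_val hb _ _
  have h2 : val 2 (tauTail 1) < 1 := by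
    have h3 := val_not one_lt_two (tauTail 1)
    have h4 : 0 < val 2 (fun i => !tauTail 1 i) :=
      val_pos one_lt_two (i := 2) (by simp [tauTail, tau])
    norm_num at h3
    linarith
  obtain ⟨q, hq, hq1⟩ := intermediate_value_Icc' (base_lt_two 1).le
    ((continuousOn_val (tauTail 1)).mono fun x hx => hb.trans_le hx.1) ⟨h2.le, h1⟩
  refine ⟨q, hb.trans_le hq.1, lt_of_le_of_ne hq.2 ?_, hq1⟩
  rintro rfl
  exact h2.ne hq1

lemma klBases_eq : klBases = {qKL} := by
  obtain ⟨Q, h1, h2, h3⟩ := exists_kl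
  have : klBases = {Q} := by
    refine eq_singleton_iff_unique_mem.2 ⟨⟨⟨h1, h2⟩, h3⟩, fun q hq => ?_⟩
    rcases lt_trichotomy q Q with h | h | h
    · exact absurd (h3.trans hq.2.symm) (val_tauTail_strictAnti hq.1.1 h).ne
    · exact h
    · exact absurd (hq.2.trans h3.symm) (val_tauTail_strictAnti h1 h).ne
  rw [this, qKL, this, csInf_singleton]

lemma qKL_mem : qKL ∈ klBases := by rw [klBases_eq]; rfl

lemma one_lt_qKL : 1 < qKL := qKL_mem.1.1

lemma qKL_lt_two : qKL < 2 := qKL_mem.1.2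

lemma val_qKL : val qKL (tauTail 1) = 1 := qKL_mem.2

lemma base_lt_qKL (m : ℕ) : base m < qKL := by
  by_contra h
  have h1 := psum_lt_val_tauTail one_lt_qKL (2 ^ m)
  have h2 := psum_anti (by linarith [one_lt_qKL]) (not_lt.1 h) (tauTail 1) (2 ^ m)
  have h3 := psum_lt_val_tauTail ((one_lt_qKL).trans_le (not_lt.1 h)) (2 ^ m)
  have h4 := val_anti one_lt_qKL (not_lt.1 h) (tauTail 1)
  rw [psum_base] at h3
  rw [val_qKL] at h4
  linarith

lemma exists_lt_base {q : ℝ} (h : q < qKL) : ∃ m, q < base m := by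
  rcases le_or_gt q 1 with h1 | h1
  · exact ⟨1, h1.trans_lt (one_lt_base le_rfl)⟩
  have h2 : 1 < val q (tauTail 1) := by
    rw [← val_qKL]; exact val_tauTail_strictAnti h1 h
  have h3 : Tendsto (fun N => psum q (tauTail 1) N) atTop (𝓝 (val q (tauTail 1))) :=
    (summable_val h1 _).hasSum.tendsto_sum_nat
  obtain ⟨N, hN⟩ := (h3.eventually_const_lt h2).exists
  refine ⟨N, ?_⟩
  by_contra h4
  have h5 := psum_le_one_of_base_le (not_lt.1 h4)
  have h6 := psum_lt_psum_two_pow (by linarith : 0 < q) (m := N) Nat.lt_two_pow_self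
  linarith

lemma tendsto_base : Tendsto base atTop (𝓝 qKL) := by
  refine tendsto_order.2 ⟨fun a ha => ?_, fun a ha => ?_⟩
  · obtain ⟨m, hm⟩ := exists_lt_base ha
    filter_upwards [eventually_ge_atTop m] with k hk
    exact hm.trans_le (base_strictMono.monotone hk)
  · exact Eventually.of_forall fun m => (base_lt_qKL m).trans ha

/-! ### The quasi-greedy expansion of `1` in the base `base m` -/

/-- The sequence `(τ₁ … τ_{2^m}⁻)^∞`. -/
def pm (m : ℕ) : ℕ → Bool := fun j => tau ((1 + j) % 2 ^ m)

lemma pm_eq_twist (m : ℕ) : pm m = fun j => twist (fun _ => false) m (1 + j) := by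
  ext j; simp [pm, twist]

lemma val_dd_pm_le {q : ℝ} (hq : 1 < q) {m : ℕ} (h : base m ≤ q) (i : ℕ) :
    val q (dd (pm m) i) ≤ 1 := by
  rw [pm_eq_twist, dd_tail]
  refine val_dd_le_one hq (t := tauTail 1) (i₀ := 0) (fun i _ => ?_) (Nat.zero_le _)
  have key : ∃ j, j + 1 ≤ 2 ^ m ∧ (∀ l < j, dd (twist (fun _ => false) m) i l = tauTail 1 l) ∧
      dd (twist (fun _ => false) m) i j = false ∧ tauTail 1 j = true := by
    by_cases hi : 2 ^ m ∣ i
    · obtain ⟨b, rfl⟩ := hi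
      exact exists_drop_twist_of_eq rfl
    · exact exists_drop_twist_of_not_dvd _ hi
  obtain ⟨j, hj, h1, h2, h3⟩ := key
  exact ⟨j, h1, h2, h3, (psum_mono (by linarith) _ hj).trans (psum_le_one_of_base_le h)⟩

/-- Lowering the last digit of τ₁…τ_{2^m} costs z = q^{-2^m}, so by periodicity the value v
satisfies v = 1 - z + zv. -/
lemma val_pm {m : ℕ} (hm : 1 ≤ m) : val (base m) (pm m) = 1 := by
  have hb := one_lt_base hm
  have hp : 0 < 2 ^ m := by positivity
  have h1 : psum (base m) (pm m) (2 ^ m) = 1 - 1 / base m ^ 2 ^ m := by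
    have e : 2 ^ m = (2 ^ m - 1) + 1 := by omega
    have h2 : psum (base m) (tauTail 1) (2 ^ m) = psum (base m) (pm m) (2 ^ m - 1) +
        1 / base m ^ 2 ^ m := by
      conv_lhs => rw [e]
      rw [psum_succ, tauTail_two_pow, bit_true, ← e]
      congr 1
      exact psum_congr fun i hi => by rw [pm, Nat.mod_eq_of_lt (by omega), tauTail]
    have h3 : pm m (2 ^ m - 1) = false := by
      have : 1 + (2 ^ m - 1) = 2 ^ m := by omega
      simp [pm, this]
    rw [e, psum_succ, h3, ← e, bit_false, zero_div, add_zero]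
    rw [psum_base] at h2
    linarith
  have h2 := val_split hb (pm m) (2 ^ m)
  have h3 : (fun i => pm m (2 ^ m + i)) = pm m := by
    ext i
    have : 1 + (2 ^ m + i) = 2 ^ m + (1 + i) := by ring
    simp [pm, this]
  rw [h3, h1] at h2
  have h4 : 1 < base m ^ 2 ^ m := one_lt_pow₀ hb hp.ne'
  have h5 : 0 < base m ^ 2 ^ m := by linarith
  field_simp at h2
  have : (val (base m) (pm m) - 1) * (base m ^ 2 ^ m - 1) = 0 := by linarith
  rcases mul_eq_zero.1 this with h | h <;> linarith

/-- This serves twice: a larger expansion of 1 would have to end in 0^∞, so `pm m` is quasi-greedy;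
and a reflected tail of a univoque sequence cannot exceed `pm m`. -/
lemma one_le_psum_of_pm_lexLt {q : ℝ} (hq : 0 < q) {m : ℕ} (hm : 1 ≤ m) (h : q ≤ base m)
    {d : ℕ → Bool} {j : ℕ} (h1 : ∀ i < j, pm m i = d i) (h2 : pm m j = false) (h3 : d j = true) :
    1 ≤ psum q d (j + 1) := by
  have := LexLt.val_le_psum (one_lt_base hm) h1 h2 h3 (val_dd_pm_le (one_lt_base hm) le_rfl j)
  rw [val_pm hm] at this
  exact this.trans (psum_anti hq h _ _)

lemma Uni.dd_lexLt_pm {q : ℝ} (hq : 1 < q) {m : ℕ} (hm : 1 ≤ m) (h : q ≤ base m)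
    {d : ℕ → Bool} (hd : Uni q d) (p : ℕ) : LexLt (dd d p) (pm m) := by
  by_cases heq : dd d p = pm m
  · have h1 := hd p
    have h2 := val_anti hq h (pm m)
    rw [val_pm hm] at h2
    rw [heq] at h1
    linarith
  · rcases lexLt_or heq with h1 | ⟨j, h1, h2, h3⟩
    · exact h1
    · have h4 := one_le_psum_of_pm_lexLt (by linarith) hm h h1 h2 h3
      have h5 := psum_le_val hq (dd d p) (j + 1)
      linarith [hd p]

/-! ### Periodic words and the identification of q̂_m with `base m`. -/

lemma length_tauWord (a b : ℕ) : (tauWord a b).length = b + 1 - a := by simp [tauWord]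

lemma getD_tauWord {a b i : ℕ} (h : a + i ≤ b) : (tauWord a b).getD i false = tau (a + i) := by
  have h1 : i < (tauWord a b).length := by rw [length_tauWord]; omega
  rw [List.getD_eq_getElem _ _ h1]
  simp [tauWord]

lemma getD_dropLast_append {w : List Bool} {b : Bool} {i : ℕ} (hi : i < w.length) :
    (w.dropLast ++ [b]).getD i false = if i + 1 < w.length then w.getD i false else b := by
  have h1 : i < (w.dropLast ++ [b]).length := by simp; omega
  rw [List.getD_eq_getElem _ _ h1, List.getD_eq_getElem _ _ hi, List.getElem_append]
  simp only [List.length_dropLast, List.getElem_dropLast]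
  split_ifs <;> first | rfl | (exfalso; omega) | simp

lemma one_add_mod (i : ℕ) {N : ℕ} (hN : 0 < N) :
    (1 + i) % N = if i % N + 1 < N then i % N + 1 else 0 := by
  have := Nat.mod_lt i hN
  rw [add_comm, ← Nat.mod_add_mod]
  split_ifs with h
  · exact Nat.mod_eq_of_lt h
  · have : i % N + 1 = N := by omega
    rw [this, Nat.mod_self]

lemma periodic_minus (m : ℕ) : periodic (minus (tauWord 1 (2 ^ m))) = pm m := by
  have hp : 0 < 2 ^ m := by positivity
  have hl : (tauWord 1 (2 ^ m)).length = 2 ^ m := by rw [length_tauWord]; omega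
  have hl' : (minus (tauWord 1 (2 ^ m))).length = 2 ^ m := by simp [minus, hl]; omega
  ext i
  have hi := Nat.mod_lt i hp
  rw [periodic, hl', minus, getD_dropLast_append (by rw [hl]; exact hi), hl, pm,
    one_add_mod i hp]
  split_ifs with h
  · rw [getD_tauWord (by omega), add_comm]
  · simp

lemma isQuasiGreedy_base {m : ℕ} (hm : 1 ≤ m) : IsQuasiGreedy (base m) 1 (pm m) := by
  have hb := one_lt_base hm
  refine ⟨⟨val_pm hm, fun N => ⟨2 ^ m * N, Nat.le_mul_of_pos_left _ (by positivity), ?_⟩⟩, ?_⟩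
  · have h1 : 1 < 2 ^ m := Nat.one_lt_two_pow (by omega)
    simp [pm, add_comm 1, Nat.mod_eq_of_lt h1]
  · rintro s ⟨hs1, hs2⟩
    by_contra hlt
    obtain ⟨j, h1, h2⟩ := not_le.1 hlt
    have h3 := Bool.lt_iff.1 h2
    obtain ⟨i, hi1, hi2⟩ := hs2 (j + 1)
    have h4 := one_le_psum_of_pm_lexLt (by linarith) hm le_rfl (d := ofLex s) h1 h3.1 h3.2
    have h5 := val_split hb (ofLex s) (j + 1)
    obtain ⟨l, rfl⟩ := Nat.exists_eq_add_of_le hi1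
    have h6 : 0 < val (base m) (fun i => ofLex s (j + 1 + i)) := val_pos hb (i := l) hi2
    have h7 : 0 < val (base m) (fun i => ofLex s (j + 1 + i)) / base m ^ (j + 1) := by positivity
    linarith

lemma hatBases_eq_base {m : ℕ} (hm : 1 ≤ m) : hatBases m = {base m} := by
  have hb := one_lt_base hm
  have h0 : pm m 0 = true := by
    have h1 : 1 < 2 ^ m := Nat.one_lt_two_pow (by omega)
    simp [pm, Nat.mod_eq_of_lt h1]
  refine eq_singleton_iff_unique_mem.2 ⟨⟨⟨hb, (base_lt_two m).le⟩, ?_⟩, ?_⟩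
  · rw [periodic_minus]; exact isQuasiGreedy_base hm
  · rintro q ⟨⟨hq1, _⟩, hq⟩
    rw [periodic_minus] at hq
    have h1 : val q (pm m) = 1 := hq.1.1
    rcases lt_trichotomy q (base m) with h | h | h
    · have := val_strictAnti hq1 h h0
      rw [h1, val_pm hm] at this
      exact absurd this (lt_irrefl _)
    · exact h
    · have := val_strictAnti hb h h0
      rw [h1, val_pm hm] at this
      exact absurd this (lt_irrefl _)

lemma qhat_eq_base {m : ℕ} (hm : 1 ≤ m) : qhat m = base m := by
  rw [qhat, hatBases_eq_base hm, csInf_singleton]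

/-! ### Gaps between univoque sequences -/

lemma dd_apply_of_false {d : ℕ → Bool} {i : ℕ} (h : d i = false) (j : ℕ) :
    dd d i j = d (i + 1 + j) := by simp [dd, h]

lemma dd_apply_of_true {d : ℕ → Bool} {i : ℕ} (h : d i = true) (j : ℕ) :
    dd d i j = !d (i + 1 + j) := by simp [dd, h]

lemma LexLt.asymm {s t : ℕ → Bool} (h : LexLt s t) : ¬ LexLt t s := by
  rintro ⟨j, h1, h2, h3⟩
  obtain ⟨k, h4, h5, h6⟩ := h
  rcases lt_trichotomy j k with hjk | rfl | hjk
  · have := h4 j hjk; simp_all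
  · simp_all
  · have := h1 k hjk; simp_all

lemma tau_mod_two_pow_succ (M y : ℕ) :
    tau (y % 2 ^ (M + 1)) = xor (decide (y / 2 ^ M % 2 = 1)) (tau (y % 2 ^ M)) := by
  rw [Nat.mod_pow_succ, add_comm, tau_add M _ _ (Nat.mod_lt _ (by positivity))]
  rcases Nat.mod_two_eq_zero_or_one (y / 2 ^ M) with h | h <;> simp [h]

lemma tau_two_pow_add_mod (M y : ℕ) :
    tau ((2 ^ M + y) % 2 ^ (M + 1)) = !tau (y % 2 ^ (M + 1)) := by
  have hp : 0 < 2 ^ M := by positivity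
  rw [tau_mod_two_pow_succ, tau_mod_two_pow_succ, Nat.add_mod_left, Nat.add_div_left _ hp]
  rcases Nat.mod_two_eq_zero_or_one (y / 2 ^ M) with h | h
  · have : (y / 2 ^ M).succ % 2 = 1 := by omega
    simp [h, this]
  · have : (y / 2 ^ M).succ % 2 = 0 := by omega
    simp [h, this]

lemma dd_dd_false {d : ℕ → Bool} {p j : ℕ} (h : dd d p j = false) (i : ℕ) :
    dd d (p + 1 + j) i = dd d p (j + 1 + i) := by
  have h5 : d (p + 1 + j) = d p := by
    revert h; simp only [dd]; cases d p <;> cases d (p + 1 + j) <;> simp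
  simp only [dd, h5]; congr 2; ring

lemma dd_dd_true {d : ℕ → Bool} {p j : ℕ} (h : dd d p j = true) (i : ℕ) :
    dd d (p + 1 + j) i = !dd d p (j + 1 + i) := by
  have h5 : d (p + 1 + j) = !d p := by
    revert h; simp only [dd]; cases d p <;> cases d (p + 1 + j) <;> simp
  have : p + 1 + j + 1 + i = p + 1 + (j + 1 + i) := by ring
  simp only [dd, h5, this]; cases d p <;> simp

/-- The general bound in these bases is `pm (m + 1)`; the point is that it improves to `pm m`. A
tail above `pm m` but below `pm (m + 1)` must begin with τ₁…τ_{2^m}, and then the reflected tail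
starting there exceeds `pm (m + 1)`, because `pm (m + 1)` turns into its reflection after 2^m
digits. -/
lemma Uni.not_pm_lexLt {q : ℝ} (hq : 1 < q) {m : ℕ} (h : q ≤ base (m + 1)) {d : ℕ → Bool}
    (hd : Uni q d) (p : ℕ) : ¬ LexLt (pm m) (dd d p) := by
  rintro ⟨j, h1, h2, h3⟩
  have hpos : 0 < 2 ^ m := by positivity
  have h2p : 2 ^ (m + 1) = 2 * 2 ^ m := by ring
  have hpm : pm m (2 ^ m - 1) = false := by
    have : 1 + (2 ^ m - 1) = 2 ^ m := by omega
    simp [pm, this]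
  induction j using Nat.strong_induction_on generalizing p with
  | _ j ih =>
    -- If the first difference lies beyond one period, that period ends in 0 and can be removed
    -- without changing the orientation of the tail.
    rcases le_or_gt (2 ^ m) j with hj | hj
    · have e1 : dd d p (2 ^ m - 1) = false := by rw [← h1 _ (by omega), hpm]
      have e2 : ∀ i, dd d (p + 1 + (2 ^ m - 1)) i = dd d p (2 ^ m + i) := fun i => by
        rw [dd_dd_false e1]; congr 2; omega
      have e3 : ∀ i, pm m (2 ^ m + i) = pm m i := fun i => by
        have : 1 + (2 ^ m + i) = 2 ^ m + (1 + i) := by ring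
        simp [pm, this]
      obtain ⟨k, rfl⟩ := Nat.exists_eq_add_of_le hj
      exact ih k (by omega) _ (fun i hi => by rw [e2, ← e3, h1 _ (by omega)]) (by rw [← e3, h2])
        (by rw [e2, h3])
    · have hD := hd.dd_lexLt_pm hq (by omega) h p
      have e0 : ∀ i, i + 1 < 2 ^ m → pm (m + 1) i = pm m i := fun i hi => by
        rw [pm, pm, Nat.mod_eq_of_lt (by omega), Nat.mod_eq_of_lt (by omega)]
      by_cases hj1 : j + 1 < 2 ^ m
      · exact hD.asymm ⟨j, fun i hi => by rw [e0 i (by omega), h1 i hi],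
          by rw [e0 j hj1, h2], h3⟩
      -- Here the tail begins with τ₁…τ_{2^m}. Its drop below `pm (m + 1)` comes later, and becomes
      -- a rise once the orientation is reversed.
      · obtain rfl : j = 2 ^ m - 1 := by omega
        obtain ⟨k, k1, k2, k3⟩ := hD
        have e2 : ∀ i, dd d (p + 1 + (2 ^ m - 1)) i = !dd d p (2 ^ m + i) := fun i => by
          rw [dd_dd_true h3]; congr 3; omega
        have e3 : ∀ i, pm (m + 1) (2 ^ m + i) = !pm (m + 1) i := fun i => by
          have : 1 + (2 ^ m + i) = 2 ^ m + (1 + i) := by ring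
          rw [pm, pm, this, tau_two_pow_add_mod]
        have hk : 2 ^ m ≤ k := by
          by_contra hk
          rcases lt_or_ge k (2 ^ m - 1) with hlt | hge
          · have := h1 k hlt
            rw [e0 k (by omega), this] at k3
            simp_all
          · obtain rfl : k = 2 ^ m - 1 := by omega
            simp_all
        obtain ⟨l, rfl⟩ := Nat.exists_eq_add_of_le hk
        refine (hd.dd_lexLt_pm hq (by omega) h (p + 1 + (2 ^ m - 1))).asymm
          ⟨l, fun i hi => ?_, ?_, ?_⟩
        · rw [e2, k1 _ (by omega), e3, Bool.not_not]
        · have := e3 l; rw [k3] at this; simpa using this.symm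
        · rw [e2, k2]; rfl

/-- The sequence `0 1^∞`. -/
def vInf : ℕ → Bool := fun b => decide (b ≠ 0)

/-- The sequence `0 1^{j+1} (01)^∞`. -/
def vFin (j : ℕ) : ℕ → Bool := fun b =>
  if b = 0 then false else if b ≤ j + 1 then true else decide ((b - (j + 1)) % 2 = 0)

/-- The sequence `c_{n,∞}^{(M+1)}`. -/
def cInf (n M : ℕ) : ℕ → Bool := fun i => twist vInf M (n + i)

/-- The sequence `c_{n,j}^{(M+1)}`. -/
def cFin (n M j : ℕ) : ℕ → Bool := fun i => twist (vFin j) M (n + i)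

lemma vFin_eq_of_le {j b : ℕ} (h : b ≤ j + 1) : vFin j b = vInf b := by
  unfold vFin vInf; split_ifs <;> simp_all

lemma vFin_add (j x : ℕ) : vFin j (j + 2 + x) = decide (x % 2 = 1) := by
  have h1 : ¬ (j + 2 + x = 0) := by omega
  have h2 : ¬ (j + 2 + x ≤ j + 1) := by omega
  have h3 : j + 2 + x - (j + 1) = x + 1 := by omega
  simp only [vFin, h1, h2, h3, if_false]
  congr 1; apply propext; omega

lemma vFin_succ_add (j x : ℕ) : vFin (j + 1) (j + 2 + x) = decide (x % 2 = 0) := by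
  rcases x with _ | x
  · rw [vFin_eq_of_le (by omega)]; simp [vInf]
  · have : j + 2 + (x + 1) = j + 1 + 2 + x := by ring
    rw [this, vFin_add]; congr 1; apply propext; omega

lemma noTurn_vFin (j : ℕ) {b : ℕ} (hb : 1 ≤ b) : NoTurn (vFin j) b := by
  unfold NoTurn
  rcases lt_or_ge b (j + 1) with h | h
  · left; rw [vFin_eq_of_le (by omega), vFin_eq_of_le (by omega)]; simp [vInf]; omega
  · right
    rcases Nat.eq_or_lt_of_le h with rfl | h
    · rw [vFin_eq_of_le le_rfl]
      have := vFin_add j 1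
      rw [show j + 1 + 2 = j + 2 + 1 by ring, this]; simp [vInf]
    · obtain ⟨x, rfl⟩ := Nat.exists_eq_add_of_le (show j + 2 ≤ b by omega)
      rw [vFin_add, add_assoc (j + 2), vFin_add]; congr 1; apply propext; omega

/-- Without the patterns 011 and 100 in `v`, every reflected tail drops below τ₁τ₂… within 2^{M+1}
digits, and above `base (M + 1)` these digits are worth less than 1. -/
lemma uni_twist {q : ℝ} (hq : 1 < q) {v : ℕ → Bool} (hv : ∀ b, 1 ≤ b → NoTurn v b) {M n : ℕ}
    (hn : 1 ≤ n) (h : base (M + 1) < q) : Uni q fun i => twist v M (n + i) := by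
  intro i
  rw [dd_tail]
  refine val_dd_lt_one hq (t := tauTail 1) (i₀ := 1) (fun i hi => ?_) (by omega)
  have key : ∃ j, j + 1 ≤ 2 ^ (M + 1) ∧ (∀ l < j, dd (twist v M) i l = tauTail 1 l) ∧
      dd (twist v M) i j = false ∧ tauTail 1 j = true := by
    by_cases hi : 2 ^ M ∣ i
    · obtain ⟨b, rfl⟩ := hi
      refine exists_drop_twist (hv b ?_)
      rcases b with _ | b
      · simp at hi
      · omega
    · obtain ⟨j, h1, h2⟩ := exists_drop_twist_of_not_dvd v hi
      exact ⟨j, h1.trans (Nat.pow_le_pow_right (by norm_num) (by omega)), h2⟩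
  obtain ⟨j, hj, h1, h2, h3⟩ := key
  exact ⟨j, h1, h2, h3, (psum_mono (by linarith) _ hj).trans_lt (psum_lt_one_of_base_lt h)⟩

lemma uni_cFin {q : ℝ} (hq : 1 < q) {n M : ℕ} (j : ℕ) (hn : 1 ≤ n) (h : base (M + 1) < q) :
    Uni q (cFin n M j) := uni_twist hq (fun _ hb => noTurn_vFin j hb) hn h

/-- Adjacent letters of 01^∞ agree from position 1 on, so the drops come within 2^M digits and
already `base M` suffices. -/
lemma uni_cInf {q : ℝ} {n M : ℕ} (hn : 1 ≤ n) (h : base M < q) : Uni q (cInf n M) := by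
  have hq : 1 < q := (one_le_base M).trans_lt h
  intro i
  unfold cInf
  rw [dd_tail]
  refine val_dd_lt_one hq (t := tauTail 1) (i₀ := 1) (fun i hi => ?_) (by omega)
  have key : ∃ j, j + 1 ≤ 2 ^ M ∧ (∀ l < j, dd (twist vInf M) i l = tauTail 1 l) ∧
      dd (twist vInf M) i j = false ∧ tauTail 1 j = true := by
    by_cases hi : 2 ^ M ∣ i
    · obtain ⟨b, rfl⟩ := hi
      refine exists_drop_twist_of_eq ?_
      rcases b with _ | b
      · simp at hi
      · simp [vInf]
    · exact exists_drop_twist_of_not_dvd _ hi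
  obtain ⟨j, hj, h1, h2, h3⟩ := key
  exact ⟨j, h1, h2, h3, (psum_mono (by linarith) _ hj).trans_lt (psum_lt_one_of_base_lt h)⟩

lemma uni_tauTail {n : ℕ} (hn : 1 ≤ n) : Uni qKL (tauTail n) := by
  intro i
  have : dd (tauTail n) i = dd tau (n + i) := dd_tail tau n i
  rw [this]
  refine val_dd_lt_one one_lt_qKL (t := tauTail 1) (i₀ := 1) (fun i hi => ?_) (by omega)
  have hnd : ¬ 2 ^ i ∣ i := fun h => absurd (Nat.le_of_dvd hi h) (not_le.2 Nat.lt_two_pow_self)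
  obtain ⟨j, hj, h1, h2, h3⟩ := exists_drop_tau hnd
  exact ⟨j, h1, h2, h3, (psum_lt_val_tauTail one_lt_qKL _).trans_eq val_qKL⟩

/-- The sequence `d` is below `τ_n … τ_{2^K} 0^∞`. -/
def Below (n K : ℕ) (d : ℕ → Bool) : Prop :=
  ∃ i, n + i ≤ 2 ^ K ∧ (∀ l < i, d l = tau (n + l)) ∧ d i = false ∧ tau (n + i) = true

lemma twist_of_le {v : ℕ → Bool} (hv0 : v 0 = false) (hv1 : v 1 = true) {M x : ℕ}
    (hx : x ≤ 2 ^ M) : twist v M x = tau x := by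
  rcases Nat.lt_or_eq_of_le hx with h | rfl
  · simpa [hv0] using twist_add v (b := 0) h
  · simpa [hv1] using twist_mul v M 1

/-- After τ_{2^M} = 1 the sequence `cInf n M` continues with the reflection of `pm M`. A later drop
would give a reflected tail above `pm M`. -/
lemma Uni.below_of_lexLt {q : ℝ} (hq : 1 < q) {n M : ℕ} (h : q ≤ base (M + 1)) (hn : n ≤ 2 ^ M)
    {d : ℕ → Bool} (hd : Uni q d) (hlt : LexLt d (cInf n M)) : Below n M d := by
  obtain ⟨j, h1, h2, h3⟩ := hlt
  have key : ∀ l, n + l ≤ 2 ^ M → cInf n M l = tau (n + l) := fun l hl =>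
    twist_of_le (by simp [vInf]) (by simp [vInf]) hl
  by_cases hj : n + j ≤ 2 ^ M
  · exact ⟨j, hj, fun l hl => by rw [h1 l hl, key l (by omega)], h2, by rw [← key j hj, h3]⟩
  · exfalso
    obtain ⟨p, hp⟩ := Nat.exists_eq_add_of_le hn
    have hdp : d p = true := by rw [h1 p (by omega), key p (by omega), ← hp, tau_two_pow]
    have key2 : ∀ i, cInf n M (p + 1 + i) = !pm M i := fun i => by
      have e1 : n + (p + 1 + i) = 2 ^ M + (1 + i) := by omega
      rw [cInf, e1, twist, Nat.add_mod_left, Nat.add_div_left _ (by positivity), pm]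
      simp [vInf]
    obtain ⟨l, rfl⟩ := Nat.exists_eq_add_of_le (show p + 1 ≤ j by omega)
    refine hd.not_pm_lexLt hq h p ⟨l, fun i hi => ?_, ?_, ?_⟩
    · rw [dd_apply_of_true hdp, h1 _ (by omega), key2, Bool.not_not]
    · rw [key2] at h3; simpa using h3
    · rw [dd_apply_of_true hdp, h2]; rfl

/-- A drop in the second half of τ₁…τ_{2^{K+1}} would, seen from τ_{2^K} = 1 and reflected, rise
above `pm K`. -/
lemma Uni.below_descend {q : ℝ} (hq : 1 < q) {n K : ℕ} (h : q ≤ base (K + 1)) (hn : n ≤ 2 ^ K)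
    {d : ℕ → Bool} (hd : Uni q d) (hb : Below n (K + 1) d) : Below n K d := by
  obtain ⟨j, h0, h1, h2, h3⟩ := hb
  have h2p : 2 ^ (K + 1) = 2 * 2 ^ K := by ring
  by_cases hj : n + j ≤ 2 ^ K
  · exact ⟨j, hj, h1, h2, h3⟩
  · exfalso
    obtain ⟨p, hp⟩ := Nat.exists_eq_add_of_le hn
    have hdp : d p = true := by rw [h1 p (by omega), ← hp, tau_two_pow]
    have key2 : ∀ i, 1 + i < 2 ^ K → tau (n + (p + 1 + i)) = !pm K i := fun i hi => by
      have e1 : n + (p + 1 + i) = 2 ^ K + (1 + i) := by omega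
      rw [e1, tau_two_pow_add hi, pm, Nat.mod_eq_of_lt hi]
    obtain ⟨l, rfl⟩ := Nat.exists_eq_add_of_le (show p + 1 ≤ j by omega)
    refine hd.not_pm_lexLt hq h p ⟨l, fun i hi => ?_, ?_, ?_⟩
    · rw [dd_apply_of_true hdp, h1 _ (by omega), key2 _ (by omega), Bool.not_not]
    · by_cases hl : 1 + l < 2 ^ K
      · rw [key2 _ hl] at h3; simpa using h3
      · have : 1 + l = 2 ^ K := by omega
        simp [pm, this]
    · rw [dd_apply_of_true hdp, h2]; rfl

lemma Uni.exists_below {q : ℝ} (hq : 1 < q) {n k M : ℕ} (hn : n ≤ 2 ^ k) (hkM : k ≤ M)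
    {d : ℕ → Bool} (hd : Uni q d) (hb : Below n M d) :
    ∃ j, k ≤ j ∧ j ≤ M ∧ Below n j d ∧ (base j < q ∨ j = k) := by
  induction M, hkM using Nat.le_induction with
  | base => exact ⟨k, le_rfl, le_rfl, hb, Or.inr rfl⟩
  | succ M hM ih =>
    rcases lt_or_ge (base (M + 1)) q with h | h
    · exact ⟨M + 1, by omega, le_rfl, hb, Or.inl h⟩
    · obtain ⟨j, h1, h2, h3⟩ := ih (hd.below_descend hq h
        (hn.trans (Nat.pow_le_pow_right (by norm_num) hM)) hb)
      exact ⟨j, h1, by omega, h3⟩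

lemma twist_vFin_add (j M y : ℕ) :
    twist (vFin j) M (2 ^ M * (j + 2) + y) = tau (y % 2 ^ (M + 1)) := by
  rw [twist, Nat.mul_add_mod, Nat.mul_add_div (by positivity), vFin_add, tau_mod_two_pow_succ]

lemma twist_vFin_succ_add (j M y : ℕ) :
    twist (vFin (j + 1)) M (2 ^ M * (j + 2) + y) = !tau (y % 2 ^ (M + 1)) := by
  rw [twist, Nat.mul_add_mod, Nat.mul_add_div (by positivity), vFin_succ_add,
    tau_mod_two_pow_succ]
  rcases Nat.mod_two_eq_zero_or_one (y / 2 ^ M) with h | h <;> simp [h]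

lemma twist_congr_of_lt {v w : ℕ → Bool} {M B x : ℕ} (h : ∀ b < B, v b = w b)
    (hx : x < 2 ^ M * B) : twist v M x = twist w M x := by
  rw [twist, twist, h _ (Nat.div_lt_of_lt_mul hx)]

/-- After the common prefix the lower sequence continues with 0 followed by `pm (M + 1)`, the upper
one with 1 followed by its reflection. Whichever digit `d` takes there, its next reflected tail
exceeds `pm (M + 1)`. -/
lemma Uni.not_between {q : ℝ} (hq : 1 < q) {n M j : ℕ} (h : q ≤ base (M + 2)) (hn : n ≤ 2 ^ M)
    {d : ℕ → Bool} (hd : Uni q d) (h1 : LexLt (cFin n M j) d) (h2 : LexLt d (cFin n M (j + 1))) :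
    False := by
  have hnP : n ≤ 2 ^ M * (j + 2) := hn.trans (Nat.le_mul_of_pos_right _ (by omega))
  obtain ⟨p, hp⟩ := Nat.exists_eq_add_of_le hnP
  have hcc : ∀ l < p, cFin n M j l = cFin n M (j + 1) l := fun l hl =>
    twist_congr_of_lt (B := j + 2)
      (fun b hb => by rw [vFin_eq_of_le (by omega), vFin_eq_of_le (by omega)]) (by omega)
  have a1 : ∀ y, cFin n M j (p + y) = tau (y % 2 ^ (M + 1)) := fun y => by
    rw [← twist_vFin_add j, hp, cFin, add_assoc]
  have a2 : ∀ y, cFin n M (j + 1) (p + y) = !tau (y % 2 ^ (M + 1)) := fun y => by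
    rw [← twist_vFin_succ_add j, hp, cFin, add_assoc]
  have b1 := a1 0
  have b2 := a2 0
  simp only [add_zero, Nat.zero_mod, tau_zero, Bool.not_false] at b1 b2
  obtain ⟨i, i1, i2, i3⟩ := h1
  obtain ⟨k, k1, k2, k3⟩ := h2
  have hi : p ≤ i := by
    by_contra hi
    rcases lt_trichotomy i k with hik | rfl | hik
    · have := k1 i hik
      rw [← hcc i (by omega)] at this; simp_all
    · simp_all
    · have := i1 k hik
      rw [hcc k (by omega)] at this; simp_all
  have hk : p ≤ k := by
    by_contra hk
    have := i1 k (by omega)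
    rw [hcc k (by omega)] at this; simp_all
  rcases hdp : d p with _ | _
  · have : p ≠ i := by rintro rfl; simp_all
    obtain ⟨l, rfl⟩ := Nat.exists_eq_add_of_le (show p + 1 ≤ i by omega)
    refine hd.not_pm_lexLt hq h p ⟨l, fun x hx => ?_, ?_, ?_⟩
    · rw [dd_apply_of_false hdp, ← i1 _ (by omega), add_assoc, a1, pm]
    · rw [add_assoc, a1] at i2; exact i2
    · rw [dd_apply_of_false hdp]; exact i3
  · have : p ≠ k := by rintro rfl; simp_all
    obtain ⟨l, rfl⟩ := Nat.exists_eq_add_of_le (show p + 1 ≤ k by omega)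
    refine hd.not_pm_lexLt hq h p ⟨l, fun x hx => ?_, ?_, ?_⟩
    · rw [dd_apply_of_true hdp, k1 _ (by omega), add_assoc, a2, pm, Bool.not_not]
    · rw [add_assoc, a2] at k3; simpa [pm] using k3
    · rw [dd_apply_of_true hdp, k2]; rfl

/-! ### The orbit of `1` -/

/-- The remainder that is left after the digits `τ₁ … τ_i` of an expansion of `1` in base `q`. -/
noncomputable def pp (q : ℝ) : ℕ → ℝ
  | 0 => 1
  | i + 1 => q * pp q i - bit (tau (i + 1))

@[simp] lemma pp_zero (q : ℝ) : pp q 0 = 1 := rfl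

lemma pp_succ (q : ℝ) (i : ℕ) : pp q (i + 1) = q * pp q i - bit (tau (i + 1)) := rfl

lemma pp_one (q : ℝ) : pp q 1 = q - 1 := by simp [pp_succ]

lemma tau_two : tau 2 = true := tau_two_pow 1

lemma tau_three : tau 3 = false := by simpa using tau_two_mul_add_one 1

lemma tau_four : tau 4 = true := tau_two_pow 2

lemma pp_two (q : ℝ) : pp q 2 = q * (q - 1) - 1 := by
  rw [pp_succ, pp_one]; simp [tau_two]

lemma pp_three (q : ℝ) : pp q 3 = q * (q * (q - 1) - 1) := by
  rw [pp_succ, pp_two]; simp [tau_three]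

lemma pp_four (q : ℝ) : pp q 4 = q * (q * (q * (q - 1) - 1)) - 1 := by
  rw [pp_succ, pp_three]; simp [tau_four]

/-- The value of `1^∞`, minus one. -/
noncomputable def rho (q : ℝ) : ℝ := 1 / (q - 1) - 1

lemma rho_pos {q : ℝ} (hq : 1 < q) (h2 : q < 2) : 0 < rho q := by
  rw [rho, sub_pos, lt_div_iff₀ (by linarith)]; linarith

lemma pp_add {q : ℝ} (hq : 0 < q) (a N : ℕ) :
    pp q (a + N) = q ^ N * (pp q a - psum q (tauTail (a + 1)) N) := by
  induction N with
  | zero => simp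
  | succ N ih =>
    have h1 : tauTail (a + 1) N = tau (a + N + 1) := by simp [tauTail]; congr 1; ring
    rw [← add_assoc, pp_succ, ih, psum_succ, h1]
    field_simp
    ring

lemma pp_eq {q : ℝ} (hq : 0 < q) (N : ℕ) :
    pp q N = q ^ N * (1 - psum q (tauTail 1) N) := by
  simpa using pp_add hq 0 N

lemma psum_tauTail {q : ℝ} (hq : 0 < q) (a N : ℕ) :
    psum q (tauTail (a + 1)) N = pp q a - pp q (a + N) / q ^ N := by
  rw [pp_add hq a N]
  field_simp
  ring

lemma pp_base_two_pow (m : ℕ) : pp (base m) (2 ^ m) = 0 := by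
  rw [pp_eq (base_pos m), psum_base]; simp

lemma pp_nonneg {q : ℝ} {m N : ℕ} (hN : N ≤ 2 ^ m) (h : base m ≤ q) : 0 ≤ pp q N := by
  have hq : 0 < q := (base_pos m).trans_le h
  rw [pp_eq hq]
  refine mul_nonneg (by positivity) ?_
  have := (psum_mono hq (tauTail 1) hN).trans (psum_le_one_of_base_le h)
  linarith

lemma lt_base_of_pp_neg {q : ℝ} {m : ℕ} (h : pp q (2 ^ m) < 0) : q < base m := by
  by_contra hn
  exact absurd (pp_nonneg le_rfl (not_lt.1 hn)) (not_le.2 h)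

lemma base_le_of_pp_nonneg {q : ℝ} (hq : 0 < q) {m : ℕ} (h : 0 ≤ pp q (2 ^ m)) : base m ≤ q := by
  by_contra hn
  have h1 := one_lt_psum_of_lt_base hq (not_le.1 hn)
  rw [pp_eq hq] at h
  have h2 : 0 < q ^ 2 ^ m := by positivity
  nlinarith

lemma xPt_eq (a : ℕ) : xPt (a + 1) = pp qKL a := by
  have h1 := val_split one_lt_qKL (tauTail 1) a
  have h2 : (fun i => tauTail 1 (a + i)) = tauTail (a + 1) := by
    ext i; simp only [tauTail]; congr 1; ring
  have hq : 0 < qKL := by linarith [one_lt_qKL]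
  rw [h2, val_qKL] at h1
  rw [pp_eq hq, xPt]
  field_simp at h1
  linarith

lemma pp_qKL_pos (a : ℕ) : 0 < pp qKL a := by
  rw [← xPt_eq]
  refine val_pos one_lt_qKL (i := 2 ^ (a + 1) - (a + 1)) ?_
  have : a + 1 < 2 ^ (a + 1) := Nat.lt_two_pow_self
  have : a + 1 + (2 ^ (a + 1) - (a + 1)) = 2 ^ (a + 1) := by omega
  simp [tauTail, this]

/-- After a digit 0 this is the univoque condition for the Thue–Morse sequence; after a digit 1 the
remainder is at most q_KL - 1. -/
lemma pp_qKL_le_one (a : ℕ) : pp qKL a ≤ 1 := by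
  induction a with
  | zero => simp
  | succ a ih =>
    rcases h : tau (a + 1) with _ | _
    · rw [← xPt_eq, xPt]
      have h1 := uni_tauTail (n := a + 1) (by omega) 0
      rw [dd_of_false (by simpa [tauTail] using h)] at h1
      refine le_of_eq_of_le ?_ h1.le
      congr 1; ext i; simp only [tauTail]; congr 1; ring
    · rw [pp_succ, h, bit_true]
      nlinarith [qKL_lt_two, one_lt_qKL]

lemma pp_mono {r q : ℝ} (hr : 0 < r) (h : r ≤ q) {N : ℕ} (hN : ∀ i < N, 0 ≤ pp r i) :
    pp r N ≤ pp q N := by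
  induction N with
  | zero => simp
  | succ N ih =>
    have h1 := ih fun i hi => hN i (by omega)
    have h2 := hN N (by omega)
    rw [pp_succ, pp_succ]
    have : r * pp r N ≤ q * pp q N := mul_le_mul h h1 h2 (by linarith)
    linarith

lemma pp_base_le_one {m N : ℕ} (hN : N ≤ 2 ^ m) : pp (base m) N ≤ 1 :=
  (pp_mono (base_pos m) (base_lt_qKL m).le fun i hi => pp_nonneg (by omega) le_rfl).trans
    (pp_qKL_le_one N)

/-- The difference quotient of `pp`. -/
noncomputable def sg (r s : ℝ) : ℕ → ℝ
  | 0 => 0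
  | i + 1 => s * sg r s i + pp r i

lemma sg_succ (r s : ℝ) (i : ℕ) : sg r s (i + 1) = s * sg r s i + pp r i := rfl

lemma pp_sub_pp (r s : ℝ) (N : ℕ) : pp s N - pp r N = (s - r) * sg r s N := by
  induction N with
  | zero => simp [sg]
  | succ N ih =>
    rw [pp_succ, pp_succ, sg_succ]
    linear_combination s * ih

lemma pow_mul_sg_le {r s : ℝ} (hs : 0 < s) {a W : ℕ} (h : ∀ i < a + W, 0 ≤ pp r i) :
    s ^ W * sg r s a ≤ sg r s (a + W) := by
  induction W with
  | zero => simp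
  | succ W ih =>
    have h1 := ih fun i hi => h i (by omega)
    have h2 := h (a + W) (by omega)
    rw [← add_assoc, sg_succ, pow_succ]
    have := mul_le_mul_of_nonneg_left h1 hs.le
    nlinarith

lemma sg_add_le {r s : ℝ} (hs : 1 ≤ s) {a W : ℕ} (h : ∀ i < a + W, pp r i ≤ 1) :
    (s - 1) * sg r s (a + W) ≤ s ^ W * ((s - 1) * sg r s a + 1) - 1 := by
  induction W with
  | zero => simp
  | succ W ih =>
    have h1 := ih fun i hi => h i (by omega)
    have h2 := h (a + W) (by omega)
    rw [← add_assoc, sg_succ, pow_succ]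
    have := mul_le_mul_of_nonneg_left h1 (by linarith : 0 ≤ s)
    have := mul_le_mul_of_nonneg_left h2 (sub_nonneg.2 hs)
    nlinarith

/-- The digits τ_{2^m+t} and τ_t are complementary for 0 < t < 2^m, so the sum of the two remainders
evolves by y ↦ qy - 1, whose fixed point is 1 + `rho q`. -/
lemma pp_add_two_pow {q : ℝ} (hq : 1 < q) (m : ℕ) : ∀ t < 2 ^ m,
    pp q (2 ^ m + t) + pp q t = q ^ t * (pp q (2 ^ m) - rho q) + (1 + rho q) := by
  have hq1 : q - 1 ≠ 0 := by linarith
  intro t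
  induction t with
  | zero => intro _; simp
  | succ t ih =>
    intro ht
    have h1 := ih (by omega)
    have h2 : bit (tau (2 ^ m + t + 1)) = 1 - bit (tau (t + 1)) := by
      rw [add_assoc, tau_two_pow_add ht, bit_not]
    have h3 : q * (1 + rho q) - 1 = 1 + rho q := by
      rw [rho]; field_simp; ring
    rw [← add_assoc, pp_succ, pp_succ, h2, pow_succ]
    linear_combination q * h1 + h3

/-- At t = 2^m the digits τ_{2^{m+1}} and τ_{2^m} are both 1, which breaks the complementarity of
the preceding lemma in its last step. The resulting doubling formula determines the orbit at powers
of two, in particular in the bases `base (m + 1)` and `base (m + 2)`. -/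
lemma pp_two_pow_succ {q : ℝ} (hq : 1 < q) (m : ℕ) :
    pp q (2 ^ (m + 1)) = (q ^ 2 ^ m - 1) * (pp q (2 ^ m) - rho q) := by
  have hp : 0 < 2 ^ m := by positivity
  have hq1 : q - 1 ≠ 0 := by linarith
  have h1 := pp_add_two_pow hq m (2 ^ m - 1) (by omega)
  obtain ⟨L, hL⟩ : ∃ L, 2 ^ m = L + 1 := ⟨2 ^ m - 1, by omega⟩
  have h2 : 2 ^ (m + 1) = 2 ^ m + L + 1 := by rw [pow_succ]; omega
  have h3 : tau (2 ^ m + L + 1) = true := by rw [← h2, tau_two_pow]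
  have h4 : tau (L + 1) = true := by rw [← hL, tau_two_pow]
  have h5 : pp q (2 ^ m) = q * pp q L - 1 := by rw [hL, pp_succ, h4, bit_true]
  have h6 : q * (1 + rho q) - 1 = 1 + rho q := by rw [rho]; field_simp; ring
  have h7 : q ^ 2 ^ m = q ^ L * q := by rw [hL, pow_succ]
  have h8 : 2 ^ m - 1 = L := by omega
  rw [h8] at h1
  rw [h2, pp_succ, h3, bit_true, h7]
  linear_combination q * h1 + h6 + h5

lemma pp_base_succ (m : ℕ) : pp (base (m + 1)) (2 ^ m) = rho (base (m + 1)) := by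
  have hb := one_lt_base (m := m + 1) (by omega)
  have h1 := pp_two_pow_succ hb m
  rw [pp_base_two_pow] at h1
  have h2 : 1 < base (m + 1) ^ 2 ^ m := one_lt_pow₀ hb (by positivity)
  rcases mul_eq_zero.1 h1.symm with h | h <;> linarith

lemma pp_base_add_two (m : ℕ) :
    (base (m + 2) ^ 2 ^ m - 1) * (pp (base (m + 2)) (2 ^ m) - rho (base (m + 2))) =
      rho (base (m + 2)) := by
  rw [← pp_two_pow_succ (one_lt_base (by omega)), pp_base_succ]

/-! ### Bounds for the bases -/

lemma base_one : base 1 = (1 + √5) / 2 := by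
  have h := pp_base_two_pow 1
  rw [pow_one, pp_two] at h
  have h1 := one_le_base 1
  have h5 : √5 ^ 2 = 5 := Real.sq_sqrt (by norm_num)
  have h6 : 0 ≤ √5 := Real.sqrt_nonneg 5
  have : (base 1 - (1 + √5) / 2) * (base 1 - (1 - √5) / 2) = 0 := by nlinarith
  rcases mul_eq_zero.1 this with h7 | h7
  · linarith
  · exfalso; linarith

/-- In base 1.79 the sixth remainder is already greater than 1, and it would be at least as large in
any larger base, whereas in base q_KL all remainders are at most 1. -/
lemma qKL_lt : qKL < 1.79 := by
  by_contra h
  have h5 : tau 5 = false := by simpa [tau_two] using tau_two_mul_add_one 2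
  have h6 : tau 6 = false := (tau_two_mul 3).trans tau_three
  have e : ∀ q, pp q 6 = q * (q * (q * (q * (q * (q - 1) - 1)) - 1)) := fun q => by
    rw [pp_succ, pp_succ, pp_four, h5, h6]; simp
  have h1 : pp 1.79 6 ≤ pp qKL 6 := by
    refine pp_mono (by norm_num) (not_lt.1 h) fun i hi => ?_
    interval_cases i
    · simp
    · rw [pp_one]; norm_num
    · rw [pp_two]; norm_num
    · rw [pp_three]; norm_num
    · rw [pp_four]; norm_num
    · rw [pp_succ, pp_four, h5]; norm_num
  have h2 := pp_qKL_le_one 6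
  rw [e] at h1
  norm_num at h1
  linarith

lemma base_two_gt : 1.75 < base 2 := by
  refine lt_base_of_pp_neg ?_
  rw [show 2 ^ 2 = 4 by norm_num, pp_four]; norm_num

lemma base_two_le : base 2 ≤ 1.76 := by
  refine base_le_of_pp_nonneg (by norm_num) ?_
  rw [show 2 ^ 2 = 4 by norm_num, pp_four]; norm_num

lemma base_three_gt : 1.78 < base 3 := by
  refine lt_base_of_pp_neg ?_
  have h1 := pp_two_pow_succ (q := 1.78) (by norm_num) 2
  rw [show 2 ^ 2 = 4 by norm_num, pp_four, rho] at h1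
  rw [h1]; norm_num

lemma base_one_bounds : 1.6 < base 1 ∧ base 1 < 1.62 := by
  rw [base_one]
  have h5 : √5 ^ 2 = 5 := Real.sq_sqrt (by norm_num)
  have h6 : 0 ≤ √5 := Real.sqrt_nonneg 5
  constructor <;> nlinarith

lemma base_lt_bound (m : ℕ) : base m < 1.79 := (base_lt_qKL m).trans qKL_lt

/-! ### Univoque sequences below the tails of the Thue-Morse sequence -/

/-- The value of `τ_n … τ_{2^M}` followed by the reflection of `τ₁τ₂…`, in base `qKL`. -/
noncomputable def bound (n M : ℕ) : ℝ :=
  psum qKL (tauTail n) (2 ^ M + 1 - n) + rho qKL / qKL ^ (2 ^ M + 1 - n)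

lemma qKL_pos : 0 < qKL := by linarith [one_lt_qKL]

lemma bound_eq {a M : ℕ} (h : a + 1 ≤ 2 ^ M) :
    bound (a + 1) M = pp qKL a - (pp qKL (2 ^ M) - rho qKL) / qKL ^ (2 ^ M - a) := by
  have h1 : 2 ^ M + 1 - (a + 1) = 2 ^ M - a := by omega
  have h2 : a + (2 ^ M - a) = 2 ^ M := by omega
  rw [bound, h1, psum_tauTail qKL_pos, h2, sub_div]
  ring

lemma rho_lt_pp_qKL (M : ℕ) : rho qKL < pp qKL (2 ^ M) := by
  have hp : 0 < 2 ^ M := by positivity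
  have h1 := val_dd_lt_of_true one_lt_qKL (tauTail_two_pow M) (uni_tauTail le_rfl (2 ^ M - 1))
  rw [← xPt_eq, xPt, rho]
  convert h1 using 2
  ext i; simp only [tauTail]; congr 1; omega

lemma bound_lt_xPt {a M : ℕ} (h : a + 1 ≤ 2 ^ M) : bound (a + 1) M < xPt (a + 1) := by
  rw [bound_eq h, xPt_eq]
  have h1 := rho_lt_pp_qKL M
  have h2 : 0 < qKL ^ (2 ^ M - a) := pow_pos qKL_pos _
  have : 0 < (pp qKL (2 ^ M) - rho qKL) / qKL ^ (2 ^ M - a) := div_pos (by linarith) h2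
  linarith

lemma bound_nonneg (n M : ℕ) : 0 ≤ bound n M := by
  have h1 := psum_nonneg qKL_pos (tauTail n) (2 ^ M + 1 - n)
  have h2 := (rho_pos one_lt_qKL qKL_lt_two).le
  have h3 := qKL_pos
  unfold bound
  positivity

lemma bound_mono {a k M : ℕ} (h : a + 1 ≤ 2 ^ k) (hkM : k ≤ M) :
    bound (a + 1) k ≤ bound (a + 1) M := by
  induction M, hkM using Nat.le_induction with
  | base => exact le_rfl
  | succ M hM ih =>
    refine ih.trans ?_
    have h1 : a + 1 ≤ 2 ^ M := h.trans (Nat.pow_le_pow_right (by norm_num) hM)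
    have h2 : 2 ^ (M + 1) = 2 * 2 ^ M := by ring
    rw [bound_eq h1, bound_eq (by omega)]
    have e1 : 2 ^ (M + 1) - a = (2 ^ M - a) + 2 ^ M := by omega
    have hQ := qKL_pos
    have h3 : (pp qKL (2 ^ (M + 1)) - rho qKL) / qKL ^ (2 ^ (M + 1) - a) ≤
        (pp qKL (2 ^ M) - rho qKL) / qKL ^ (2 ^ M - a) := by
      rw [e1, pow_add qKL, mul_comm (qKL ^ _), ← div_div]
      refine div_le_div_of_nonneg_right ?_ (by positivity)
      -- With X = q^{2^M} and p the remainder at 2^M, (X-1)(p-ρ) - ρ = X(p-ρ) - p, so the inequality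
      -- amounts to p ≥ 0.
      rw [div_le_iff₀ (by positivity), pp_two_pow_succ one_lt_qKL]
      have := pp_qKL_pos (2 ^ M)
      linarith
    linarith

/-- Both p = `pp Q (2 ^ M)` and the gain `pp Q a - pp r a` are multiples of Q - r. The quotient `sg`
is at least Q^{a-1} at `a`, and (Q-1) times it is at most Q^{2^M} - 1 at 2^M. The bound p ≤ Qρ makes
these two estimates fit together. -/
lemma pp_base_le_bound {a M : ℕ} (hM : 2 ≤ M) (ha : 1 ≤ a) (h : a + 1 ≤ 2 ^ M) :
    pp (base M) a ≤ bound (a + 1) M := by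
  have hQ := qKL_pos
  have hQ1 := one_lt_qKL
  have hr := base_lt_qKL M
  set Q := qKL
  set r := base M
  have hL : 4 ≤ 2 ^ M := Nat.pow_le_pow_right (n := 2) (by norm_num) hM
  obtain ⟨W, hW⟩ := Nat.exists_eq_add_of_le (show a ≤ 2 ^ M by omega)
  obtain ⟨b, rfl⟩ := Nat.exists_eq_add_of_le ha
  have hnn : ∀ i ≤ 2 ^ M, 0 ≤ pp r i := fun i hi => pp_nonneg hi le_rfl
  have s1 : sg r Q 1 = 1 := by simp [sg]
  have s2 : Q ^ b * 1 ≤ sg r Q (1 + b) := by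
    rw [← s1]; exact pow_mul_sg_le hQ fun i hi => hnn i (by omega)
  have s3 : (Q - 1) * sg r Q (2 ^ M) ≤ Q ^ (2 ^ M) - 1 := by
    have := sg_add_le (r := r) (s := Q) hQ1.le (a := 0) (W := 2 ^ M)
      fun i hi => pp_base_le_one (by omega)
    simpa [sg] using this
  have d1 := pp_sub_pp r Q (1 + b)
  have d2 := pp_sub_pp r Q (2 ^ M)
  rw [show pp r (2 ^ M) = 0 from pp_base_two_pow M, sub_zero] at d2
  have e1 : tau (2 ^ M + 1) = false := by rw [tau_two_pow_add (by omega)]; simp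
  have e2 : tau (2 ^ M + 2) = false := by rw [tau_two_pow_add (by omega), tau_two]; rfl
  have e3 : pp Q (2 ^ M + 2) = Q * (Q * pp Q (2 ^ M)) := by
    rw [pp_succ, pp_succ, e1, e2]; simp
  -- The two zeros after τ_{2^M} give p ≤ Q⁻².
  have e4 : Q * (Q * pp Q (2 ^ M)) ≤ 1 := e3 ▸ pp_qKL_le_one _
  have e5 : pp Q (2 ^ M) ≤ Q * rho Q := by
    have h1 : Q < 1.79 := qKL_lt
    have h2 : 1.75 < Q := base_two_gt.trans (base_lt_qKL 2)
    have h3 : rho Q * (Q - 1) = 2 - Q := by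
      rw [rho]; field_simp [(by linarith : Q - 1 ≠ 0)]; ring
    have h4 : 0.25 ≤ rho Q := by nlinarith
    have h5 : 0 < pp Q (2 ^ M) := pp_qKL_pos (2 ^ M)
    have h6 : 3 ≤ Q * Q := by nlinarith
    have h7 : 3 * pp Q (2 ^ M) ≤ Q * Q * pp Q (2 ^ M) := mul_le_mul_of_nonneg_right h6 h5.le
    nlinarith
  rw [bound_eq h, show 2 ^ M - (1 + b) = W by omega]
  suffices (pp Q (2 ^ M) - rho Q) / Q ^ W ≤ pp Q (1 + b) - pp r (1 + b) by linarith
  rw [div_le_iff₀ (by positivity), d1]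
  have hpow : Q ^ (2 ^ M) = Q * (Q ^ W * Q ^ b) := by rw [hW]; ring
  have hδ : 0 < Q - r := by linarith
  have k1 : (Q - r) * (Q ^ b * Q ^ W) ≤ (Q - r) * sg r Q (1 + b) * Q ^ W := by
    rw [mul_one] at s2
    have : Q ^ b * Q ^ W ≤ sg r Q (1 + b) * Q ^ W := by gcongr
    nlinarith
  have k2 : (Q - 1) * pp Q (2 ^ M) ≤ (Q - r) * (Q * (Q ^ W * Q ^ b)) := by
    rw [d2, ← hpow]
    nlinarith
  have k3 : Q * (pp Q (2 ^ M) - rho Q) ≤ Q * ((Q - r) * (Q ^ b * Q ^ W)) := by nlinarith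
  exact (le_of_mul_le_mul_left k3 hQ).trans k1

lemma Below.val_lt {q : ℝ} (hq : 1 < q) {n M : ℕ} {d : ℕ → Bool} (hd : Uni q d)
    (h : Below n M d) : val q d < psum q (tauTail n) (2 ^ M + 1 - n) := by
  obtain ⟨i, h0, h1, h2, h3⟩ := h
  exact (LexLt.val_lt_psum hq (t := tauTail n) h1 h2 h3 (hd i)).trans_le
    (psum_mono (by linarith) _ (by omega))

/-- In base `base M` the orbit reaches 0 at time 2^M, so the orbit point at `a` is the value of the
finite word τ_{a+1}…τ_{2^M}. -/
lemma Below.val_lt_pp {q : ℝ} {a M : ℕ} (ha : a + 1 ≤ 2 ^ M) (hq : base M < q)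
    {d : ℕ → Bool} (hd : Uni q d) (h : Below (a + 1) M d) : val q d < pp (base M) a := by
  refine (h.val_lt ((one_le_base M).trans_lt hq) hd).trans_le ?_
  refine (psum_anti (base_pos M) hq.le _ _).trans_eq ?_
  rw [psum_tauTail (base_pos M), show a + (2 ^ M + 1 - (a + 1)) = 2 ^ M by omega,
    pp_base_two_pow]
  simp

/-- Univoque sequences below `τ_n … τ_{2^M} 0^∞` have a value at most `bound n M`. -/
def Bounded (n M : ℕ) : Prop :=
  ∀ q d, 1 < q → Uni q d → Below n M d → val q d ≤ bound n M

/-- Lower the level of the drop as far as the base `q` allows. Either it stops at a level whose base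
lies below `q`, where the orbit of 1 bounds the value, or it reaches the initial level `k`. -/
lemma Bounded.mono {a k M : ℕ} (hk : 1 ≤ k) (ha : 1 ≤ a) (hak : a + 1 ≤ 2 ^ k)
    (h : Bounded (a + 1) k) (hkM : k ≤ M) : Bounded (a + 1) M := by
  rcases Nat.eq_or_lt_of_le hkM with rfl | hlt
  · exact h
  intro q d hq hd hb
  obtain ⟨j, h1, h2, h3, h4⟩ := hd.exists_below hq hak hkM hb
  have hak' : ∀ {l}, k ≤ l → a + 1 ≤ 2 ^ l := fun hl =>
    hak.trans (Nat.pow_le_pow_right (by norm_num) hl)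
  rcases h4 with h4 | rfl
  · refine (h3.val_lt_pp (hak' h1) h4 hd).le.trans (le_trans ?_ (pp_base_le_bound (by omega) ha
      (hak' hkM)))
    exact pp_mono (base_pos j) (base_strictMono.monotone h2) fun i hi =>
      pp_nonneg (by have := hak' h1; omega) le_rfl
  · exact (h q d hq hd h3).trans (bound_mono hak hkM)

/-- This is the rigidity at level 0: `pm 0` is 0^∞, so no digit can change. -/
lemma Uni.eq_const {q : ℝ} (hq : 1 < q) (h : q ≤ base 1) {d : ℕ → Bool} (hd : Uni q d) (i : ℕ) :
    d i = d 0 := by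
  have key : ∀ i, d (i + 1) = d i := by
    intro i
    by_contra hne
    refine hd.not_pm_lexLt (m := 0) hq h i ⟨0, by simp, by simp [pm], ?_⟩
    revert hne
    simp only [dd, add_zero]
    cases d i <;> cases d (i + 1) <;> simp
  induction i with
  | zero => rfl
  | succ i ih => rw [key, ih]

/-- Up to the golden ratio only 0^∞ qualifies, and beyond it the finite word is worth less than in
the golden base. One numerical comparison thus covers all bases. -/
lemma bounded_of_psum_le {n k : ℕ}
    (h : psum (base 1) (tauTail n) (2 ^ k + 1 - n) ≤ bound n k) : Bounded n k := by
  intro q d hq hd hb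
  rcases le_or_gt q (base 1) with hle | hlt
  · obtain ⟨i, -, -, h2, -⟩ := hb
    have h0 : ∀ l, d l = false := fun l => by
      rw [hd.eq_const hq hle l, ← hd.eq_const hq hle i, h2]
    have : val q d = 0 := by rw [val_eq_tsum]; simp [h0]
    rw [this]
    exact bound_nonneg n k
  · exact (hb.val_lt hq hd).le.trans ((psum_anti (base_pos 1) hlt.le _ _).trans h)

lemma one_div_base_one_le : 1 / base 1 ≤ 1 / qKL + rho qKL / qKL := by
  have h1 := qKL_lt
  have h2 := one_lt_qKL
  have h3 := base_one_bounds.1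
  have h4 : 1 / qKL + rho qKL / qKL = 1 / (qKL * (qKL - 1)) := by
    rw [rho]; field_simp [(by linarith : qKL - 1 ≠ 0)]; ring
  rw [h4]
  refine one_div_le_one_div_of_le (by nlinarith) (by nlinarith)

lemma bounded_two : Bounded 2 1 := by
  refine bounded_of_psum_le ?_
  have h : ∀ q, psum q (tauTail 2) 1 = 1 / q := fun q => by
    rw [psum_succ]; simp [tauTail, tau_two]
  rw [bound, show 2 ^ 1 + 1 - 2 = 1 by norm_num, h, h, pow_one]
  exact one_div_base_one_le

lemma bounded_four : Bounded 4 2 := by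
  refine bounded_of_psum_le ?_
  have h : ∀ q, psum q (tauTail 4) 1 = 1 / q := fun q => by
    rw [psum_succ]; simp [tauTail, tau_four]
  rw [bound, show 2 ^ 2 + 1 - 4 = 1 by norm_num, h, h, pow_one]
  exact one_div_base_one_le

lemma bounded_three : Bounded 3 2 := by
  refine bounded_of_psum_le ?_
  have h : ∀ q, psum q (tauTail 3) 2 = 1 / q ^ 2 := fun q => by
    rw [psum_succ, psum_succ]; simp [tauTail, tau_four, tau_three]
  rw [bound, show 2 ^ 2 + 1 - 3 = 2 by norm_num, h, h]
  have h1 := qKL_lt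
  have h2 := one_lt_qKL
  have h3 := base_one_bounds.1
  have h4 : 1 / qKL ^ 2 + rho qKL / qKL ^ 2 = 1 / (qKL ^ 2 * (qKL - 1)) := by
    rw [rho]; field_simp [(by linarith : qKL - 1 ≠ 0)]; ring
  rw [h4]
  have h5 : qKL * (qKL - 1) ≤ 1.415 := by nlinarith
  have h6 : 0 < qKL * (qKL - 1) := by nlinarith
  refine one_div_le_one_div_of_le (by nlinarith) ?_
  nlinarith

lemma tau_three_mul_add {k x : ℕ} (hx : x ≤ 2 ^ k) : tau (3 * 2 ^ k + x) = tau x := by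
  rcases Nat.lt_or_eq_of_le hx with h | rfl
  · rw [mul_comm, tau_add k 3 x h, tau_three]; simp
  · rw [show 3 * 2 ^ k + 2 ^ k = 2 ^ (k + 2) by ring, tau_two_pow, tau_two_pow]

lemma S.one_lt {n : ℕ} (h : S n) : 1 < n := by
  cases h with
  | two => norm_num
  | three => norm_num
  | four => norm_num
  | step k n hk h1 h2 h3 h4 =>
    have : 2 ^ 2 ≤ 2 ^ k := Nat.pow_le_pow_right (by norm_num) hk
    omega

lemma level_le {n k M : ℕ} (h1 : 2 ^ k < 2 * n) (h2 : n ≤ 2 ^ M) : k ≤ M := by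
  have h : 2 ^ k < 2 ^ (M + 1) := by rw [pow_succ]; omega
  have := (Nat.pow_lt_pow_iff_right (by norm_num : 1 < 2)).1 h
  omega

/-- The recursion defining S matches τ_{3·2^l+i} = τ_i for i ≤ 2^l. The word from n = 3·2^l + n' to
2^{l+2} equals the one from n' to 2^l, so the drops and the bound coincide at this level, and
monotonicity gives the higher levels. -/
lemma S.bounded {n : ℕ} (h : S n) : ∀ M, n ≤ 2 ^ M → Bounded n M := by
  induction h with
  | two => exact fun M hM => bounded_two.mono (a := 1) le_rfl le_rfl (by norm_num)
            (level_le (by norm_num) hM)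
  | three => exact fun M hM => bounded_three.mono (a := 2) (by norm_num) (by norm_num)
              (by norm_num) (level_le (by norm_num) hM)
  | four => exact fun M hM => bounded_four.mono (a := 3) (by norm_num) (by norm_num)
              (by norm_num) (level_le (by norm_num) hM)
  | step k n hk h1 h2 h3 h4 ih =>
    intro M hM
    obtain ⟨l, rfl⟩ : ∃ l, k = l + 1 := ⟨k - 1, by omega⟩
    simp only [Nat.add_sub_cancel] at h3 h4 ih
    have e1 : 2 ^ (l + 1) = 2 * 2 ^ l := by ring
    have e2 : 2 ^ (l + 1 + 1) = 4 * 2 ^ l := by ring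
    obtain ⟨n', rfl⟩ := Nat.exists_eq_add_of_lt h3
    have hn' : 3 * 2 ^ l + n' + 1 - 3 * 2 ^ l = n' + 1 := by omega
    rw [hn'] at ih h4
    have hle : n' + 1 ≤ 2 ^ l := by omega
    have hlen : 2 ^ (l + 1 + 1) + 1 - (3 * 2 ^ l + n' + 1) = 2 ^ l + 1 - (n' + 1) := by omega
    have htau : ∀ i, n' + 1 + i ≤ 2 ^ l → tau (3 * 2 ^ l + n' + 1 + i) = tau (n' + 1 + i) :=
      fun i hi => by rw [← tau_three_mul_add hi]; congr 1; ring
    have hlev : Bounded (3 * 2 ^ l + n' + 1) (l + 1 + 1) := by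
      rintro q d hq hd ⟨i, i0, i1, i2, i3⟩
      have hb : bound (3 * 2 ^ l + n' + 1) (l + 1 + 1) = bound (n' + 1) l := by
        rw [bound, bound, hlen]
        congr 1
        exact psum_congr fun i hi => htau i (by omega)
      rw [hb]
      refine ih l hle q d hq hd ⟨i, by omega, fun x hx => ?_, i2, ?_⟩
      · rw [i1 x hx, htau x (by omega)]
      · rw [← htau i (by omega), i3]
    refine hlev.mono (by omega) ?_ (by omega) ?_
    · have : 0 < 2 ^ l := by positivity
      omega
    · refine level_le (n := 3 * 2 ^ l + n' + 1) ?_ hM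
      omega

lemma Uni.val_lt_xPt {n M : ℕ} (hn : S n ∨ n = 1) (hM : n ≤ 2 ^ M) {q : ℝ} (hq : 1 < q)
    {d : ℕ → Bool} (hd : Uni q d) (hb : Below n M d) : val q d < xPt n := by
  rcases hn with hn | rfl
  · obtain ⟨a, rfl⟩ : ∃ a, n = a + 1 := ⟨n - 1, by have := hn.one_lt; omega⟩
    exact (hn.bounded M hM q d hq hd hb).trans_lt (bound_lt_xPt hM)
  · obtain ⟨j, -, -, h3, h4⟩ := hd.exists_below hq (k := 0) (by norm_num) (Nat.zero_le M) hb
    have h5 : base j < q := by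
      rcases h4 with h4 | rfl
      · exact h4
      · rwa [base_zero]
    have := h3.val_lt_pp (a := 0) Nat.one_le_two_pow h5 hd
    rw [xPt_eq 0]
    simpa using this

/-! ### The values of the sequences `cFin` -/

/-- The part of `cFin n M j` that follows `τ_n … τ_{2^M}`. -/
def xTail (M j : ℕ) : ℕ → Bool := fun i => twist (vFin j) M (2 ^ M + 1 + i)

lemma xTail_zero (M i : ℕ) : xTail M 0 i = !pm (M + 1) i := by
  have h : ∀ b, vFin 0 b = decide (b % 2 = 1) := by
    intro b
    rcases b with _ | _ | b
    · simp [vFin]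
    · simp [vFin]
    · rw [show b + 1 + 1 = 0 + 2 + b by ring, vFin_add]; congr 1; apply propext; omega
  rw [xTail, twist, h, ← tau_mod_two_pow_succ, add_assoc, tau_two_pow_add_mod, pm]

lemma vFin_succ_succ (j : ℕ) {b : ℕ} (hb : 1 ≤ b) : vFin (j + 1) (b + 1) = vFin j b := by
  rcases le_or_gt b (j + 1) with h | h
  · rw [vFin_eq_of_le (by omega), vFin_eq_of_le h]; simp [vInf]; omega
  · obtain ⟨x, rfl⟩ := Nat.exists_eq_add_of_le (show j + 2 ≤ b by omega)
    rw [vFin_add, show j + 2 + x + 1 = j + 1 + 2 + x by ring, vFin_add]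

lemma xTail_succ_add (M j i : ℕ) : xTail M (j + 1) (2 ^ M + i) = xTail M j i := by
  have hp : 0 < 2 ^ M := by positivity
  have e : 2 ^ M + 1 + (2 ^ M + i) = 2 ^ M + (2 ^ M + 1 + i) := by ring
  rw [xTail, xTail, e, twist, twist, Nat.add_mod_left, Nat.add_div_left _ hp,
    vFin_succ_succ]
  rw [Nat.le_div_iff_mul_le hp]; omega

lemma xTail_succ_lt {M j i : ℕ} (hi : i < 2 ^ M) :
    xTail M (j + 1) i = if i + 1 < 2 ^ M then !tauTail 1 i else true := by
  have hp : 0 < 2 ^ M := by positivity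
  split_ifs with h
  · have e : 2 ^ M + 1 + i = 2 ^ M * 1 + (1 + i) := by ring
    rw [xTail, e, twist_add _ (by omega), vFin_eq_of_le (by omega), tauTail]; simp [vInf]
  · have e : 2 ^ M + 1 + i = 2 ^ M * 2 := by omega
    rw [xTail, e, twist_mul, vFin_eq_of_le (by omega)]; simp [vInf]

lemma psum_not {q : ℝ} (hq : 1 < q) (d : ℕ → Bool) (N : ℕ) :
    psum q (fun i => !d i) N + psum q d N = (1 + rho q) * (1 - 1 / q ^ N) := by
  have hq1 : q - 1 ≠ 0 := by linarith
  have hq0 : q ≠ 0 := by linarith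
  induction N with
  | zero => simp
  | succ N ih =>
    have h : psum q (fun i => !d i) (N + 1) + psum q d (N + 1) =
        (psum q (fun i => !d i) N + psum q d N) + 1 / q ^ (N + 1) := by
      rw [psum_succ, psum_succ, bit_not]; ring
    rw [h, ih, rho]
    field_simp
    ring

lemma psum_tauTail_one {q : ℝ} (hq : 0 < q) (N : ℕ) :
    psum q (tauTail 1) N = 1 - 1 / q ^ N * pp q N := by
  rw [psum_tauTail hq 0 N, zero_add, pp_zero]; ring

/-- The value of the word `block M`. -/
lemma psum_xTail_succ {q : ℝ} (hq : 1 < q) (M j : ℕ) :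
    psum q (xTail M (j + 1)) (2 ^ M) =
      (1 - 1 / q ^ 2 ^ M) * rho q + 1 / q ^ 2 ^ M * pp q (2 ^ M) := by
  have hp : 0 < 2 ^ M := by positivity
  obtain ⟨L, hL⟩ : ∃ L, 2 ^ M = L + 1 := ⟨2 ^ M - 1, by omega⟩
  have h1 := psum_not hq (tauTail 1) (2 ^ M)
  rw [psum_tauTail_one (by linarith)] at h1
  have h2 : psum q (xTail M (j + 1)) L = psum q (fun i => !tauTail 1 i) L :=
    psum_congr fun i hi => by rw [xTail_succ_lt (by omega), if_pos (by omega)]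
  have h3 : xTail M (j + 1) L = true := by rw [xTail_succ_lt (by omega), if_neg (by omega)]
  have h4 : tauTail 1 L = true := by
    have := tauTail_two_pow M; rwa [hL, Nat.add_sub_cancel] at this
  have h5 : psum q (fun i => !tauTail 1 i) (L + 1) = psum q (fun i => !tauTail 1 i) L := by
    rw [psum_succ, h4]; simp
  rw [hL] at h1 ⊢
  rw [psum_succ, h2, h3, ← h5, bit_true]
  linear_combination h1

lemma val_xTail_succ {q : ℝ} (hq : 1 < q) (M j : ℕ) :
    val q (xTail M (j + 1)) = (1 - 1 / q ^ 2 ^ M) * rho q + 1 / q ^ 2 ^ M * pp q (2 ^ M) +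
      1 / q ^ 2 ^ M * val q (xTail M j) := by
  rw [val_split hq _ (2 ^ M), psum_xTail_succ hq]
  simp_rw [xTail_succ_add]
  ring

/-- `pm (M + 1)` becomes its reflection after 2^M digits, which gives a linear equation for its
value. -/
lemma val_xTail_zero {q : ℝ} (hq : 1 < q) (M : ℕ) :
    (1 + 1 / q ^ 2 ^ M) * val q (xTail M 0) = rho q + 1 / q ^ 2 ^ M * pp q (2 ^ M) := by
  have hp : 0 < 2 ^ M := by positivity
  have e1 : xTail M 0 = fun i => !pm (M + 1) i := by ext i; exact xTail_zero M i
  have e2 : psum q (pm (M + 1)) (2 ^ M) = psum q (tauTail 1) (2 ^ M) :=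
    psum_congr fun i hi => by
      have : 2 ^ (M + 1) = 2 * 2 ^ M := by ring
      rw [pm, Nat.mod_eq_of_lt (by omega), tauTail]
  have e3 : (fun i => pm (M + 1) (2 ^ M + i)) = fun i => !pm (M + 1) i := by
    ext i
    rw [pm, pm, show 1 + (2 ^ M + i) = 2 ^ M + (1 + i) by ring, tau_two_pow_add_mod]
  have h1 := val_split hq (pm (M + 1)) (2 ^ M)
  rw [e2, e3, val_not hq, psum_tauTail_one (by linarith)] at h1
  have h3 : 1 / (q - 1) = 1 + rho q := by rw [rho]; ring
  rw [e1, val_not hq, h3]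
  rw [h3] at h1
  have hq0 : q ≠ 0 := by linarith
  linear_combination (-1 : ℝ) * h1

lemma val_cFin {q : ℝ} (hq : 1 < q) {a M : ℕ} (h : a + 1 ≤ 2 ^ M) (j : ℕ) :
    val q (cFin (a + 1) M j) =
      pp q a + (val q (xTail M j) - pp q (2 ^ M)) / q ^ (2 ^ M - a) := by
  have e1 : psum q (cFin (a + 1) M j) (2 ^ M - a) = psum q (tauTail (a + 1)) (2 ^ M - a) :=
    psum_congr fun i hi => twist_of_le (by simp [vFin]) (by simp [vFin]) (by omega)
  have e2 : (fun i => cFin (a + 1) M j (2 ^ M - a + i)) = xTail M j := by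
    ext i; rw [cFin, xTail]; congr 1; omega
  rw [val_split hq _ (2 ^ M - a), e1, e2, psum_tauTail (by linarith),
    show a + (2 ^ M - a) = 2 ^ M by omega]
  ring

lemma val_xTail_sub {q : ℝ} (hq : 1 < q) (M j : ℕ) :
    val q (xTail M (j + 1)) - val q (xTail M j) =
      (1 / q ^ 2 ^ M) ^ j * (val q (xTail M 1) - val q (xTail M 0)) := by
  induction j with
  | zero => simp
  | succ j ih =>
    rw [val_xTail_succ hq M (j + 1), pow_succ]
    have := val_xTail_succ hq M j
    linear_combination (1 / q ^ 2 ^ M) * ih - this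

lemma val_cFin_sub {q : ℝ} (hq : 1 < q) {a M : ℕ} (h : a + 1 ≤ 2 ^ M) (j : ℕ) :
    val q (cFin (a + 1) M (j + 1)) - val q (cFin (a + 1) M j) =
      (1 / q ^ 2 ^ M) ^ j * (val q (xTail M 1) - val q (xTail M 0)) / q ^ (2 ^ M - a) := by
  rw [val_cFin hq h, val_cFin hq h, ← val_xTail_sub hq]
  ring

lemma inv_pow_mem {q : ℝ} (hq : 1 < q) (M : ℕ) : 0 < 1 / q ^ 2 ^ M ∧ 1 / q ^ 2 ^ M < 1 := by
  have h : 1 < q ^ 2 ^ M := one_lt_pow₀ hq (by positivity)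
  exact ⟨by positivity, by rw [div_lt_one (by linarith)]; exact h⟩

lemma xTail_one_gt {q : ℝ} (hq : 1 < q) (hq2 : q < 2) {M : ℕ} (h : base M ≤ q) :
    val q (xTail M 0) < val q (xTail M 1) := by
  have h0 := val_xTail_zero hq M
  have h1 := val_xTail_succ hq M 0
  rw [zero_add] at h1
  have hz := inv_pow_mem hq M
  have hr := rho_pos hq hq2
  have hp := pp_nonneg (N := 2 ^ M) le_rfl h
  set z := 1 / q ^ 2 ^ M
  set p := pp q (2 ^ M)
  have key : (1 + z) * (val q (xTail M 1) - val q (xTail M 0)) =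
      (1 - z) * z * rho q + 2 * z ^ 2 * p := by
    rw [h1]; linear_combination (z - 1) * h0
  have : 0 < (1 - z) * z * rho q + 2 * z ^ 2 * p := by
    have : 0 < (1 - z) * z * rho q := mul_pos (mul_pos (by linarith) hz.1) hr
    positivity
  rw [← key] at this
  have := pos_of_mul_pos_right this (by linarith)
  linarith

lemma val_cFin_strictMono {q : ℝ} (hq : 1 < q) (hq2 : q < 2) {a M : ℕ} (h : base M ≤ q)
    (ha : a + 1 ≤ 2 ^ M) : StrictMono fun j => val q (cFin (a + 1) M j) := by
  refine strictMono_nat_of_lt_succ fun j => ?_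
  rw [← sub_pos, val_cFin_sub hq ha]
  have := xTail_one_gt hq hq2 h
  have h1 : 0 < val q (xTail M 1) - val q (xTail M 0) := by linarith
  positivity

lemma xTail_zero_base (M : ℕ) :
    val (base (M + 1)) (xTail M 0) = rho (base (M + 1)) := by
  have hb := one_lt_base (m := M + 1) (by omega)
  have h := val_xTail_zero hb M
  rw [pp_base_succ] at h
  have hz := inv_pow_mem hb M
  set z := 1 / base (M + 1) ^ 2 ^ M
  have : (1 + z) * (val (base (M + 1)) (xTail M 0) - rho (base (M + 1))) = 0 := by linarith
  rcases mul_eq_zero.1 this with h | h <;> linarith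

lemma xTail_one_base (M : ℕ) :
    val (base (M + 1)) (xTail M 1) =
      rho (base (M + 1)) * (1 + 1 / base (M + 1) ^ 2 ^ M) := by
  have hb := one_lt_base (m := M + 1) (by omega)
  rw [val_xTail_succ hb M 0, xTail_zero_base, pp_base_succ]
  ring

/-- The increments of `j ↦ val q (cFin n M j)` are dominated by those in base `base (M+1)`. -/
lemma val_cFin_sub_lt {q : ℝ} {a M : ℕ} (h : base (M + 1) < q) (ha : a + 1 ≤ 2 ^ M) (j : ℕ) :
    val q (cFin (a + 1) M (j + 2)) - val q (cFin (a + 1) M (j + 1)) <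
      val (base (M + 1)) (cFin (a + 1) M (j + 1)) - val (base (M + 1)) (cFin (a + 1) M j) := by
  have hb := one_lt_base (m := M + 1) (by omega)
  have hq : 1 < q := hb.trans h
  rw [val_cFin_sub hq ha, val_cFin_sub hb ha, xTail_zero_base, xTail_one_base]
  set r := base (M + 1) with hr
  have hrho : 0 < rho r := rho_pos hb (base_lt_two _)
  -- An extra block puts its own value in front of the old tail and shifts that tail. The block is
  -- worth exactly `rho r` in base `r`, and the shift does not increase the tail's value.
  have hD : val q (xTail M 1) - val q (xTail M 0) ≤ rho r := by
    have h1 := val_split hq (xTail M 1) (2 ^ M)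
    have h2 := psum_anti (by linarith : 0 < r) h.le (xTail M 1) (2 ^ M)
    have h3 : psum r (xTail M 1) (2 ^ M) = rho r := by
      have := psum_xTail_succ hb M 0
      rw [pp_base_succ] at this
      rw [zero_add] at this
      rw [this]; ring
    have h4 := inv_pow_mem hq M
    have h5 := val_nonneg hq (xTail M 0)
    have h6 : (fun i => xTail M 1 (2 ^ M + i)) = xTail M 0 := by
      ext i; exact xTail_succ_add M 0 i
    rw [h6] at h1
    have h7 : val q (xTail M 0) / q ^ 2 ^ M ≤ val q (xTail M 0) :=
      div_le_self h5 (one_le_pow₀ hq.le)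
    linarith
  have hz : 1 / q ^ 2 ^ M ≤ 1 / r ^ 2 ^ M := by gcongr
  have hzq := (inv_pow_mem hq M).1
  have hW : 1 / q ^ (2 ^ M - a) < 1 / r ^ (2 ^ M - a) := by
    refine one_div_lt_one_div_of_lt (by positivity) (pow_lt_pow_left₀ h (by linarith) (by omega))
  calc (1 / q ^ 2 ^ M) ^ (j + 1) * (val q (xTail M 1) - val q (xTail M 0)) / q ^ (2 ^ M - a)
      ≤ (1 / q ^ 2 ^ M) ^ (j + 1) * rho r * (1 / q ^ (2 ^ M - a)) := by
        rw [div_eq_mul_one_div]; gcongr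
    _ ≤ (1 / r ^ 2 ^ M) ^ (j + 1) * rho r * (1 / q ^ (2 ^ M - a)) := by gcongr
    _ < (1 / r ^ 2 ^ M) ^ (j + 1) * rho r * (1 / r ^ (2 ^ M - a)) := by gcongr
    _ = _ := by ring

/-! ### The gap between consecutive intervals -/

/-- Since zρ_s = (1-z)(s-r)(K+c), every term becomes a multiple of s - r. Cancelling this factor
leaves `hF`, in which the small distance of the two bases no longer occurs. -/
lemma remainder_ineq {r s z K ρs ρr p g c Y : ℝ} (hrs : r < s) (hz0 : 0 < z) (hz1 : z < 1)
    (hp : (1 - z) * p = ρs) (hρ : ρr = ρs + (s - r) * c) (hK : p - ρr = (s - r) * K)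
    (hY : (1 - z ^ 2) * Y = ρs * (z ^ 2 + z ^ 3 + z ^ 4))
    (hF : (z * K + z * c) * (2 + 2 * z + z ^ 2) < (1 + z) * (c * (1 + z) + g)) :
    p - ρr - (s - r) * g < ρr * z - Y := by
  have h1 : 0 < 1 - z ^ 2 := by nlinarith
  have h2 : ρs * z = (1 - z) * ((s - r) * (K + c)) := by
    linear_combination (1 - z) * hK + (1 - z) * hρ - hp
  have key : (1 - z ^ 2) * (p - ρr - (s - r) * g - (ρr * z - Y)) =
      (s - r) * (1 - z) * ((z * K + z * c) * (2 + 2 * z + z ^ 2) -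
        (1 + z) * (c * (1 + z) + g)) := by
    linear_combination (1 + z) * hp + hY + z * (2 + 2 * z + z ^ 2) * h2 -
      (1 - z ^ 2) * (1 + z) * hρ
  have h3 : (s - r) * (1 - z) * ((z * K + z * c) * (2 + 2 * z + z ^ 2) -
        (1 + z) * (c * (1 + z) + g)) < 0 :=
    mul_neg_of_pos_of_neg (mul_pos (by linarith) (by linarith)) (by linarith)
  rw [← key] at h3
  have := neg_of_mul_neg_right h3 h1.le
  linarith

/-- The claim reads c(1-z²-z³) + (1+z)g - k(2+2z+z²) > 0, and under the stated conditions its worst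
case is the corner z₀, k₀, c₀, g₀. -/
lemma bounds_ineq {z k c g z₀ k₀ c₀ g₀ : ℝ} (hz : 0 ≤ z) (hz₀ : z ≤ z₀) (hz₁ : z₀ ≤ 1 / 2)
    (hk : k ≤ k₀) (hc : c₀ ≤ c) (hc₀ : 0 ≤ c₀) (hg : g₀ ≤ g) (hgk : g₀ ≤ 2 * k₀) (hk₀ : 0 ≤ k₀)
    (h : 0 < c₀ * (1 - z₀ ^ 2 - z₀ ^ 3) + (1 + z₀) * g₀ - k₀ * (2 + 2 * z₀ + z₀ ^ 2)) :
    (k + z * c) * (2 + 2 * z + z ^ 2) < (1 + z) * (c * (1 + z) + g) := by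
  have e2 : z ^ 2 ≤ z₀ ^ 2 := by gcongr
  have e3 : z ^ 3 ≤ z₀ ^ 3 := by gcongr
  have e4 : z₀ ^ 2 ≤ 1 / 4 := by nlinarith
  have e5 : z₀ ^ 3 ≤ 1 / 8 := by nlinarith
  have h1 : c₀ * (1 - z₀ ^ 2 - z₀ ^ 3) ≤ c * (1 - z ^ 2 - z ^ 3) :=
    mul_le_mul hc (by linarith) (by linarith) (by linarith)
  have h2 : k * (2 + 2 * z + z ^ 2) ≤ k₀ * (2 + 2 * z + z ^ 2) :=
    mul_le_mul_of_nonneg_right hk (by positivity)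
  have h3 : (1 + z) * g₀ ≤ (1 + z) * g := mul_le_mul_of_nonneg_left hg (by linarith)
  have h4 : k₀ * z ^ 2 ≤ k₀ * z₀ ^ 2 := mul_le_mul_of_nonneg_left e2 hk₀
  have h5 : z * (2 * k₀ - g₀) ≤ z₀ * (2 * k₀ - g₀) := mul_le_mul_of_nonneg_right hz₀ (by linarith)
  nlinarith

lemma sg_two (r s : ℝ) : sg r s 2 = s + (r - 1) := by
  rw [sg_succ, sg_succ, pp_one]; simp [sg]

lemma sg_four (r s : ℝ) : sg r s 4 =
    s ^ 3 + s ^ 2 * (r - 1) + s * (r * (r - 1) - 1) + r * (r * (r - 1) - 1) := by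
  rw [sg_succ, sg_succ, sg_two, pp_two, pp_three]; ring

lemma sg_four_le {r s : ℝ} (hr0 : 1.75 ≤ r) (hr : r ≤ 1.79) (hs : 1.78 ≤ s) :
    sg r s 4 ≤ 0.96 * s ^ 4 := by
  have h1 : r * (r - 1) - 1 ≤ 0.4141 := by nlinarith
  have h2 : r * (r * (r - 1) - 1) ≤ 0.7413 := by nlinarith
  have h3 : s * (r * (r - 1) - 1) ≤ s * 0.4141 := by gcongr
  have h4 : s ^ 2 * (r - 1) ≤ s ^ 2 * 0.79 := by gcongr; linarith
  have h5 : 1.78 * s ≤ s ^ 2 := by nlinarith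
  have h6 : 1.78 * s ^ 2 ≤ s ^ 3 := by nlinarith [sq_nonneg s]
  have h7 : 1.78 * s ^ 3 ≤ s ^ 4 := by
    have : 0 ≤ s ^ 3 := by positivity
    nlinarith
  rw [sg_four]
  linarith

/-- As M grows, `z` becomes small and `z * sg` stays bounded. So M = 1 and M = 2 are computed
separately and all larger M are treated at once. -/
lemma base_gap_ineq {M : ℕ} (hM : 1 ≤ M) :
    let r := base (M + 1)
    let s := base (M + 2)
    let z := 1 / s ^ 2 ^ M
    let c := 1 / ((r - 1) * (s - 1))
    (z * sg r s (2 ^ M) + z * c) * (2 + 2 * z + z ^ 2) <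
      (1 + z) * (c * (1 + z) + 1 / (r * (r - 1))) := by
  intro r s z c
  have hs : 1.78 < s := base_three_gt.trans_le (base_strictMono.monotone (by omega))
  have hs' : s < 1.79 := base_lt_bound _
  have hr' : r < 1.79 := base_lt_bound _
  have hr : 1.75 < r := base_two_gt.trans_le (base_strictMono.monotone (by omega))
  have hzp : 0 < z := (inv_pow_mem (by linarith : 1 < s) M).1
  have hs4 : 10 ≤ s ^ 4 := by
    have : (1.78 : ℝ) ^ 4 ≤ s ^ 4 := by gcongr
    norm_num at this ⊢; linarith
  have hc : 1.6 ≤ c := by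
    rw [le_div_iff₀ (by nlinarith)]; nlinarith
  have hg : 0.707 ≤ 1 / (r * (r - 1)) := by
    rw [le_div_iff₀ (by nlinarith)]; nlinarith
  rcases Nat.lt_or_ge M 2 with h2 | h2
  · obtain rfl : M = 1 := by omega
    have hr2 : r ≤ 1.76 := base_two_le
    have hc : 1.66 ≤ c := by
      rw [le_div_iff₀ (by nlinarith)]; nlinarith
    have hg : 0.747 ≤ 1 / (r * (r - 1)) := by
      rw [le_div_iff₀ (by nlinarith)]; nlinarith
    have hz : z = 1 / s ^ 2 := by simp only [z, pow_one]
    refine bounds_ineq (z₀ := 0.3157) (k₀ := 0.81) hzp.le ?_ (by norm_num) ?_ hc (by norm_num) hg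
      (by norm_num) (by norm_num) (by norm_num)
    · rw [hz, div_le_iff₀ (by positivity)]; nlinarith
    · rw [hz, pow_one, sg_two, one_div_mul_eq_div, div_le_iff₀ (by positivity)]; nlinarith
  have h4 := sg_four_le hr.le hr'.le hs.le
  rcases Nat.lt_or_ge M 3 with h3 | h3
  · obtain rfl : M = 2 := by omega
    have hz : z = 1 / s ^ 4 := rfl
    refine bounds_ineq (z₀ := 0.1) (k₀ := 0.97) hzp.le ?_ (by norm_num) ?_ hc (by norm_num) hg
      (by norm_num) (by norm_num) (by norm_num)
    · rw [hz, div_le_iff₀ (by positivity)]; linarith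
    · rw [hz, show (2 : ℕ) ^ 2 = 4 by norm_num, one_div_mul_eq_div, div_le_iff₀ (by positivity)]
      linarith
  · have hL : 8 ≤ 2 ^ M := Nat.pow_le_pow_right (n := 2) (by norm_num) h3
    obtain ⟨W, hW⟩ := Nat.exists_eq_add_of_le (show 4 ≤ 2 ^ M by omega)
    have hW4 : 4 ≤ W := by omega
    have hsW : s ^ 4 ≤ s ^ W := pow_le_pow_right₀ (by linarith) hW4
    have hz : z = 1 / (s ^ 4 * s ^ W) := by simp only [z]; rw [hW, pow_add]
    -- After the explicit value at time 4, bounding all later remainders by 1 is good enough to keep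
    -- `z * sg` below 1.1.
    have h5 := sg_add_le (r := r) (s := s) (by linarith) (a := 4) (W := W) fun i hi =>
      pp_base_le_one (by rw [pow_succ]; omega)
    rw [← hW] at h5
    have hpos : 0 < s ^ 4 * s ^ W := by positivity
    refine bounds_ineq (z₀ := 0.01) (k₀ := 1.1) hzp.le ?_ (by norm_num) ?_ hc (by norm_num) hg
      (by norm_num) (by norm_num) (by norm_num)
    · rw [hz, div_le_iff₀ hpos]; nlinarith
    · rw [hz, one_div_mul_eq_div, div_le_iff₀ hpos]
      have h6 : (s - 1) * sg r s 4 + 1 ≤ (s - 1) * (1.1 * s ^ 4) := by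
        have : (s - 1) * sg r s 4 ≤ (s - 1) * (0.96 * s ^ 4) :=
          mul_le_mul_of_nonneg_left h4 (by linarith)
        nlinarith
      have h7 : s ^ W * ((s - 1) * sg r s 4 + 1) ≤ s ^ W * ((s - 1) * (1.1 * s ^ 4)) := by gcongr
      have h8 : (s - 1) * sg r s (2 ^ M) ≤ (s - 1) * (1.1 * (s ^ 4 * s ^ W)) := by nlinarith
      exact le_of_mul_le_mul_left h8 (by linarith)

lemma val_xTail_two_sub (M : ℕ) :
    let s := base (M + 2)
    let z := 1 / s ^ 2 ^ M
    (1 - z) * pp s (2 ^ M) = rho s ∧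
    (1 - z ^ 2) * (val s (xTail M 2) - pp s (2 ^ M)) = rho s * (z ^ 2 + z ^ 3 + z ^ 4) := by
  intro s z
  have hs : 1 < s := one_lt_base (by omega)
  have h := pp_base_add_two M
  have h0 := val_xTail_zero hs M
  have h1 := val_xTail_succ hs M 0
  have h2 := val_xTail_succ hs M 1
  rw [zero_add] at h1
  rw [one_add_one_eq_two] at h2
  have hsz : s ^ 2 ^ M * z = 1 := by
    simp only [z]; field_simp
  change (s ^ 2 ^ M - 1) * (pp s (2 ^ M) - rho s) = rho s at h
  change val s (xTail M 2) = (1 - z) * rho s + z * pp s (2 ^ M) + z * val s (xTail M 1) at h2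
  change val s (xTail M 1) = (1 - z) * rho s + z * pp s (2 ^ M) + z * val s (xTail M 0) at h1
  change (1 + z) * val s (xTail M 0) = rho s + z * pp s (2 ^ M) at h0
  have hp : (1 - z) * pp s (2 ^ M) = rho s := by
    linear_combination z * h - (pp s (2 ^ M) - rho s) * hsz
  refine ⟨hp, ?_⟩
  rw [h2, h1]
  linear_combination (1 - z) * z ^ 2 * h0 + ((1 + z) * (z + z ^ 2 - 1) + z ^ 3) * hp

/-- The left side equals (s-r)·s·`sg r s (2 ^ M - 1)`: this is the extreme case a = 2^M - 1 of the
comparison of two consecutive intervals. -/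
lemma base_gap (M : ℕ) :
    let r := base (M + 1)
    let s := base (M + 2)
    pp s (2 ^ M) - pp r (2 ^ M) - (s - r) * pp r (2 ^ M - 1) <
      rho r * (1 / r ^ 2 ^ M) - (val s (xTail M 2) - pp s (2 ^ M)) := by
  intro r s
  have hr : 1 < r := one_lt_base (by omega)
  have hrs : r < s := base_strictMono (by omega)
  obtain ⟨hp, hY⟩ := val_xTail_two_sub M
  have hz := inv_pow_mem (hr.trans hrs) M
  rcases Nat.eq_zero_or_pos M with rfl | hM
  · have e1 : pp s (2 ^ 0) - pp r (2 ^ 0) - (s - r) * pp r (2 ^ 0 - 1) = 0 := by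
      simp [pp_one]
    rw [e1]
    have hr1 : r = base 1 := rfl
    have hs1 : 1.75 < s := base_two_gt
    have hs2 : s ≤ 1.76 := base_two_le
    have hb := base_one_bounds
    rw [← hr1] at hb
    have h2 : r * (r - 1) - 1 = 0 := by
      have := pp_base_two_pow 1
      rwa [pow_one, pp_two] at this
    have e2 : rho r * (1 / r ^ 2 ^ 0) = 1 / r ^ 2 := by
      have : rho r = 1 / r := by
        rw [rho, sub_eq_iff_eq_add, div_add_one (by linarith), div_eq_div_iff (by linarith)
          (by linarith)]
        linarith
      rw [this]; field_simp; norm_num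
    have e3 : 0.38 < 1 / r ^ 2 := by
      rw [lt_div_iff₀ (by positivity)]; nlinarith
    have h3 : rho s ≤ 1 / 3 := by
      rw [rho, sub_le_iff_le_add, div_le_iff₀ (by linarith)]; nlinarith
    have h4 : 0 < rho s := rho_pos (by linarith) (by linarith)
    set z := 1 / base (0 + 2) ^ 2 ^ 0 with hzdef
    have hz1 : z ≤ 0.5715 := by
      have : z = 1 / s := by rw [hzdef]; simp only [pow_zero, pow_one]; rfl
      rw [this, div_le_iff₀ (by linarith)]; nlinarith
    have hz0 : 0 < z := hz.1
    have e4 : z ^ 2 ≤ 0.3267 := by nlinarith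
    have e5 : z ^ 3 ≤ 0.1868 := by nlinarith
    have e6 : z ^ 4 ≤ 0.1068 := by nlinarith
    have h5 : rho s * (z ^ 2 + z ^ 3 + z ^ 4) ≤ 1 / 3 * (0.3267 + 0.1868 + 0.1068) := by
      gcongr
    rw [e2]
    have h6 : (1 - z ^ 2) * (val s (xTail 0 2) - pp s (2 ^ 0)) ≤ 0.207 := by
      refine (le_of_eq hY).trans (h5.trans ?_)
      norm_num
    by_contra hcon
    have h7 : 0.38 ≤ val s (xTail 0 2) - pp s (2 ^ 0) := by linarith
    nlinarith
  · have hF := base_gap_ineq hM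
    have hpr : pp r (2 ^ M) = rho r := pp_base_succ M
    have hg : pp r (2 ^ M - 1) = 1 / (r * (r - 1)) := by
      obtain ⟨L, hL⟩ : ∃ L, 2 ^ M = L + 1 :=
        ⟨2 ^ M - 1, by have : 0 < 2 ^ M := by positivity
                       omega⟩
      have h1 : r * pp r L - 1 = rho r := by
        rw [← hpr, hL, pp_succ, ← hL, tau_two_pow, bit_true]
      rw [hL, Nat.add_sub_cancel]
      rw [rho] at h1
      have hr1 : r - 1 ≠ 0 := by linarith
      field_simp at h1 ⊢
      linarith
    have h1 := remainder_ineq (r := r) (s := s) (K := sg r s (2 ^ M)) (ρr := rho r)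
      (p := pp s (2 ^ M)) hrs hz.1 hz.2 hp
      (c := 1 / ((r - 1) * (s - 1))) (by
        have hr1 : r - 1 ≠ 0 := by linarith
        have hs1 : s - 1 ≠ 0 := by linarith
        change rho r = rho s + _
        rw [rho, rho]; field_simp; ring)
      (by rw [← hpr]; exact pp_sub_pp r s _) hY hF
    rw [hpr, hg]
    refine h1.trans_le ?_
    have h2 : 1 / s ^ 2 ^ M ≤ 1 / r ^ 2 ^ M := by gcongr
    have h3 := mul_le_mul_of_nonneg_left h2 (rho_pos hr (base_lt_two _)).le
    linarith

/-- Remainders at `a` are carried to time 2^M - 1 by `pow_mul_sg_le`, so the worst starting point is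
the last one, treated in `base_gap`. -/
lemma val_cFin_two_lt {a M : ℕ} (ha : a + 1 ≤ 2 ^ M) :
    val (base (M + 2)) (cFin (a + 1) M 2) < val (base (M + 1)) (cFin (a + 1) M 1) := by
  have hr : 1 < base (M + 1) := one_lt_base (by omega)
  have hrs : base (M + 1) < base (M + 2) := base_strictMono (by omega)
  have hgap := base_gap M
  rw [val_cFin (hr.trans hrs) ha, val_cFin hr ha, xTail_one_base, pp_base_succ]
  have hrho := rho_pos hr (base_lt_two _)
  have hnn : ∀ i ≤ 2 ^ M, 0 ≤ pp (base (M + 1)) i := fun i hi =>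
    pp_nonneg (m := M + 1) (by rw [pow_succ]; omega) le_rfl
  simp only at hgap
  set r := base (M + 1)
  set s := base (M + 2)
  set Y := val s (xTail M 2) - pp s (2 ^ M)
  obtain ⟨W, hW⟩ := Nat.exists_eq_add_of_le ha
  have hWa : 2 ^ M - a = W + 1 := by omega
  have h1 : s ^ W * sg r s a ≤ sg r s (a + W) :=
    pow_mul_sg_le (by linarith) fun i hi => hnn i (by omega)
  have h2 : sg r s (2 ^ M) = s * sg r s (a + W) + pp r (2 ^ M - 1) := by
    rw [hW, show a + 1 + W = a + W + 1 by ring, sg_succ, Nat.add_sub_cancel]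
  have h3 := pp_sub_pp r s (2 ^ M)
  have h4 := pp_sub_pp r s a
  have h5 : s ^ (W + 1) * (pp s a - pp r a) + Y < rho r * (1 / r ^ 2 ^ M) := by
    have h6 : (s - r) * (s * (s ^ W * sg r s a)) ≤ (s - r) * (s * sg r s (a + W)) := by
      have : 0 ≤ s - r := by linarith
      have : 0 ≤ s := by linarith
      gcongr
    have h7 : s ^ (W + 1) * (pp s a - pp r a) = (s - r) * (s * (s ^ W * sg r s a)) := by
      rw [h4]; ring
    rw [h7]
    rw [h3, h2] at hgap
    linarith
  rw [hWa]
  have hs : 0 < s ^ (W + 1) := by have : 0 < s := by linarith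
                                  positivity
  have hr0 : 0 < r := by linarith
  have h8 : rho r * (1 / r ^ 2 ^ M) / s ^ (W + 1) ≤ rho r * (1 / r ^ 2 ^ M) / r ^ (W + 1) := by
    gcongr
  have h9 : (s ^ (W + 1) * (pp s a - pp r a) + Y) / s ^ (W + 1) <
      rho r * (1 / r ^ 2 ^ M) / s ^ (W + 1) := by gcongr
  rw [add_div, mul_div_cancel_left₀ _ hs.ne'] at h9
  have e : rho r * (1 + 1 / r ^ 2 ^ M) - rho r = rho r * (1 / r ^ 2 ^ M) := by ring
  rw [e]
  linarith

lemma val_cFin_succ_lt {a M : ℕ} (ha : a + 1 ≤ 2 ^ M) (j : ℕ) :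
    val (base (M + 2)) (cFin (a + 1) M (j + 2)) < val (base (M + 1)) (cFin (a + 1) M (j + 1)) := by
  induction j with
  | zero => exact val_cFin_two_lt ha
  | succ j ih =>
    have := val_cFin_sub_lt (q := base (M + 2)) (base_strictMono (by omega)) ha (j + 1)
    linarith

/-! ### The words of the cascades -/

lemma length_block (m : ℕ) : (block m).length = 2 ^ m := by
  have hp : 0 < 2 ^ m := by positivity
  simp [block, plus, refl, length_tauWord]; omega

lemma getD_block {m i : ℕ} (hi : i < 2 ^ m) :
    (block m).getD i false = if i + 1 < 2 ^ m then !tau (1 + i) else true := by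
  have hl : (refl (tauWord 1 (2 ^ m))).length = 2 ^ m := by simp [refl, length_tauWord]
  rw [block, plus, getD_dropLast_append (by rw [hl]; exact hi), hl]
  split_ifs with h
  · have h1 : i < (refl (tauWord 1 (2 ^ m))).length := by omega
    rw [List.getD_eq_getElem _ _ h1]
    simp [refl, tauWord]
  · rfl

lemma twist_eq_block {v : ℕ → Bool} {M b : ℕ} (h0 : v b = true) (h1 : v (b + 1) = true) {i : ℕ}
    (hi : i < 2 ^ M) : twist v M (2 ^ M * b + (1 + i)) = (block M).getD i false := by
  rw [getD_block hi]
  split_ifs with h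
  · rw [twist_add v (by omega), h0]; simp
  · rw [show 2 ^ M * b + (1 + i) = 2 ^ M * (b + 1) by rw [mul_add]; omega, twist_mul, h1]

lemma cSeqInf_eq {n M : ℕ} (hn : n ≤ 2 ^ M) :
    wordThen (tauWord n (2 ^ M)) (periodic (block M)) = cInf n M := by
  have hp : 0 < 2 ^ M := by positivity
  ext i
  rw [wordThen, length_tauWord]
  split_ifs with h
  · rw [getD_tauWord (by omega), cInf, twist_of_le (by simp [vInf]) (by simp [vInf]) (by omega)]
  · obtain ⟨l, rfl⟩ := Nat.exists_eq_add_of_le (not_lt.1 h)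
    rw [Nat.add_sub_cancel_left, periodic, length_block, cInf]
    rw [← twist_eq_block (v := vInf) (b := l / 2 ^ M + 1) (by simp [vInf]) (by simp [vInf])
      (Nat.mod_lt _ hp)]
    congr 1
    have := Nat.div_add_mod l (2 ^ M)
    rw [mul_add]
    omega

lemma getD_wordPow (w : List Bool) : ∀ (j : ℕ) {i : ℕ}, i < w.length * j →
    (wordPow w j).getD i false = w.getD (i % w.length) false
  | 0, i, h => by simp at h
  | j + 1, i, h => by
    have e : wordPow w (j + 1) = w ++ wordPow w j := by simp [wordPow, List.replicate_succ]
    rw [e]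
    rcases lt_or_ge i w.length with hi | hi
    · rw [List.getD_append _ _ _ _ hi, Nat.mod_eq_of_lt hi]
    · rw [List.getD_append_right _ _ _ _ hi, getD_wordPow w j (by rw [mul_add] at h; omega),
        ← Nat.mod_eq_sub_mod hi]

lemma length_wordPow (w : List Bool) (j : ℕ) : (wordPow w j).length = w.length * j := by
  simp [wordPow, mul_comm]

lemma cSeq_eq {n M : ℕ} (hn : n ≤ 2 ^ M) (j : ℕ) : cSeq n (M + 1) j = cFin n M j := by
  have hp : 0 < 2 ^ M := by positivity
  ext i
  rw [cSeq, Nat.add_sub_cancel, wordThen, List.length_append, length_tauWord, length_wordPow,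
    length_block]
  split_ifs with h
  · rcases lt_or_ge i (2 ^ M + 1 - n) with h1 | h1
    · rw [List.getD_append _ _ _ _ (by rw [length_tauWord]; exact h1), getD_tauWord (by omega),
        cFin, twist_of_le (by simp [vFin]) (by simp [vFin]) (by omega)]
    · rw [List.getD_append_right _ _ _ _ (by rw [length_tauWord]; exact h1), length_tauWord]
      obtain ⟨l, rfl⟩ := Nat.exists_eq_add_of_le h1
      rw [Nat.add_sub_cancel_left, getD_wordPow _ _ (by rw [length_block]; omega), length_block]
      have hl : l / 2 ^ M < j := Nat.div_lt_of_lt_mul (by omega)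
      rw [← twist_eq_block (v := vFin j) (b := l / 2 ^ M + 1)
        (by rw [vFin_eq_of_le (by omega)]; simp [vInf])
        (by rw [vFin_eq_of_le (by omega)]; simp [vInf]) (Nat.mod_lt _ hp), cFin]
      congr 1
      have := Nat.div_add_mod l (2 ^ M)
      rw [mul_add]
      omega
  · obtain ⟨l, rfl⟩ := Nat.exists_eq_add_of_le (not_lt.1 h)
    have hp2 : 0 < 2 ^ (M + 1) := by positivity
    have hlt := Nat.mod_lt l hp2
    rw [Nat.add_sub_cancel_left, periodic, length_block, getD_block hlt, cFin]
    have e2 : 2 ^ (M + 1) = 2 * 2 ^ M := by ring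
    have key : n + (2 ^ M + 1 - n + 2 ^ M * j + l) + 2 ^ M = 2 ^ M * (j + 2) + (1 + l) := by
      rw [mul_add]; omega
    have hrefl : twist (vFin j) M (n + (2 ^ M + 1 - n + 2 ^ M * j + l)) =
        !tau ((1 + l) % 2 ^ (M + 1)) := by
      rcases lt_or_ge (1 + l) (2 ^ M) with hl | hl
      · have : n + (2 ^ M + 1 - n + 2 ^ M * j + l) = 2 ^ M * (j + 1) + (1 + l) := by
          rw [mul_add]; omega
        rw [this, twist_add _ hl, vFin_eq_of_le le_rfl, Nat.mod_eq_of_lt (by omega)]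
        simp [vInf]
      · obtain ⟨y, hy⟩ := Nat.exists_eq_add_of_le hl
        have : n + (2 ^ M + 1 - n + 2 ^ M * j + l) = 2 ^ M * (j + 2) + y := by omega
        rw [this, twist_vFin_add, hy, tau_two_pow_add_mod, Bool.not_not]
    rw [hrefl, one_add_mod l hp2]
    split_ifs
    · rw [add_comm]
    · simp

lemma xi_eq {n M : ℕ} (hn : n ≤ 2 ^ M) : xi n (M + 1) = val (base (M + 1)) (cInf n M) := by
  rw [xi, qhat_eq_base (by omega), cSeqInf, Nat.add_sub_cancel, cSeqInf_eq hn]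

lemma xiJ_eq {n M : ℕ} (hn : n ≤ 2 ^ M) (j : ℕ) :
    xiJ n (M + 1) j = val (base (M + 1)) (cFin n M j) := by
  rw [xiJ, qhat_eq_base (by omega), cSeq_eq hn]

/-- The letters 0 1 1 0 1 0 1 …, taken in pairs, are 01, 10, 10, …, that is 01^∞ one level up. Hence
c_1^{(m)} = c_∞^{(m+1)}, which links successive levels. -/
lemma cFin_one (n M : ℕ) : cFin n M 1 = cInf n (M + 1) := by
  ext i
  rw [cFin, cInf, twist, twist, tau_mod_two_pow_succ, pow_succ, ← Nat.div_div_eq_div_mul,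
    ← Bool.xor_assoc]
  congr 1
  set b := (n + i) / 2 ^ M
  rcases lt_or_ge b 3 with h | h
  · interval_cases b <;> simp [vFin, vInf]
  · obtain ⟨x, hx⟩ := Nat.exists_eq_add_of_le h
    have h1 : b / 2 ≠ 0 := by omega
    rw [hx, show 3 + x = 1 + 2 + x by ring, vFin_add, vInf, ← show 3 + x = 1 + 2 + x by ring, ← hx]
    rcases Nat.mod_two_eq_zero_or_one x with h2 | h2
    · have : b % 2 = 1 := by omega
      simp [h1, h2, this]
    · have : b % 2 = 0 := by omega
      simp [h1, h2, this]

lemma cFin_lexLt_cInf {n M : ℕ} (hn : n ≤ 2 ^ M) (j : ℕ) : LexLt (cFin n M j) (cInf n M) := by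
  obtain ⟨p, hp⟩ := Nat.exists_eq_add_of_le (hn.trans (Nat.le_mul_of_pos_right (2 ^ M)
    (show 0 < j + 2 by omega)))
  refine ⟨p, fun i hi => twist_congr_of_lt (B := j + 2)
    (fun b hb => vFin_eq_of_le (by omega)) (by omega), ?_, ?_⟩
  · rw [cFin, ← hp]; simpa using twist_vFin_add j M 0
  · rw [cInf, ← hp, twist_mul]; simp [vInf]

lemma LexLt.trans {s t u : ℕ → Bool} (h1 : LexLt s t) (h2 : LexLt t u) : LexLt s u := by
  obtain ⟨j, j1, j2, j3⟩ := h1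
  obtain ⟨k, k1, k2, k3⟩ := h2
  rcases lt_trichotomy j k with h | rfl | h
  · exact ⟨j, fun i hi => (j1 i hi).trans (k1 i (by omega)), j2, by rw [← k1 j h, j3]⟩
  · simp_all
  · exact ⟨k, fun i hi => (j1 i (by omega)).trans (k1 i hi), by rw [j1 k h, k2], k3⟩

lemma cInf_true {n M : ℕ} (hn : n ≤ 2 ^ M) : cInf n M (2 ^ M - n) = true := by
  have : n + (2 ^ M - n) = 2 ^ M * 1 := by omega
  rw [cInf, this, twist_mul]; simp [vInf]

lemma cFin_true {n M : ℕ} (hn : n ≤ 2 ^ M) (j : ℕ) : cFin n M j (2 ^ M - n) = true := by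
  have : n + (2 ^ M - n) = 2 ^ M * 1 := by omega
  rw [cFin, this, twist_mul]; simp [vFin]

/-! ### The location of the points -/

lemma tendsto_val_cFin {q : ℝ} (hq : 1 < q) {n M : ℕ} (hn : n ≤ 2 ^ M) :
    Tendsto (fun j => val q (cFin n M j)) atTop (𝓝 (val q (cInf n M))) := by
  have h : ∀ j : ℕ, |val q (cFin n M j) - val q (cInf n M)| ≤ 1 / (q - 1) / q ^ j := fun j =>
    abs_val_sub_le hq fun i hi => twist_congr_of_lt (B := j + 2)
      (fun b hb => vFin_eq_of_le (by omega)) (by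
        have : j ≤ 2 ^ M * j := Nat.le_mul_of_pos_left _ (by positivity)
        rw [mul_add]; omega)
  refine tendsto_iff_norm_sub_tendsto_zero.2 (squeeze_zero (fun _ => norm_nonneg _) h ?_)
  exact tendsto_const_nhds.div_atTop (tendsto_pow_atTop_atTop_of_one_lt hq)

lemma strictMono_val_cFin {q : ℝ} (hq : 1 < q) (hq2 : q < 2) {n M : ℕ} (h : base M ≤ q)
    (hn1 : 1 ≤ n) (hn : n ≤ 2 ^ M) : StrictMono fun j => val q (cFin n M j) := by
  obtain ⟨a, rfl⟩ : ∃ a, n = a + 1 := ⟨n - 1, by omega⟩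
  exact val_cFin_strictMono hq hq2 h hn

lemma val_cFin_lt_cInf {q : ℝ} (hq : 1 < q) (hq2 : q < 2) {n M : ℕ} (h : base M ≤ q)
    (hn1 : 1 ≤ n) (hn : n ≤ 2 ^ M) (j : ℕ) : val q (cFin n M j) < val q (cInf n M) :=
  (strictMono_val_cFin hq hq2 h hn1 hn (Nat.lt_succ_self j)).trans_le
    ((strictMono_val_cFin hq hq2 h hn1 hn).monotone.ge_of_tendsto (tendsto_val_cFin hq hn) _)

lemma xiJ_strictMono {n M : ℕ} (hn1 : 1 ≤ n) (hn : n ≤ 2 ^ M) : StrictMono (xiJ n (M + 1)) := by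
  have := strictMono_val_cFin (one_lt_base (m := M + 1) (by omega)) (base_lt_two _)
    (base_strictMono.monotone (Nat.le_succ M)) hn1 hn
  intro i j hij
  rw [xiJ_eq hn, xiJ_eq hn]
  exact this hij

lemma xiJ_lt_xi {n M : ℕ} (hn1 : 1 ≤ n) (hn : n ≤ 2 ^ M) (j : ℕ) :
    xiJ n (M + 1) j < xi n (M + 1) := by
  rw [xiJ_eq hn, xi_eq hn]
  exact val_cFin_lt_cInf (one_lt_base (by omega)) (base_lt_two _)
    (base_strictMono.monotone (Nat.le_succ M)) hn1 hn j

lemma tendsto_xiJ {n M : ℕ} (hn : n ≤ 2 ^ M) :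
    Tendsto (xiJ n (M + 1)) atTop (𝓝 (xi n (M + 1))) := by
  rw [xi_eq hn]
  exact (tendsto_val_cFin (one_lt_base (by omega)) hn).congr fun j => (xiJ_eq hn j).symm

lemma le_two_pow_succ {n M : ℕ} (hn : n ≤ 2 ^ M) : n ≤ 2 ^ (M + 1) :=
  hn.trans (Nat.pow_le_pow_right (by norm_num) (Nat.le_succ M))

lemma xi_succ_lt_xiJ {n M : ℕ} (hn : n ≤ 2 ^ M) :
    xi n (M + 2) < xiJ n (M + 1) 1 := by
  rw [xiJ_eq hn, xi_eq (le_two_pow_succ hn), cFin_one]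
  exact val_strictAnti (one_lt_base (by omega)) (base_strictMono (by omega))
    (cInf_true (le_two_pow_succ hn))

lemma strictAntiOn_of_succ_lt_self {f : ℕ → ℝ} {k : ℕ} (h : ∀ m, k ≤ m → f (m + 1) < f m) :
    StrictAntiOn f (Ici k) := by
  intro a ha b _ hab
  induction b, hab using Nat.le_induction with
  | base => exact h a ha
  | succ b hb ih =>
    have hka : k ≤ a := ha
    have hab : a + 1 ≤ b := hb
    have hkb : k ≤ b := by omega
    exact (h b hkb).trans (ih hkb)

lemma xi_strictAntiOn {n k : ℕ} (hn1 : 1 ≤ n) (hn : n ≤ 2 ^ k) : StrictAntiOn (xi n) (Ioi k) := by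
  have : StrictAntiOn (xi n) (Ici (k + 1)) := by
    refine strictAntiOn_of_succ_lt_self fun m hm => ?_
    obtain ⟨M, rfl⟩ : ∃ M, m = M + 1 := ⟨m - 1, by omega⟩
    have hM := hn.trans (Nat.pow_le_pow_right (by norm_num : 0 < 2) (show k ≤ M by omega))
    exact (xi_succ_lt_xiJ hM).trans (xiJ_lt_xi hn1 hM 1)
  exact this.mono fun m hm => hm

lemma tendsto_xi {n k : ℕ} (hn : n ≤ 2 ^ k) : Tendsto (xi n) atTop (𝓝 (xPt n)) := by
  have hb1 := one_lt_base (le_refl 1)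
  have hM : ∀ m, n ≤ 2 ^ (k + m) := fun m => hn.trans (Nat.pow_le_pow_right (by norm_num) (by omega))
  have hlim : Tendsto (fun m => val (base (k + m + 1)) (tauTail n)) atTop (𝓝 (xPt n)) := by
    have h1 : Tendsto (fun m => base (m + (k + 1))) atTop (𝓝 qKL) :=
      (tendsto_add_atTop_iff_nat (k + 1)).2 tendsto_base
    have h2 : (fun m => base (m + (k + 1))) = fun m => base (k + m + 1) := by
      ext m; congr 1; ring
    rw [h2] at h1
    exact (((continuousOn_val (tauTail n)).continuousAt (Ioi_mem_nhds one_lt_qKL)).tendsto).comp h1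
  have hd : ∀ m : ℕ, |xi n (k + m + 1) - val (base (k + m + 1)) (tauTail n)| ≤
      1 / (base 1 - 1) / base 1 ^ m := by
    intro m
    have hb : base 1 ≤ base (k + m + 1) := base_strictMono.monotone (by omega)
    have hle : n + m ≤ 2 ^ (k + m) := by
      have h1 : 2 ^ k * (m + 1) ≤ 2 ^ k * 2 ^ m := Nat.mul_le_mul_left _ Nat.lt_two_pow_self
      have h2 : m ≤ 2 ^ k * m := Nat.le_mul_of_pos_left _ (by positivity)
      rw [pow_add]
      rw [mul_add] at h1
      omega
    rw [xi_eq (hM m)]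
    refine (abs_val_sub_le (hb1.trans_le hb) (N := m) fun i hi =>
      twist_of_le (by simp [vInf]) (by simp [vInf]) (by omega)).trans ?_
    have : 0 < base 1 - 1 := by linarith
    gcongr
  have h0 : Tendsto (fun m => xi n (k + m + 1) - val (base (k + m + 1)) (tauTail n)) atTop
      (𝓝 0) :=
    squeeze_zero_norm hd (tendsto_const_nhds.div_atTop (tendsto_pow_atTop_atTop_of_one_lt hb1))
  have h1 := h0.add hlim
  simp only [sub_add_cancel, zero_add] at h1
  refine (tendsto_add_atTop_iff_nat (k + 1)).1 (h1.congr fun m => ?_)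
  congr 1; ring

lemma xPt_lt_xi {n M : ℕ} (hn1 : 1 ≤ n) (hn : n ≤ 2 ^ M) : xPt n < xi n (M + 1) := by
  have h1 := xi_strictAntiOn hn1 hn
  refine lt_of_le_of_lt (le_of_tendsto (tendsto_xi hn) ?_)
    (h1 (show M < M + 1 by omega) (show M < M + 2 by omega) (by omega))
  filter_upwards [eventually_ge_atTop (M + 2)] with m hm
  exact h1.antitoneOn (show M < M + 2 by omega) (show M < m by omega) hm

lemma xPt_pos {n : ℕ} (hn1 : 1 ≤ n) : 0 < xPt n := by
  obtain ⟨a, rfl⟩ : ∃ a, n = a + 1 := ⟨n - 1, by omega⟩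
  rw [xPt_eq]
  exact pp_qKL_pos a

/-! ### The values of `q_s` -/

lemma isLeast_of_cInf {n M : ℕ} (hS : S n ∨ n = 1) (hn1 : 1 ≤ n) (hn : n ≤ 2 ^ M) {x q : ℝ}
    (hx : xPt n < x) (hq : base M < q) (hq' : q ≤ base (M + 1)) (hv : val q (cInf n M) = x) :
    IsLeast (univoqueBases x) q := by
  have hq1 : 1 < q := (one_le_base M).trans_lt hq
  have hU := uni_cInf hn1 hq
  refine ⟨mem_univoqueBases.2 ⟨hq1, hq'.trans (base_lt_two _).le, _, hU, hv⟩, fun p hp => ?_⟩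
  obtain ⟨hp1, hp2, d, hd, hdx⟩ := mem_univoqueBases.1 hp
  by_contra hlt
  rw [not_le] at hlt
  have h1 := lexLt_of_lt_base hp1 hlt hU (hdx.trans hv.symm)
    (by rw [hdx]; exact (xPt_pos hn1).trans hx)
  have h2 := hd.val_lt_xPt hS hn hp1 (hd.below_of_lexLt hp1 (hlt.le.trans hq') hn h1)
  linarith

lemma isLeast_of_cFin {n M j : ℕ} (hS : S n ∨ n = 1) (hn1 : 1 ≤ n) (hn : n ≤ 2 ^ M) {x q : ℝ}
    (hx : xPt n < x) (hxj : xiJ n (M + 1) j ≤ x) (hq : base (M + 1) < q) (hq' : q ≤ base (M + 2))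
    (hv : val q (cFin n M (j + 1)) = x) : IsLeast (univoqueBases x) q := by
  have hq1 : 1 < q := (one_le_base _).trans_lt hq
  have hU := uni_cFin hq1 (n := n) (j + 1) hn1 hq
  refine ⟨mem_univoqueBases.2 ⟨hq1, hq'.trans (base_lt_two _).le, _, hU, hv⟩, fun p hp => ?_⟩
  obtain ⟨hp1, hp2, d, hd, hdx⟩ := mem_univoqueBases.1 hp
  by_contra hlt
  rw [not_le] at hlt
  have h1 := lexLt_of_lt_base hp1 hlt hU (hdx.trans hv.symm)
    (by rw [hdx]; exact (xPt_pos hn1).trans hx)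
  -- In bases up to `base (M + 1)` a smaller expansion is worth less than `xPt n`. In larger ones
  -- the lower endpoint `xiJ` places it above `cFin n M j`, inside a gap.
  rcases le_or_gt p (base (M + 1)) with hpb | hpb
  · have h2 := hd.val_lt_xPt hS hn hp1
      (hd.below_of_lexLt hp1 hpb hn (h1.trans (cFin_lexLt_cInf hn _)))
    linarith
  · have h3 : val p (cFin n M j) < val p d := by
      rw [hdx]
      refine lt_of_lt_of_le ?_ hxj
      rw [xiJ_eq hn]
      exact val_strictAnti (one_lt_base (by omega)) hpb (cFin_true hn j)
    have h4 : LexLt (cFin n M j) d := by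
      by_cases hne : cFin n M j = d
      · rw [hne] at h3; exact absurd h3 (lt_irrefl _)
      · rcases lexLt_or hne with h | h
        · exact h
        · exact absurd (h.val_lt hp1 hd) (not_lt.2 h3.le)
    exact hd.not_between hp1 (hlt.le.trans hq') hn h4 h1

lemma exists_val_eq {a b x : ℝ} (ha : 1 < a) (hab : a < b) {c : ℕ → Bool} (h1 : val b c ≤ x)
    (h2 : x < val a c) : ∃ q ∈ Ioc a b, val q c = x := by
  obtain ⟨q, hq, hqx⟩ := intermediate_value_Icc' hab.le
    ((continuousOn_val c).mono fun y hy => ha.trans_le hy.1) ⟨h1, h2.le⟩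
  refine ⟨q, ⟨lt_of_le_of_ne hq.1 ?_, hq.2⟩, hqx⟩
  rintro rfl
  exact h2.ne' hqx

lemma val_injOn {p q : ℝ} (hp : 1 < p) (hq : 1 < q) {c : ℕ → Bool} {i : ℕ} (hc : c i = true)
    (h : val p c = val q c) : p = q := by
  rcases lt_trichotomy p q with hlt | rfl | hlt
  · exact absurd h (val_strictAnti hp hlt hc).ne'
  · rfl
  · exact absurd h (val_strictAnti hq hlt hc).ne

lemma qs_xi {n M : ℕ} (hS : S n ∨ n = 1) (hn1 : 1 ≤ n) (hn : n ≤ 2 ^ M) :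
    IsLeast (univoqueBases (xi n (M + 1))) (base (M + 1)) :=
  isLeast_of_cInf hS hn1 hn (xPt_lt_xi hn1 hn) (base_strictMono (by omega)) le_rfl (xi_eq hn).symm

lemma qs_first {n M : ℕ} (hS : S n ∨ n = 1) (hn1 : 1 ≤ n) (hn : n ≤ 2 ^ M) {x : ℝ}
    (hx : x ∈ Ico (xi n (M + 2)) (xiJ n (M + 1) 1)) :
    IsLeast (univoqueBases x) (qs x) ∧ qs x ∈ Ioc (base (M + 1)) (base (M + 2)) ∧
      val (qs x) (cInf n (M + 1)) = x := by
  have hn2 := le_two_pow_succ hn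
  obtain ⟨q, hq, hqx⟩ := exists_val_eq (c := cInf n (M + 1)) (x := x)
    (one_lt_base (m := M + 1) (by omega)) (base_strictMono (Nat.lt_succ_self (M + 1)))
    (by rw [← xi_eq hn2]; exact hx.1)
    (by rw [← cFin_one, ← xiJ_eq hn]; exact hx.2)
  have h := isLeast_of_cInf hS hn1 hn2 ((xPt_lt_xi hn1 hn2).trans_le hx.1) hq.1 hq.2 hqx
  rw [qs_eq_of_isLeast h]
  exact ⟨h, hq, hqx⟩

lemma qs_later {n M : ℕ} (hS : S n ∨ n = 1) (hn1 : 1 ≤ n) (hn : n ≤ 2 ^ M) {j : ℕ} {x : ℝ}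
    (hx : x ∈ Ico (xiJ n (M + 1) (j + 1)) (xiJ n (M + 1) (j + 2))) :
    IsLeast (univoqueBases x) (qs x) ∧ qs x ∈ Ioo (base (M + 1)) (base (M + 2)) ∧
      val (qs x) (cFin n M (j + 2)) = x := by
  have hn2 := le_two_pow_succ hn
  have hlt : val (base (M + 2)) (cFin n M (j + 2)) < x := by
    refine lt_of_lt_of_le ?_ hx.1
    obtain ⟨a, rfl⟩ : ∃ a, n = a + 1 := ⟨n - 1, by omega⟩
    rw [xiJ_eq hn]
    exact val_cFin_succ_lt hn j
  obtain ⟨q, hq, hqx⟩ := exists_val_eq (c := cFin n M (j + 2)) (x := x)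
    (one_lt_base (m := M + 1) (by omega)) (base_strictMono (Nat.lt_succ_self (M + 1)))
    hlt.le (by rw [← xiJ_eq hn]; exact hx.2)
  have hx1 : xPt n < x := by
    refine (xPt_lt_xi hn1 hn2).trans ((xi_succ_lt_xiJ hn).trans_le (le_trans ?_ hx.1))
    exact (xiJ_strictMono hn1 hn).monotone (by omega)
  have h := isLeast_of_cFin hS hn1 hn hx1 hx.1 hq.1 hq.2 hqx
  rw [qs_eq_of_isLeast h]
  refine ⟨h, ⟨hq.1, lt_of_le_of_ne hq.2 ?_⟩, hqx⟩
  rintro rfl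
  exact hlt.ne hqx

/-- The intervals cover `[ξ_{M+2}, ξ_{M+1})`. -/
lemma locate {n M : ℕ} (hn : n ≤ 2 ^ M) {x : ℝ} (hx : x ∈ Ico (xi n (M + 2)) (xi n (M + 1))) :
    x ∈ Ico (xi n (M + 2)) (xiJ n (M + 1) 1) ∨
      ∃ j, x ∈ Ico (xiJ n (M + 1) (j + 1)) (xiJ n (M + 1) (j + 2)) := by
  classical
  have hex : ∃ j, x < xiJ n (M + 1) (j + 1) :=
    (((tendsto_add_atTop_iff_nat 1).2 (tendsto_xiJ hn)).eventually_const_lt hx.2).exists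
  have hs := Nat.find_spec hex
  rcases h : Nat.find hex with _ | j
  · rw [h] at hs
    exact Or.inl ⟨hx.1, hs⟩
  · have hm := Nat.find_min hex (m := j) (by omega)
    rw [h] at hs
    exact Or.inr ⟨j, not_lt.1 hm, hs⟩

lemma isLeast_qs {n k : ℕ} (hS : S n ∨ n = 1) (hn1 : 1 ≤ n) (hn : n ≤ 2 ^ k) {x : ℝ}
    (hx : x ∈ Ioo (xPt n) (xi n (k + 1))) : IsLeast (univoqueBases x) (qs x) := by
  classical
  have hex : ∃ m, xi n (k + m + 1) ≤ x := by
    have h1 := ((tendsto_add_atTop_iff_nat (k + 1)).2 (tendsto_xi hn)).eventually_lt_const hx.1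
    obtain ⟨m, hm⟩ := h1.exists
    exact ⟨m, by rw [show k + m + 1 = m + (k + 1) by ring]; exact hm.le⟩
  have hs := Nat.find_spec hex
  rcases h : Nat.find hex with _ | m
  · rw [h] at hs
    exact absurd hx.2 (not_lt.2 hs)
  · have hm := Nat.find_min hex (m := m) (by omega)
    rw [h] at hs
    have hn' : n ≤ 2 ^ (k + m) := hn.trans (Nat.pow_le_pow_right (by norm_num) (by omega))
    rcases locate hn' ⟨hs, not_le.1 hm⟩ with h1 | ⟨j, h1⟩
    · exact (qs_first hS hn1 hn' h1).1
    · exact (qs_later hS hn1 hn' h1).1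

/-! ### The shape of `q_s` -/

lemma strictAntiOn_qs {I : Set ℝ} {c : ℕ → Bool} (h : ∀ x ∈ I, 1 < qs x ∧ val (qs x) c = x) :
    StrictAntiOn qs I := by
  intro x hx y hy hxy
  by_contra hle
  have := val_anti (h x hx).1 (not_lt.1 hle) c
  rw [(h x hx).2, (h y hy).2] at this
  linarith

/-- The inverse of a strictly decreasing convex function is convex. -/
lemma convexOn_qs {I : Set ℝ} (hI : Convex ℝ I) {c : ℕ → Bool} {i : ℕ} (hc : c i = true)
    (h : ∀ x ∈ I, 1 < qs x ∧ val (qs x) c = x) : ConvexOn ℝ I qs := by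
  refine ⟨hI, fun x hx y hy a b ha hb hab => ?_⟩
  have hz := h _ (hI hx hy ha hb hab)
  have hv := (convexOn_val c).2 (mem_Ioi.2 (h x hx).1) (mem_Ioi.2 (h y hy).1) ha hb hab
  have h1 : 1 < a • qs x + b • qs y := convex_Ioi (𝕜 := ℝ) 1 (mem_Ioi.2 (h x hx).1)
    (mem_Ioi.2 (h y hy).1) ha hb hab
  by_contra hlt
  have h2 := val_strictAnti h1 (not_le.1 hlt) hc
  simp only [(h x hx).2, (h y hy).2, hz.2] at hv h2
  linarith

/-- Only an inequality for the value of `c` is required, so the same `c` can serve across infinitely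
many intervals accumulating at `β`. -/
lemma tendsto_qs {β r : ℝ} (hr : 1 < r) {c : ℕ → Bool} {i : ℕ} (hc : c i = true)
    (hβ : val r c = β) (h : ∀ᶠ x in 𝓝[<] β, r < qs x ∧ x ≤ val (qs x) c) :
    Tendsto qs (𝓝[<] β) (𝓝 r) := by
  refine tendsto_order.2 ⟨fun a ha => ?_, fun a ha => ?_⟩
  · filter_upwards [h] with x hx
    exact ha.trans hx.1
  · have h1 : val a c < β := by rw [← hβ]; exact val_strictAnti hr ha hc
    filter_upwards [h, Ioo_mem_nhdsLT h1] with x hx hxa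
    by_contra hle
    have := val_anti (hr.trans ha) (not_lt.1 hle) c
    linarith [hx.2, hxa.1]

lemma tendsto_qs_xiJ {n M : ℕ} (hS : S n ∨ n = 1) (hn1 : 1 ≤ n) (hn : n ≤ 2 ^ M) (j : ℕ) :
    Tendsto qs (𝓝[<] (xiJ n (M + 1) (j + 1))) (𝓝 (base (M + 1))) := by
  refine tendsto_qs (one_lt_base (by omega)) (cFin_true hn (j + 1)) (xiJ_eq hn _).symm ?_
  rcases j with _ | j
  · filter_upwards [Ioo_mem_nhdsLT (xi_succ_lt_xiJ hn)] with x hx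
    have := qs_first hS hn1 hn (Ioo_subset_Ico_self hx)
    exact ⟨this.2.1.1, by rw [zero_add, cFin_one, this.2.2]⟩
  · filter_upwards [Ioo_mem_nhdsLT (xiJ_strictMono hn1 hn (show j + 1 < j + 1 + 1 by omega))]
      with x hx
    have := qs_later hS hn1 hn (Ioo_subset_Ico_self hx)
    exact ⟨this.2.1.1, this.2.2.ge⟩

lemma tendsto_qs_xi {n M : ℕ} (hS : S n ∨ n = 1) (hn1 : 1 ≤ n) (hn : n ≤ 2 ^ M) :
    Tendsto qs (𝓝[<] (xi n (M + 1))) (𝓝 (base (M + 1))) := by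
  refine tendsto_qs (one_lt_base (by omega)) (cInf_true hn) (xi_eq hn).symm ?_
  filter_upwards [Ioo_mem_nhdsLT ((xi_succ_lt_xiJ hn).trans (xiJ_lt_xi hn1 hn 1))] with x hx
  have key : ∀ j, base (M + 1) < qs x → qs x ≤ base (M + 2) → val (qs x) (cFin n M j) = x →
      x ≤ val (qs x) (cInf n M) := fun j h1 h2 h3 => by
    conv_lhs => rw [← h3]
    exact (val_cFin_lt_cInf ((one_le_base _).trans_lt h1) (h2.trans_lt (base_lt_two _))
      ((base_strictMono.monotone (Nat.le_succ M)).trans h1.le) hn1 hn j).le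
  rcases locate hn (Ioo_subset_Ico_self hx) with h | ⟨j, h⟩
  · obtain ⟨-, h1, h2⟩ := qs_first hS hn1 hn h
    exact ⟨h1.1, key 1 h1.1 h1.2 (by rw [cFin_one, h2])⟩
  · obtain ⟨-, h1, h2⟩ := qs_later hS hn1 hn h
    exact ⟨h1.1, key _ h1.1 h1.2.le h2⟩

lemma mem_Ico_xiJ {n M : ℕ} (hn1 : 1 ≤ n) (hn : n ≤ 2 ^ M) (j : ℕ) :
    xiJ n (M + 1) (j + 1) ∈ Ico (xiJ n (M + 1) (j + 1)) (xiJ n (M + 1) (j + 2)) :=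
  ⟨le_rfl, xiJ_strictMono hn1 hn (by omega)⟩

lemma qs_xiJ_strictAntiOn {n M : ℕ} (hS : S n ∨ n = 1) (hn1 : 1 ≤ n) (hn : n ≤ 2 ^ M) :
    StrictAntiOn (fun j => qs (xiJ n (M + 1) j)) (Ici 1) := by
  refine strictAntiOn_of_succ_lt_self fun j hj => ?_
  obtain ⟨i, rfl⟩ : ∃ i, j = i + 1 := ⟨j - 1, by omega⟩
  obtain ⟨-, h1, h2⟩ := qs_later hS hn1 hn (mem_Ico_xiJ hn1 hn i)
  obtain ⟨-, h3, h4⟩ := qs_later hS hn1 hn (mem_Ico_xiJ hn1 hn (i + 1))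
  -- In the base `qs (xiJ n (M + 1) (i + 1))` the previous sequence `cFin n M (i + 2)` has exactly
  -- the value `xiJ n (M + 1) (i + 1)`, and the next increment is smaller than the increment of
  -- `xiJ`.
  have h5 : val (qs (xiJ n (M + 1) (i + 1))) (cFin n M (i + 3)) < xiJ n (M + 1) (i + 2) := by
    obtain ⟨a, rfl⟩ : ∃ a, n = a + 1 := ⟨n - 1, by omega⟩
    have := val_cFin_sub_lt h1.1 hn (i + 1)
    rw [← xiJ_eq hn, ← xiJ_eq hn] at this
    linarith
  by_contra hle
  have h6 := val_anti ((one_le_base _).trans_lt h1.1) (not_lt.1 hle) (cFin n M (i + 3))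
  have h7 : val (qs (xiJ n (M + 1) (i + 1 + 1))) (cFin n M (i + 3)) = xiJ n (M + 1) (i + 2) := h4
  linarith

lemma tendsto_qs_comp_xiJ {n M : ℕ} (hS : S n ∨ n = 1) (hn1 : 1 ≤ n) (hn : n ≤ 2 ^ M) :
    Tendsto (fun j => qs (xiJ n (M + 1) j)) atTop (𝓝 (base (M + 1))) :=
  (tendsto_qs_xi hS hn1 hn).comp (tendsto_nhdsWithin_iff.2
    ⟨tendsto_xiJ hn, Eventually.of_forall fun j => xiJ_lt_xi hn1 hn j⟩)

/-! ### The half-line -/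

lemma xPt_one : xPt 1 = 1 := val_qKL

lemma xi_one_one : xi 1 1 = (1 + √5) / 2 := by
  have hb := one_lt_base (le_refl 1)
  rw [xi_eq (M := 0) (by norm_num), zero_add, ← base_one]
  have h1 : cInf 1 0 = fun i => !(fun _ => false : ℕ → Bool) i := by
    ext i; simp [cInf, twist, vInf, Nat.mod_one]
  have h2 : val (base 1) (fun _ => false) = 0 := by rw [val_eq_tsum]; simp
  have h3 := pp_base_two_pow 1
  rw [pow_one, pp_two] at h3
  rw [h1, val_not hb, h2, sub_zero, div_eq_iff (by linarith)]
  linarith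

lemma isLeast_one : IsLeast (univoqueBases 1) qKL := by
  have hU := uni_tauTail (le_refl 1)
  refine ⟨mem_univoqueBases.2 ⟨one_lt_qKL, qKL_lt_two.le, _, hU, val_qKL⟩, fun p hp => ?_⟩
  obtain ⟨hp1, hp2, d, hd, hdx⟩ := mem_univoqueBases.1 hp
  by_contra hlt
  rw [not_le] at hlt
  obtain ⟨j, h1, h2, h3⟩ := lexLt_of_lt_base hp1 hlt hU (hdx.trans val_qKL.symm)
    (by rw [hdx]; exact one_pos)
  -- A drop below the whole Thue–Morse tail at index `j` lies inside τ₁…τ_{2^{j+1}}, so the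
  -- finite-level estimate applies.
  have hb : Below 1 (j + 1) d := ⟨j, by rw [add_comm]; exact Nat.lt_two_pow_self.le, h1, h2, h3⟩
  have := hd.val_lt_xPt (Or.inr rfl) Nat.one_le_two_pow hp1 hb
  rw [xPt_one] at this
  linarith

lemma isLeast_of_base_one_le {x : ℝ} (hx : base 1 ≤ x) : IsLeast (univoqueBases x) (1 + 1 / x) := by
  have hb := one_lt_base (le_refl 1)
  have hx0 : 0 < x := by linarith
  have hb2 : base 1 * (base 1 - 1) - 1 = 0 := by
    have := pp_base_two_pow 1
    rwa [pow_one, pp_two] at this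
  have hle : 1 + 1 / x ≤ base 1 := by
    have : 1 / x ≤ 1 / base 1 := by gcongr
    have : 1 / base 1 = base 1 - 1 := by rw [div_eq_iff (by linarith)]; linarith
    linarith
  have hq1 : 1 < 1 + 1 / x := by have : 0 < 1 / x := by positivity
                                 linarith
  have hzero : ∀ q, val q (fun _ => false) = 0 := fun q => by rw [val_eq_tsum]; simp
  have hone : ∀ q, 1 < q → val q (fun _ => true) = 1 / (q - 1) := fun q hq => by
    have := val_not hq (fun _ => false)
    rw [hzero, sub_zero] at this
    simpa using this
  refine ⟨mem_univoqueBases.2 ⟨hq1, hle.trans (base_lt_two 1).le, fun _ => true, fun i => ?_, ?_⟩,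
    fun p hp => ?_⟩
  · have : dd (fun _ => true) i = fun _ => false := by ext j; simp [dd]
    rw [this, hzero]
    exact one_pos
  · rw [hone _ hq1]; simp
  · obtain ⟨hp1, hp2, d, hd, hdx⟩ := mem_univoqueBases.1 hp
    by_contra hlt
    rw [not_le] at hlt
    -- Every smaller base lies below the golden ratio, where only 0^∞ and 1^∞ are univoque.
    have hc := hd.eq_const hp1 (hlt.le.trans hle)
    rcases h0 : d 0 with _ | _
    · have : d = fun _ => false := by ext i; rw [hc i, h0]
      rw [this, hzero] at hdx
      linarith
    · have : d = fun _ => true := by ext i; rw [hc i, h0]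
      rw [this, hone _ hp1] at hdx
      have : p = 1 + 1 / x := by rw [← hdx, one_div_one_div]; ring
      linarith

end UnivoqueBase

/-! ### The theorem, with m = M + 1. -/

open UnivoqueBase Set Filter Topology in
theorem theorem6p2 :
    -- the constants are well defined
    (klBases = {qKL} ∧ ∀ m : ℕ, 1 ≤ m → hatBases m = {qhat m}) ∧
    -- the cascades
    (∀ n k : ℕ, (S n ∨ n = 1) → 2 ^ k < 2 * n → n ≤ 2 ^ k →
      -- the location of the points
      (StrictAntiOn (xi n) (Ioi k) ∧
        Tendsto (xi n) atTop (𝓝 (xPt n)) ∧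
        ∀ m : ℕ, k < m →
          xi n (m + 1) < xiJ n m 1 ∧
          StrictMonoOn (xiJ n m) (Ici 1) ∧
          Tendsto (xiJ n m) atTop (𝓝 (xi n m))) ∧
      -- the values of `q_s`
      (∀ x ∈ Ioo (xPt n) (xi n (k + 1)), IsLeast (univoqueBases x) (qs x)) ∧
      (∀ m : ℕ, k < m →
        (∀ x ∈ Ico (xi n (m + 1)) (xiJ n m 1),
          qs x ∈ Ioc (qhat m) (qhat (m + 1)) ∧
          val (qs x) (wordThen (tauWord n (2 ^ m)) (periodic (block m))) = x ∧
          ∀ q ∈ Ioc (qhat m) (qhat (m + 1)),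
            val q (wordThen (tauWord n (2 ^ m)) (periodic (block m))) = x → q = qs x) ∧
        qs (xi n (m + 1)) = qhat (m + 1) ∧
        (∀ j : ℕ, 2 ≤ j → ∀ x ∈ Ico (xiJ n m (j - 1)) (xiJ n m j),
          qs x ∈ Ioo (qhat m) (qhat (m + 1)) ∧
          val (qs x) (cSeq n m j) = x ∧
          ∀ q ∈ Ioo (qhat m) (qhat (m + 1)), val q (cSeq n m j) = x → q = qs x)) ∧
      -- the shape of `q_s`
      (∀ m : ℕ, k < m →
        (StrictAntiOn qs (Ico (xi n (m + 1)) (xiJ n m 1)) ∧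
          ConvexOn ℝ (Ico (xi n (m + 1)) (xiJ n m 1)) qs) ∧
        (∀ j : ℕ, 2 ≤ j →
          StrictAntiOn qs (Ico (xiJ n m (j - 1)) (xiJ n m j)) ∧
          ConvexOn ℝ (Ico (xiJ n m (j - 1)) (xiJ n m j)) qs) ∧
        StrictAntiOn (fun j : ℕ => qs (xiJ n m j)) (Ici 1) ∧
        Tendsto (fun j : ℕ => qs (xiJ n m j)) atTop (𝓝 (qhat m)) ∧
        (∀ j : ℕ, 1 ≤ j →
          Tendsto qs (𝓝[<] (xiJ n m j)) (𝓝 (qhat m)) ∧ qhat m < qs (xiJ n m j)) ∧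
        Tendsto qs (𝓝[<] (xi n m)) (𝓝 (qhat m)) ∧
        qs (xi n m) = qhat m)) ∧
    -- the half-line `[1, ∞)`: with `n = 1`, `k = 0` the above covers `(1, q_G)`
    (xPt 1 = 1 ∧ xi 1 1 = (1 + √5) / 2 ∧
      qs 1 = qKL ∧ IsLeast (univoqueBases 1) (qs 1) ∧
      ∀ x : ℝ, (1 + √5) / 2 ≤ x →
        qs x = 1 + 1 / x ∧ IsLeast (univoqueBases x) (qs x)) := by
  refine ⟨⟨klBases_eq, fun m hm => by rw [hatBases_eq_base hm, qhat_eq_base hm]⟩, ?_, xPt_one,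
    xi_one_one, qs_eq_of_isLeast isLeast_one, ?_, fun x hx => ?_⟩
  · intro n k hS _ hn
    have hn1 : 1 ≤ n := hS.elim (fun h => h.one_lt.le) fun h => h.ge
    have pred : ∀ m, k < m → ∃ M, m = M + 1 ∧ n ≤ 2 ^ M := fun m hm =>
      ⟨m - 1, by omega, hn.trans (Nat.pow_le_pow_right (by norm_num) (by omega))⟩
    refine ⟨⟨xi_strictAntiOn hn1 hn, tendsto_xi hn, fun m hm => ?_⟩,
      fun x hx => isLeast_qs hS hn1 hn hx, fun m hm => ?_, fun m hm => ?_⟩ <;>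
    obtain ⟨M, rfl, hM⟩ := pred m hm
    · exact ⟨xi_succ_lt_xiJ hM, (xiJ_strictMono hn1 hM).strictMonoOn _, tendsto_xiJ hM⟩
    · have hM' := le_two_pow_succ hM
      have h1 : ∀ {q}, base (M + 1) < q → 1 < q := fun h => (one_le_base _).trans_lt h
      rw [qhat_eq_base (by omega), qhat_eq_base (by omega), cSeqInf_eq hM']
      refine ⟨fun x hx => ?_, qs_eq_of_isLeast (qs_xi hS hn1 hM'), fun j hj x hx => ?_⟩
      · obtain ⟨-, h2, h3⟩ := qs_first hS hn1 hM hx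
        exact ⟨h2, h3, fun q hq hqx =>
          val_injOn (h1 hq.1) (h1 h2.1) (cInf_true hM') (hqx.trans h3.symm)⟩
      · obtain ⟨i, rfl⟩ : ∃ i, j = i + 2 := ⟨j - 2, by omega⟩
        obtain ⟨-, h2, h3⟩ := qs_later hS hn1 hM hx
        rw [cSeq_eq hM]
        exact ⟨h2, h3, fun q hq hqx =>
          val_injOn (h1 hq.1) (h1 h2.1) (cFin_true hM _) (hqx.trans h3.symm)⟩
    · have h1 : ∀ {q}, base (M + 1) < q → 1 < q := fun h => (one_le_base _).trans_lt h
      rw [qhat_eq_base (by omega)]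
      have hf : ∀ x ∈ Ico (xi n (M + 2)) (xiJ n (M + 1) 1),
          1 < qs x ∧ val (qs x) (cInf n (M + 1)) = x := fun x hx =>
        have h := qs_first hS hn1 hM hx
        ⟨h1 h.2.1.1, h.2.2⟩
      have hl : ∀ i, ∀ x ∈ Ico (xiJ n (M + 1) (i + 1)) (xiJ n (M + 1) (i + 2)),
          1 < qs x ∧ val (qs x) (cFin n M (i + 2)) = x := fun i x hx =>
        have h := qs_later hS hn1 hM hx
        ⟨h1 h.2.1.1, h.2.2⟩
      refine ⟨⟨strictAntiOn_qs hf, convexOn_qs (convex_Ico _ _) (cInf_true (le_two_pow_succ hM)) hf⟩,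
        fun j hj => ?_, qs_xiJ_strictAntiOn hS hn1 hM, tendsto_qs_comp_xiJ hS hn1 hM,
        fun j hj => ?_, tendsto_qs_xi hS hn1 hM, qs_eq_of_isLeast (qs_xi hS hn1 hM)⟩
      · obtain ⟨i, rfl⟩ : ∃ i, j = i + 2 := ⟨j - 2, by omega⟩
        exact ⟨strictAntiOn_qs (hl i), convexOn_qs (convex_Ico _ _) (cFin_true hM _) (hl i)⟩
      · obtain ⟨i, rfl⟩ : ∃ i, j = i + 1 := ⟨j - 1, by omega⟩
        exact ⟨tendsto_qs_xiJ hS hn1 hM i, (qs_later hS hn1 hM (mem_Ico_xiJ hn1 hM i)).2.1.1⟩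
  · rw [qs_eq_of_isLeast isLeast_one]
    exact isLeast_one
  · rw [← base_one] at hx
    have h := isLeast_of_base_one_le hx
    rw [qs_eq_of_isLeast h]
    exact ⟨rfl, h⟩
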